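/- Work over $\mathbb F_2$. Let $\mathfrak{sl}_2(\wedge)_{dg}$ be the $\mathbb Z$-graded Lie superalgebra with basis $e,f,h$ (degree $0$), $v_2,v_{-2},\tilde v_0,d,D$ (degree $1$), $x$ (degree $2$), whose only nonzero brackets of basis elements are, up to symmetry, $[e,f]=h$, $[e,v_{-2}]=[f,v_2]=\tilde v_0$, $[v_2,v_{-2}]=[d,D]=x$. Regard it as an $L_\infty$-algebra with $l_1=[d,\cdot\,]$, $l_2=[\cdot,\cdot]$ and $l_n=0$ for $n\ge 3$ (cohomological grading). For a diagram $P$ of an oriented link in the thickened annulus, let $\mathrm{CKh}(P)$ be the $\mathbb F_2$-vector space spanned by the Khovanov generators (a complete resolution of $P$, with each circle labelled $+$ or $-$), with the homological grading. Let $k$ be the winding number grading (the number of nontrivial circles labelled $+$ minus the number of nontrivial circles labelled $-$, a circle being nontrivial if it separates the two boundary components of the annulus). Write the Khovanov differential as $\partial=\partial_0+\partial_-$ and the Lee differential as $\partial^{Lee}=\partial^{Lee}_0+\partial^{Lee}_+$, where the subscripts $0,-,+$ mark the parts that preserve, decrease and increase $k$. Let $e,f,h$ act on each resolution through the tensor product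 of the defining representations of $\mathfrak{sl}_2$ for the nontrivial circles and trivial representations for the trivial circles; let $v_2,v_{-2},d,D$ act by $\partial^{Lee}_+,\partial_-,\partial_0,\partial^{Lee}_0$; and let $\tilde v_0$ and $x$ act by the commutators $[e,v_{-2}]$ and $[v_2,v_{-2}]$. With $k_1=\partial_0$, with this action as $k_2$, and with $k_n=0$ for $n\ge 3$, $\mathrm{CKh}(P)$ is an $L_\infty$-module over $\mathfrak{sl}_2(\wedge)_{dg}$. **Theorem.** This $L_\infty$-module structure is invariant under Reidemeister II up to $L_\infty$-quasi-isomorphism: if two annular link diagrams $P$ and $P'$ differ by a Reidemeister II move, then there are $L_\infty$-module homomorphisms $\mathrm{CKh}(P)\to\mathrm{CKh}(P')$ and $\mathrm{CKh}(P')\to\mathrm{CKh}(P)$ over $\mathfrak{sl}_2(\wedge)_{dg}$ whose first components are quasi-isomorphisms of complexes. -/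

import Mathlib

/-! # `L_∞`-algebras and `L_∞`-modules over the field with two elements

All signs are trivial in characteristic two.  Gradings are cohomological: `l_n` and `k_n` have degree
`2 - n` and the `n`-th component of a module homomorphism has degree `1 - n`. -/

/-- The ground field. -/
abbrev F2 := ZMod 2

/-- The entries of `x` at the positions in `I`, in increasing order.  An `(i, n - i)`-unshuffle `σ` of
`n` letters is the same thing as the `i`-element set `I = {σ 1, …, σ i}`, and `σ` rearranges `x` into
`restrict x I` followed by `restrict x Iᶜ`. -/
def restrict {V : Type*} {n : ℕ} (x : Fin n → V) (I : Finset (Fin n)) : Fin I.card → V :=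
  fun a => x (I.orderEmbOfFin rfl a)

/-- A family of submodules indexed by `ℤ` with a multilinear `n`-ary operation for every `n`
(the operation with `n = 0` plays no role). -/
structure LInfAlgebraData (V : Type*) [AddCommGroup V] [Module F2 V] where
  gr : ℤ → Submodule F2 V
  op : ∀ n : ℕ, MultilinearMap F2 (fun _ : Fin n => V) V

/-- The data form an `L_∞`-algebra. -/
structure LInfAlgebraData.IsLInfAlgebra {V : Type*} [AddCommGroup V] [Module F2 V]
    (A : LInfAlgebraData V) : Prop where
  internal : DirectSum.IsInternal A.gr
  symm : ∀ (n : ℕ) (x : Fin n → V) (σ : Equiv.Perm (Fin n)), A.op n (x ∘ σ) = A.op n x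
  degree : ∀ (n : ℕ), 1 ≤ n → ∀ (x : Fin n → V) (d : Fin n → ℤ), (∀ i, x i ∈ A.gr (d i)) →
    A.op n x ∈ A.gr (∑ i, d i + 2 - n)
  jacobi : ∀ (n : ℕ) (x : Fin n → V),
    ∑ I : Finset (Fin n) with I.Nonempty,
      A.op (Iᶜ.card + 1)
        (Fin.cons (A.op I.card (restrict x I)) (restrict x Iᶜ) : Fin (Iᶜ.card + 1) → V) = 0

/-- A family of submodules of `M` indexed by `ℤ` with operations `V^{⊗ a} ⊗ M → M`; here `op a` is
the operation usually written `k_{a+1}`, with `a` arguments in `V` and one in `M`. -/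
structure LInfModuleData (V M : Type*) [AddCommGroup V] [Module F2 V]
    [AddCommGroup M] [Module F2 M] where
  gr : ℤ → Submodule F2 M
  op : ∀ a : ℕ, MultilinearMap F2 (fun _ : Fin a => V) (M →ₗ[F2] M)

/-- The data form an `L_∞`-module over `A`. -/
structure LInfModuleData.IsLInfModule {V M : Type*} [AddCommGroup V] [Module F2 V]
    [AddCommGroup M] [Module F2 M] (K : LInfModuleData V M) (A : LInfAlgebraData V) : Prop where
  internal : DirectSum.IsInternal K.gr
  symm : ∀ (a : ℕ) (x : Fin a → V) (σ : Equiv.Perm (Fin a)), K.op a (x ∘ σ) = K.op a x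
  degree : ∀ (a : ℕ) (x : Fin a → V) (d : Fin a → ℤ) (m : M) (e : ℤ),
    (∀ i, x i ∈ A.gr (d i)) → m ∈ K.gr e → K.op a x m ∈ K.gr (∑ i, d i + e + 1 - a)
  relation : ∀ (a : ℕ) (x : Fin a → V) (m : M),
    (∑ I : Finset (Fin a) with I.Nonempty,
      K.op (Iᶜ.card + 1)
        (Fin.cons (A.op I.card (restrict x I)) (restrict x Iᶜ) : Fin (Iᶜ.card + 1) → V) m)
    + ∑ I : Finset (Fin a), K.op Iᶜ.card (restrict x Iᶜ) (K.op I.card (restrict x I) m) = 0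

/-- The operation `k_1`. -/
def LInfModuleData.differential {V M : Type*} [AddCommGroup V] [Module F2 V]
    [AddCommGroup M] [Module F2 M] (K : LInfModuleData V M) : M →ₗ[F2] M := K.op 0 ![]

/-- An `L_∞`-module homomorphism `K → K'` over `A`; `map a` is the component usually written
`h_{a+1}`, with `a` arguments in `V` and one in `M`. -/
structure LInfModuleHom {V M M' : Type*} [AddCommGroup V] [Module F2 V]
    [AddCommGroup M] [Module F2 M] [AddCommGroup M'] [Module F2 M']
    (A : LInfAlgebraData V) (K : LInfModuleData V M) (K' : LInfModuleData V M') where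
  map : ∀ a : ℕ, MultilinearMap F2 (fun _ : Fin a => V) (M →ₗ[F2] M')
  symm : ∀ (a : ℕ) (x : Fin a → V) (σ : Equiv.Perm (Fin a)), map a (x ∘ σ) = map a x
  degree : ∀ (a : ℕ) (x : Fin a → V) (d : Fin a → ℤ) (m : M) (e : ℤ),
    (∀ i, x i ∈ A.gr (d i)) → m ∈ K.gr e → map a x m ∈ K'.gr (∑ i, d i + e - a)
  relation : ∀ (a : ℕ) (x : Fin a → V) (m : M),
    (∑ I : Finset (Fin a) with I.Nonempty,
      map (Iᶜ.card + 1)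
        (Fin.cons (A.op I.card (restrict x I)) (restrict x Iᶜ) : Fin (Iᶜ.card + 1) → V) m)
    + (∑ I : Finset (Fin a), map Iᶜ.card (restrict x Iᶜ) (K.op I.card (restrict x I) m))
    + ∑ I : Finset (Fin a), K'.op I.card (restrict x I) (map Iᶜ.card (restrict x Iᶜ) m) = 0

/-- An `L_∞`-module homomorphism is a quasi-isomorphism if its first component, which is a chain map
for the differentials `k_1`, induces an injective and surjective map on homology. -/
def LInfModuleHom.IsQuasiIso {V M M' : Type*} [AddCommGroup V] [Module F2 V]
    [AddCommGroup M] [Module F2 M] [AddCommGroup M'] [Module F2 M']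
    {A : LInfAlgebraData V} {K : LInfModuleData V M} {K' : LInfModuleData V M'}
    (h : LInfModuleHom A K K') : Prop :=
  (∀ z : M, K.differential z = 0 → (∃ y, h.map 0 ![] z = K'.differential y) →
      ∃ y, z = K.differential y) ∧
  (∀ w : M', K'.differential w = 0 →
      ∃ z, K.differential z = 0 ∧ ∃ y, w = h.map 0 ![] z + K'.differential y)

/-- The grading on functions `ι → F2` in which the basis vector of `b` has degree `deg b`. -/
def basisGrading {ι : Type*} (deg : ι → ℤ) (n : ℤ) : Submodule F2 (ι → F2) where
  carrier := {m | ∀ b, m b ≠ 0 → deg b = n}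
  zero_mem' := by intro b hb; exact absurd rfl hb
  add_mem' := by
    intro m m' hm hm' b hb
    by_cases h : m b = 0
    · exact hm' b (fun h' => hb (by simp [h, h']))
    · exact hm b h
  smul_mem' := by
    intro c m hm b hb
    exact hm b (fun h => hb (by simp [h]))

/-! # The Lie superalgebra `sl₂(∧)_dg` over the field with two elements -/

/-- The basis `e, f, h, v₂, v₋₂, ṽ₀, d, D, x` of `sl₂(∧)_dg`. -/
inductive SlBasis
  | e | f | h | v2 | vm2 | v0 | d | D | x
  deriving DecidableEq

instance : Fintype SlBasis where
  elems := {.e, .f, .h, .v2, .vm2, .v0, .d, .D, .x}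
  complete := by intro b; cases b <;> decide

namespace SlBasis

/-- The grading of `sl₂(∧)_dg`. -/
def deg : SlBasis → ℤ
  | e => 0 | f => 0 | h => 0
  | v2 => 1 | vm2 => 1 | v0 => 1 | d => 1 | D => 1
  | x => 2

/-- The super Lie bracket of basis elements, reduced modulo two.  Over the integers the nonzero
brackets are, up to (super) skew-symmetry, `[e,f] = h`, `[h,e] = 2e`, `[h,f] = -2f`,
`[h,v₂] = 2v₂`, `[h,v₋₂] = -2v₋₂`, `[e,v₋₂] = ṽ₀ = -[f,v₂]`, `[e,ṽ₀] = -2v₂`, `[f,ṽ₀] = 2v₋₂`,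
`[v₂,v₋₂] = x = -[d,D]` and `[ṽ₀,ṽ₀] = 2x`. -/
def bracket : SlBasis → SlBasis → (SlBasis → F2)
  | e, f => Pi.single h 1
  | f, e => Pi.single h 1
  | e, vm2 => Pi.single v0 1
  | vm2, e => Pi.single v0 1
  | f, v2 => Pi.single v0 1
  | v2, f => Pi.single v0 1
  | v2, vm2 => Pi.single x 1
  | vm2, v2 => Pi.single x 1
  | d, D => Pi.single x 1
  | D, d => Pi.single x 1
  | _, _ => 0

end SlBasis

/-- The underlying vector space of `sl₂(∧)_dg`. -/
abbrev Sl2dg := SlBasis → F2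

/-- The bilinear super Lie bracket of `sl₂(∧)_dg`. -/
noncomputable def Sl2dg.bracket : Sl2dg →ₗ[F2] Sl2dg →ₗ[F2] Sl2dg :=
  (Pi.basisFun F2 SlBasis).constr F2 fun a =>
    (Pi.basisFun F2 SlBasis).constr F2 fun b => SlBasis.bracket a b

/-- `sl₂(∧)_dg` as a differential graded Lie superalgebra, that is, as an `L_∞`-algebra without higher
operations: `l_1 = [d, ·]` and `l_2 = [·, ·]`. -/
noncomputable def sl2dg : LInfAlgebraData Sl2dg where
  gr := basisGrading SlBasis.deg
  op
    | 1 => MultilinearMap.ofSubsingleton F2 Sl2dg Sl2dg (0 : Fin 1)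
        (Sl2dg.bracket (Pi.single SlBasis.d 1))
    | 2 =>
      { toFun := fun y => Sl2dg.bracket (y 0) (y 1)
        map_update_add' := by intro _ m i y z; fin_cases i <;> simp
        map_update_smul' := by intro _ m i c y; fin_cases i <;> simp }
    | _ => 0

/-! # Annular link diagrams -/

/-- The half-edges of a diagram with set of crossings `X` and set of markers `M`.  Every crossing has
four half-edges, numbered `0, 1, 2, 3` counterclockwise, where `0` and `2` belong to the strand that
passes under and `1` and `3` to the strand that passes over.  A marker is a point in the interior of an
edge, or on a circle without crossings; it has two half-edges. -/
abbrev HalfEdge (X M : Type) := (X × ZMod 4) ⊕ (M × Bool)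

/-- The counterclockwise rotation at each vertex. -/
def rotate {X M : Type} : HalfEdge X M → HalfEdge X M
  | .inl (x, k) => .inl (x, k + 1)
  | .inr (p, s) => .inr (p, !s)

/-- A (generic) diagram of an oriented link in the thickened annulus, seen in the sphere minus the two
points `𝕏` and `𝕆`, together with an arc from `𝕏` to `𝕆` that is transverse to the diagram and misses
all vertices.  The diagram is recorded as a combinatorial map: a four-valent graph with a rotation at
each vertex; the markers are auxiliary two-valent vertices, so that circles without crossings and
subdivided edges are allowed.  The diagram may be disconnected.  How the connected components lie
with respect to `𝕏` and `𝕆` is recorded by the arc; no Kauffman state depends on more. -/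
structure AnnularDiagram where
  Crossing : Type
  Marker : Type
  [finiteCrossing : Finite Crossing]
  [finiteMarker : Finite Marker]
  /-- the other half of the same edge -/
  opp : HalfEdge Crossing Marker → HalfEdge Crossing Marker
  opp_opp : ∀ a, opp (opp a) = a
  opp_ne : ∀ a, opp a ≠ a
  /-- the orientation: whether the half-edge points away from its vertex -/
  out : HalfEdge Crossing Marker → Bool
  out_opp : ∀ a, out (opp a) = !out a
  out_crossing : ∀ x k, out (.inl (x, k + 2)) = !out (.inl (x, k))
  out_marker : ∀ p s, out (.inr (p, !s)) = !out (.inr (p, s))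
  /-- the number, modulo two, of intersections of the half-edge with the arc from `𝕏` to `𝕆` -/
  cut : HalfEdge Crossing Marker → F2
  /-- The connected components of the graph lie on spheres: the numbers `V`, `E`, `F`, `C` of vertices,
  edges, faces and components satisfy `V - E + F = 2C`, where `V - E` is minus the number of
  crossings. The faces are the orbits of the composition of `opp` and `rotate`. -/
  planar : Nat.card (Quot fun a b => b = rotate (opp a)) =
    Nat.card Crossing + 2 * Nat.card (Quot fun a b => b = opp a ∨ b = rotate a)
  /-- The boundary of a face of a connected component meets the arc an odd number of times only if the
  face contains exactly one of `𝕏` and `𝕆`: each component has at most two such faces. -/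
  arc : ∀ c : Quot (fun a b => b = opp a ∨ b = rotate a),
    {F : Quot (fun a b => b = rotate (opp a)) |
      (∃ a, Quot.mk _ a = F ∧ Quot.mk _ a = c) ∧
      ∑ᶠ a ∈ {a | Quot.mk _ a = F}, (cut a + cut (opp a)) = 1}.ncard ≤ 2

attribute [instance] AnnularDiagram.finiteCrossing AnnularDiagram.finiteMarker

namespace AnnularDiagram

/-- The half-edges of `D`. -/
abbrev Half (D : AnnularDiagram) := HalfEdge D.Crossing D.Marker

/-- A vertex of the cube of resolutions: `false` is the `0`-resolution, `true` the `1`-resolution. -/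
abbrev State (D : AnnularDiagram) := D.Crossing → Bool

/-- How half-edges are joined at the vertices in a resolution: at a crossing the `0`-resolution joins
`0` with `1` and `2` with `3` (so that it joins the regions swept out by the upper strand when it is
turned counterclockwise), and the `1`-resolution joins `1` with `2` and `3` with `0`. -/
def smooth (D : AnnularDiagram) (v : D.State) : D.Half → D.Half
  | .inl (x, k) => .inl (x, if v x then 3 - k else 1 - k)
  | .inr (p, s) => .inr (p, !s)

/-- The circles of a resolution. -/
abbrev Circle (D : AnnularDiagram) (v : D.State) : Type :=
  Quot fun a b : D.Half => b = D.opp a ∨ b = D.smooth v a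

/-- The circle through a half-edge. -/
abbrev circ (D : AnnularDiagram) (v : D.State) (a : D.Half) : D.Circle v := Quot.mk _ a

/-- A circle is nontrivial if it separates `𝕏` from `𝕆`, that is, if it meets the arc from `𝕏` to `𝕆` an
odd number of times. -/
def Nontrivial (D : AnnularDiagram) {v : D.State} (c : D.Circle v) : Prop :=
  ∑ᶠ a ∈ {a | D.circ v a = c}, D.cut a = 1

/-- The Khovanov generators: a resolution with each circle labelled `+` (`true`) or `-` (`false`). -/
abbrev Gen (D : AnnularDiagram) : Type := Σ v : D.State, (D.Circle v → Bool)

/-- The label of the circle through a half-edge. -/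
def label {D : AnnularDiagram} (g : D.Gen) (a : D.Half) : Bool := g.2 (D.circ g.1 a)

/-- The number of negative crossings. -/
noncomputable def negCrossings (D : AnnularDiagram) : ℕ :=
  Nat.card {x : D.Crossing // D.out (.inl (x, 0)) = D.out (.inl (x, 1))}

/-- The homological grading. -/
noncomputable def homDeg (D : AnnularDiagram) (g : D.Gen) : ℤ :=
  (Nat.card {x : D.Crossing // g.1 x = true} : ℤ) - D.negCrossings

open Classical in
/-- The winding number grading: the number of nontrivial circles labelled `+` minus the number of
nontrivial circles labelled `-`. -/
noncomputable def windDeg (D : AnnularDiagram) (g : D.Gen) : ℤ :=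
  ∑ᶠ c : D.Circle g.1, if D.Nontrivial c then (if g.2 c then 1 else -1) else 0

/-- An edge of the cube of resolutions changes one crossing from the `0`- to the `1`-resolution and
keeps the labels of all circles that do not touch this crossing.  If two circles with labels `a` and `b`
are merged into a circle with label `c`, then `merge a b c` is required; if a circle with label `a` is
split into circles with labels `b` and `c`, then `split a b c` is required. -/
def CubeEdge (D : AnnularDiagram) (merge split : Bool → Bool → Bool → Prop) (g g' : D.Gen) : Prop :=
  ∃ x : D.Crossing, g.1 x = false ∧ g'.1 x = true ∧ (∀ y, y ≠ x → g'.1 y = g.1 y) ∧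
    (∀ a, (∀ k, D.circ g.1 a ≠ D.circ g.1 (.inl (x, k))) → label g' a = label g a) ∧
    ((D.circ g.1 (.inl (x, 0)) ≠ D.circ g.1 (.inl (x, 2)) ∧
        merge (label g (.inl (x, 0))) (label g (.inl (x, 2))) (label g' (.inl (x, 0)))) ∨
      (D.circ g.1 (.inl (x, 0)) = D.circ g.1 (.inl (x, 2)) ∧
        D.circ g'.1 (.inl (x, 0)) ≠ D.circ g'.1 (.inl (x, 2)) ∧
        split (label g (.inl (x, 0))) (label g' (.inl (x, 0))) (label g' (.inl (x, 2)))))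

/-- The coefficients of the Khovanov differential: merging sends `+ +` to `+`, and `+ -` and `- +` to
`-`, and `- -` to zero; splitting sends `+` to the sum of `+ -` and `- +`, and `-` to `- -`. -/
def KhovanovEdge (D : AnnularDiagram) : D.Gen → D.Gen → Prop :=
  D.CubeEdge
    (fun a b c => (a, b, c) ∈ ({(true, true, true), (true, false, false), (false, true, false)} :
      Set (Bool × Bool × Bool)))
    (fun a b c => (a, b, c) ∈ ({(true, true, false), (true, false, true), (false, false, false)} :
      Set (Bool × Bool × Bool)))

/-- The coefficients of the Lee differential: merging sends `- -` to `+`, splitting sends `-` to `+ +`,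
and everything else is sent to zero. -/
def LeeEdge (D : AnnularDiagram) : D.Gen → D.Gen → Prop :=
  D.CubeEdge
    (fun a b c => (a, b, c) ∈ ({(false, false, true)} : Set (Bool × Bool × Bool)))
    (fun a b c => (a, b, c) ∈ ({(false, true, true)} : Set (Bool × Bool × Bool)))

/-- `g'` arises from `g` by changing the label of one nontrivial circle from `s` to `!s`. -/
def LabelChange (D : AnnularDiagram) (s : Bool) (g g' : D.Gen) : Prop :=
  g'.1 = g.1 ∧ ∃ a, D.Nontrivial (D.circ g.1 a) ∧ label g a = s ∧ label g' a = !s ∧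
    ∀ b, D.circ g.1 b ≠ D.circ g.1 a → label g' b = label g b

/-- The underlying vector space of the Khovanov complex `CKh(D)`. -/
abbrev Chain (D : AnnularDiagram) := D.Gen → F2

noncomputable instance (D : AnnularDiagram) : Fintype D.Gen := Fintype.ofFinite _

open Classical in
/-- The linear map that sends the basis vector of `g` to the sum of the basis vectors of those `g'`
with `R g g'`. -/
noncomputable def linOfRel (D : AnnularDiagram) (R : D.Gen → D.Gen → Prop) :
    Module.End F2 D.Chain :=
  Matrix.mulVecLin (Matrix.of fun g' g => if R g g' then (1 : F2) else 0)

/-- `∂_0`, the part of the Khovanov differential that preserves the winding number grading. -/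
noncomputable def dZero (D : AnnularDiagram) : Module.End F2 D.Chain :=
  D.linOfRel fun g g' => D.KhovanovEdge g g' ∧ D.windDeg g' = D.windDeg g

/-- `∂_-`, the part of the Khovanov differential that decreases the winding number grading. -/
noncomputable def dMinus (D : AnnularDiagram) : Module.End F2 D.Chain :=
  D.linOfRel fun g g' => D.KhovanovEdge g g' ∧ D.windDeg g' < D.windDeg g

/-- `∂_0^Lee`, the part of the Lee differential that preserves the winding number grading. -/
noncomputable def leeZero (D : AnnularDiagram) : Module.End F2 D.Chain :=
  D.linOfRel fun g g' => D.LeeEdge g g' ∧ D.windDeg g' = D.windDeg g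

/-- `∂_+^Lee`, the part of the Lee differential that increases the winding number grading. -/
noncomputable def leePlus (D : AnnularDiagram) : Module.End F2 D.Chain :=
  D.linOfRel fun g g' => D.LeeEdge g g' ∧ D.windDeg g < D.windDeg g'

/-- The action of `e`: the tensor product, over the nontrivial circles, of the defining representations
of `sl₂`; trivial circles carry the trivial representation. -/
noncomputable def actE (D : AnnularDiagram) : Module.End F2 D.Chain :=
  D.linOfRel (D.LabelChange false)

/-- The action of `f`. -/
noncomputable def actF (D : AnnularDiagram) : Module.End F2 D.Chain :=
  D.linOfRel (D.LabelChange true)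

/-- The action of `h`: multiplication with the winding number grading. -/
noncomputable def actH (D : AnnularDiagram) : Module.End F2 D.Chain :=
  LinearMap.pi fun g => ((D.windDeg g : ℤ) : F2) • LinearMap.proj g

/-- The action of the basis of `sl₂(∧)_dg` on `CKh(D)`; the actions of `ṽ₀ = [e, v₋₂]` and
`x = [v₂, v₋₂]` are the (super) commutators. -/
noncomputable def act (D : AnnularDiagram) : SlBasis → Module.End F2 D.Chain
  | .e => D.actE
  | .f => D.actF
  | .h => D.actH
  | .v2 => D.leePlus
  | .vm2 => D.dMinus
  | .v0 => D.actE * D.dMinus - D.dMinus * D.actE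
  | .d => D.dZero
  | .D => D.leeZero
  | .x => D.leePlus * D.dMinus + D.dMinus * D.leePlus

/-- The annular Khovanov complex `CKh(D)` with its `sl₂(∧)_dg` `L_∞`-module operations: `k_1 = ∂_0`,
`k_2` is the action, and there are no higher operations. -/
noncomputable def CKh (D : AnnularDiagram) : LInfModuleData Sl2dg D.Chain where
  gr := basisGrading D.homDeg
  op
    | 0 => MultilinearMap.constOfIsEmpty F2 (fun _ : Fin 0 => Sl2dg) D.dZero
    | 1 => MultilinearMap.ofSubsingleton F2 Sl2dg (Module.End F2 D.Chain) (0 : Fin 1)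
        ((Pi.basisFun F2 SlBasis).constr F2 D.act)
    | _ => 0

/-! # The second Reidemeister move -/

/-- The half-edge of the diagram after the move that replaces a half-edge `a` of the diagram before the
move; see `ReidemeisterII`. -/
def outer {D D' : AnnularDiagram} (eX : D'.Crossing ≃ D.Crossing ⊕ Bool)
    (eM : D.Marker ≃ D'.Marker ⊕ Bool) : D.Half → D'.Half
  | .inl (x, k) => .inl (eX.symm (.inl x), k)
  | .inr (p, s) =>
    match eM p, s with
    | .inl q, s => .inr (q, s)
    | .inr false, false => .inl (eX.symm (.inr false), 3)
    | .inr false, true => .inl (eX.symm (.inr true), 3)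
    | .inr true, false => .inl (eX.symm (.inr false), 0)
    | .inr true, true => .inl (eX.symm (.inr true), 2)

/-- `D'` arises from `D` by a second Reidemeister move that pushes one strand over another one inside
a disk that does not meet the arc.

Draw the two strands of `D` in the disk vertically, and put a marker on each of them: `false` on the left
strand and `true` on the right strand, with half-edges `false` pointing south and `true` pointing
north.  In `D'` the left strand is pushed over the right one.  This creates two crossings, `false` at the
bottom and `true` at the top.  Starting with `0`, the half-edges point to SE, NE, NW, SW at the bottom
crossing and to SW, SE, NE, NW at the top crossing; NE at the bottom crossing is joined with SE at the
top crossing, and NW at the bottom crossing with SW at the top crossing.  Outside of the disk the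
diagrams agree.  (The move that pushes the right strand over the left one is the same one, rotated by
a half turn.) -/
def ReidemeisterII (D D' : AnnularDiagram) : Prop :=
  ∃ (eX : D'.Crossing ≃ D.Crossing ⊕ Bool) (eM : D.Marker ≃ D'.Marker ⊕ Bool),
    (∀ a, D'.opp (outer eX eM a) = outer eX eM (D.opp a)) ∧
    (∀ a, D'.out (outer eX eM a) = D.out a) ∧
    (∀ a, D'.cut (outer eX eM a) = D.cut a) ∧
    D'.opp (.inl (eX.symm (.inr false), 1)) = .inl (eX.symm (.inr true), 1) ∧
    D'.opp (.inl (eX.symm (.inr false), 2)) = .inl (eX.symm (.inr true), 0) ∧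
    D'.cut (.inl (eX.symm (.inr false), 1)) = 0 ∧
    D'.cut (.inl (eX.symm (.inr true), 1)) = 0 ∧
    D'.cut (.inl (eX.symm (.inr false), 2)) = 0 ∧
    D'.cut (.inl (eX.symm (.inr true), 0)) = 0

end AnnularDiagram

/-! # Bookkeeping for `L_∞`-structures with at most binary operations -/

/-! Modulo two every bracket of the Lie superalgebra is central, and the module operations have at
most one argument in it. All `L_∞`-relations therefore reduce to identities in at most two
arguments. What remains is to prove the commutation relations of the action, to contract the complex
after the move onto the one before it, and to transfer the action along this contraction.

Relations. The Khovanov and Lee differentials add up to the cube differential of the Frobenius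
algebra `F2[X]/(X² - 1)`, with `+` as `1` and `-` as `X`. Multiplication by `X` on the circle
through a half-edge (`toggleOp`) commutes with it, so it is determined by its values at the
generators `allPlus`. There a merge gives `1` and a split gives a sum of two toggles, and the square
is zero because every face of the cube commutes (`edgeFactor_face`, `total_mul_total`). This uses
that changing one smoothing always merges or splits (`Flip.circ_iff`), which is where planarity
enters, through a checkerboard colouring (`exists_checkerboard`). In the same way the sum of `e` and
`f` is a combination of toggles (`labelOp`); it commutes with the total differential, and its square
is the action of `h`. The grading `weight` is, up to a shift, five times the quantum degree minus
the winding number. It gives `d`, `v₋₂`, `D`, `v₂`, `e`, `f` the degrees 0, 2, 20, 18, 8, -8, so the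
basic relations are the homogeneous components of three identities; those with `ṽ₀` and `x` follow
formally (`act_bracket`).

Contraction. Let `b` and `t` be the new crossings. Generators with `b` 0-resolved and `t` 1-resolved
form a copy of the old complex. All others are matched in pairs by the split at `b` that creates a
small circle labelled `-` and by the merge at `t` that absorbs a small circle labelled `+`. Let `H`
invert this matching. Since `H ∂₀ H = H`, Gaussian elimination stops after one correction, with
inclusion `ι + H ∂₀ ι` and projection `π + π ∂₀ H`.

Transfer. Every edge of the total differential from a source of the matching to a target belongs to
the matching and has weight zero. Hence all basis elements except `d` preserve the span `N` of the
generators with a small circle labelled `+`, and the span `Q` of those without a small circle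
labelled `-`; here `e` and `f` do not see the small circle because it is trivial
(`Bigon.preservesBigon_act`). Moreover `H` maps `Q` into `N` and kills `N`. So the transferred
action is the old action, and every transfer term with two actions between homotopies vanishes. The
homomorphisms have only the components `incl`, `b ↦ H b incl` and `proj`, `b ↦ proj b H`. The
element `d` is exceptional: the second component at `d` is `incl` or `proj` itself, which is
possible because the differential is inner. -/

theorem ofFn_restrict {V : Type*} {n : ℕ} (x : Fin n → V) (I : Finset (Fin n)) :
    List.ofFn (restrict x I) = ((List.finRange n).filter (· ∈ I)).map x := by
  have h1 : List.ofFn (restrict x I) = (List.ofFn (I.orderEmbOfFin rfl)).map x := by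
    rw [List.map_ofFn]; rfl
  rw [h1]
  congr 1
  -- Both lists are strictly increasing, so equality of their sets of entries suffices.
  refine List.Perm.eq_of_pairwise (le := (· < ·)) ?_ ?_ ?_ ?_
  · intro a b _ _ hab hba; exact absurd hab (not_lt.2 hba.le)
  · rw [List.pairwise_ofFn]
    intro i j hij
    exact (I.orderEmbOfFin rfl).strictMono hij
  · exact (List.pairwise_lt_finRange n).filter _
  · rw [List.perm_ext_iff_of_nodup]
    · intro a
      simp [List.mem_ofFn, ← Set.mem_range]
    · rw [List.nodup_ofFn]; exact (I.orderEmbOfFin rfl).injective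
    · exact (List.nodup_finRange n).filter _

theorem length_ofFn_restrict {V : Type*} {n : ℕ} (x : Fin n → V) (I : Finset (Fin n)) :
    (List.ofFn (restrict x I)).length = I.card := by simp

theorem basisGrading_isInternal {ι : Type*} [Fintype ι] [DecidableEq ι] (deg : ι → ℤ) :
    DirectSum.IsInternal (basisGrading deg) := by
  constructor
  · rw [injective_iff_map_eq_zero]
    intro y hy
    ext n b
    by_contra hne
    have hb : deg b = n := (y n).2 b hne
    have h1 := congrFun hy b
    rw [DirectSum.coeAddMonoidHom_eq_dfinsuppSum, DFinsupp.sum, Finset.sum_apply,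
      Finset.sum_eq_single n] at h1
    · exact hne h1
    · intro m _ hm
      by_contra h
      exact hm ((y m).2 b h ▸ hb)
    · intro h
      rw [DFinsupp.notMem_support_iff] at h
      rw [h]; rfl
  · intro m
    refine ⟨∑ b, DirectSum.of (fun n => basisGrading deg n) (deg b)
      ⟨Pi.single b (m b), ?_⟩, ?_⟩
    · intro c hc
      by_cases h : c = b
      · rw [h]
      · simp [h] at hc
    · rw [map_sum]
      simp only [DirectSum.coeAddMonoidHom_of]
      exact Finset.univ_sum_single m

/-! ## The Lie superalgebra -/

open SlBasis in
-- The outputs are spanned by `h`, `ṽ₀`, `x`, and the coordinates of the inputs along these three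
-- never occur. This is the source of two-step nilpotency.
theorem bracket_formula (u w : Sl2dg) : Sl2dg.bracket u w =
    (u e * w f + u f * w e) • Pi.single h 1 +
    (u e * w vm2 + u vm2 * w e + u f * w v2 + u v2 * w f) • Pi.single v0 1 +
    (u v2 * w vm2 + u vm2 * w v2 + u d * w D + u D * w d) • (Pi.single x 1 : Sl2dg) := by
  have hu : (Finset.univ : Finset SlBasis) = {e, f, h, v2, vm2, v0, d, D, x} := rfl
  simp only [Sl2dg.bracket, Module.Basis.constr_apply_fintype, Pi.basisFun_equivFun,
    LinearEquiv.refl_apply, LinearMap.sum_apply, LinearMap.smul_apply, hu]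
  simp [Finset.sum_insert, SlBasis.bracket]
  module

theorem bracket_comm (u w : Sl2dg) : Sl2dg.bracket u w = Sl2dg.bracket w u := by
  rw [bracket_formula, bracket_formula]
  module

/-- The brackets of `h` and `ṽ₀` with other elements have coefficient two over the integers. Modulo
two the Jacobi identity thus holds term by term, without cancellation. -/
theorem bracket_bracket (u v w : Sl2dg) : Sl2dg.bracket (Sl2dg.bracket u v) w = 0 := by
  rw [bracket_formula (Sl2dg.bracket u v) w]
  simp [bracket_formula u v]

theorem bracket_single (a b : SlBasis) :
    Sl2dg.bracket (Pi.single a 1) (Pi.single b 1) = SlBasis.bracket a b := by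
  have h (c : SlBasis) : (Pi.single c 1 : Sl2dg) = Pi.basisFun F2 SlBasis c := by simp
  rw [h, h, Sl2dg.bracket, Module.Basis.constr_basis, Module.Basis.constr_basis]

/-- The operations of `sl2dg` on lists. -/
noncomputable def slOp : List Sl2dg → Sl2dg
  | [u] => Sl2dg.bracket (Pi.single SlBasis.d 1) u
  | [u, w] => Sl2dg.bracket u w
  | _ => 0

theorem sl2dg_op (n : ℕ) (y : Fin n → Sl2dg) : sl2dg.op n y = slOp (List.ofFn y) := by
  match n, y with
  | 0, y => rfl
  | 1, y => rfl
  | 2, y => rfl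
  | n + 3, y => simp only [List.ofFn_succ]; rfl

theorem slOp_eq_zero_or_bracket (L : List Sl2dg) :
    slOp L = 0 ∨ ∃ u w, slOp L = Sl2dg.bracket u w := by
  match L with
  | [] => exact .inl rfl
  | [u] => exact .inr ⟨_, _, rfl⟩
  | [u, w] => exact .inr ⟨_, _, rfl⟩
  | _ :: _ :: _ :: _ => exact .inl rfl

/-- Since `l_1` is itself a bracket with `d`, every composite of two operations is an iterated
bracket. -/
theorem slOp_slOp_cons (L L' : List Sl2dg) : slOp (slOp L :: L') = 0 := by
  match L' with
  | [] =>
    obtain h | ⟨u, w, h⟩ := slOp_eq_zero_or_bracket L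
    · rw [h]; simp [slOp]
    · rw [h, slOp, bracket_comm, bracket_bracket]
  | [w] =>
    obtain h | ⟨u, w, h⟩ := slOp_eq_zero_or_bracket L
    · rw [h]; simp [slOp]
    · rw [h, slOp, bracket_bracket]
  | _ :: _ :: _ => rfl

theorem slOp_of_length {L : List Sl2dg} (h : 3 ≤ L.length) : slOp L = 0 := by
  match L with
  | _ :: _ :: _ :: _ => rfl

theorem single_mem_basisGrading {ι : Type*} [DecidableEq ι] (deg : ι → ℤ) (b : ι) (c : F2) :
    Pi.single b c ∈ basisGrading deg (deg b) := by
  intro i hi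
  by_cases h : i = b
  · rw [h]
  · simp [h] at hi

theorem bracket_mem {u w : Sl2dg} {m n : ℤ} (hu : u ∈ sl2dg.gr m) (hw : w ∈ sl2dg.gr n) :
    Sl2dg.bracket u w ∈ sl2dg.gr (m + n) := by
  have key (a b c : SlBasis) (hs : SlBasis.deg c = SlBasis.deg a + SlBasis.deg b) :
      (u a * w b) • (Pi.single c 1 : Sl2dg) ∈ sl2dg.gr (m + n) := by
    by_cases h : u a * w b = 0
    · simp [h]
    · rw [← hu a (left_ne_zero_of_mul h), ← hw b (right_ne_zero_of_mul h), ← hs]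
      exact Submodule.smul_mem _ _ (single_mem_basisGrading _ _ _)
  rw [bracket_formula]
  simp only [add_smul]
  repeat' apply Submodule.add_mem
  all_goals exact key _ _ _ (by decide)

theorem perm_fin_two (σ : Equiv.Perm (Fin 2)) : (σ 0 = 0 ∧ σ 1 = 1) ∨ (σ 0 = 1 ∧ σ 1 = 0) := by
  revert σ; decide

theorem sl2dg_isLInfAlgebra : sl2dg.IsLInfAlgebra where
  internal := basisGrading_isInternal _
  symm n x σ := by
    match n with
    | 0 => exact congrArg _ (Subsingleton.elim _ _)
    | 1 => rw [Subsingleton.elim σ 1]; rfl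
    | 2 =>
      rw [sl2dg_op, sl2dg_op]
      obtain ⟨h0, h1⟩ | ⟨h0, h1⟩ := perm_fin_two σ
      · simp [slOp, List.ofFn_succ, h0, h1]
      · simp [slOp, List.ofFn_succ, h0, h1, bracket_comm (x 1)]
    | n + 3 => rfl
  degree n hn x d hx := by
    match n, hn with
    | 1, _ =>
      have h := bracket_mem (u := Pi.single SlBasis.d 1)
        (single_mem_basisGrading SlBasis.deg SlBasis.d 1) (hx 0)
      convert h using 2
      · simp [SlBasis.deg]; ring
      · rfl
    | 2, _ =>
      have h := bracket_mem (hx 0) (hx 1)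
      convert h using 2
      · simp [Fin.sum_univ_two]
      · rfl
    | n + 3, _ => exact Submodule.zero_mem _
  jacobi n x := by
    refine Finset.sum_eq_zero fun I _ => ?_
    rw [sl2dg_op, sl2dg_op, List.ofFn_cons, slOp_slOp_cons]

/-! ## Modules and homomorphisms -/

section Modules

variable {M M' : Type*} [AddCommGroup M] [Module F2 M] [AddCommGroup M'] [Module F2 M']

/-- A family of operations with at most one argument in the Lie superalgebra, on lists. -/
def unaryOp (c : M →ₗ[F2] M') (r : Sl2dg →ₗ[F2] M →ₗ[F2] M') : List Sl2dg → (M →ₗ[F2] M')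
  | [] => c
  | [u] => r u
  | _ => 0

/-- The family of multilinear maps with constant part `c`, linear part `r` and no higher parts. -/
def unaryFamily (c : M →ₗ[F2] M') (r : Sl2dg →ₗ[F2] M →ₗ[F2] M') :
    ∀ a : ℕ, MultilinearMap F2 (fun _ : Fin a => Sl2dg) (M →ₗ[F2] M')
  | 0 => MultilinearMap.constOfIsEmpty F2 (fun _ : Fin 0 => Sl2dg) c
  | 1 => MultilinearMap.ofSubsingleton F2 Sl2dg (M →ₗ[F2] M') (0 : Fin 1) r
  | _ => 0

theorem unaryFamily_apply (c : M →ₗ[F2] M') (r : Sl2dg →ₗ[F2] M →ₗ[F2] M') (n : ℕ)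
    (y : Fin n → Sl2dg) : unaryFamily c r n y = unaryOp c r (List.ofFn y) := by
  match n, y with
  | 0, y => rfl
  | 1, y => rfl
  | n + 2, y => simp only [List.ofFn_succ]; rfl

theorem unaryOp_of_length (c : M →ₗ[F2] M') (r : Sl2dg →ₗ[F2] M →ₗ[F2] M') {L : List Sl2dg}
    (h : 2 ≤ L.length) : unaryOp c r L = 0 := by
  match L with
  | _ :: _ :: _ => rfl

theorem unaryFamily_symm (c : M →ₗ[F2] M') (r : Sl2dg →ₗ[F2] M →ₗ[F2] M') (a : ℕ)
    (x : Fin a → Sl2dg) (σ : Equiv.Perm (Fin a)) :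
    unaryFamily c r a (x ∘ σ) = unaryFamily c r a x := by
  match a with
  | 0 => rfl
  | 1 => rw [Subsingleton.elim σ 1]; rfl
  | n + 2 => rfl

theorem univ_finset_fin_one : (Finset.univ : Finset (Finset (Fin 1))) = {∅, {0}} := by decide
theorem univ_finset_fin_two :
    (Finset.univ : Finset (Finset (Fin 2))) = {∅, {0}, {1}, {0, 1}} := by decide

/-- The first sum in the relations of modules and homomorphisms. -/
theorem sum_unaryFamily_bracket (c : M →ₗ[F2] M') (r : Sl2dg →ₗ[F2] M →ₗ[F2] M') (a : ℕ)
    (ha : 0 < a) (x : Fin a → Sl2dg) (m : M) :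
    (∑ I : Finset (Fin a) with I.Nonempty,
      unaryFamily c r (Iᶜ.card + 1)
        (Fin.cons (sl2dg.op I.card (restrict x I)) (restrict x Iᶜ) : Fin (Iᶜ.card + 1) → Sl2dg) m)
      = r (slOp (List.ofFn x)) m := by
  -- The inner bracket occupies one argument, and a unary family vanishes on two or more; so nothing
  -- may be left outside the inner bracket.
  rw [Finset.sum_eq_single Finset.univ]
  · rw [unaryFamily_apply, List.ofFn_cons, sl2dg_op, ofFn_restrict, ofFn_restrict]
    simp [unaryOp, List.ofFn_eq_map]
  · intro I _ hI
    rw [unaryFamily_apply, unaryOp_of_length, LinearMap.zero_apply]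
    rw [List.ofFn_cons, List.length_cons, length_ofFn_restrict]
    have : 0 < Iᶜ.card := Finset.card_pos.2 (by
      rw [Finset.nonempty_iff_ne_empty]; simpa using hI)
    omega
  · intro h
    have : (Finset.univ : Finset (Fin a)).Nonempty := ⟨⟨0, ha⟩, Finset.mem_univ _⟩
    simp [this] at h

theorem sum_card_zero_bracket (c : M →ₗ[F2] M') (r : Sl2dg →ₗ[F2] M →ₗ[F2] M')
    (x : Fin 0 → Sl2dg) (m : M) :
    (∑ I : Finset (Fin 0) with I.Nonempty,
      unaryFamily c r (Iᶜ.card + 1)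
        (Fin.cons (sl2dg.op I.card (restrict x I)) (restrict x Iᶜ) : Fin (Iᶜ.card + 1) → Sl2dg) m)
      = 0 := by
  refine Finset.sum_eq_zero fun I hI => ?_
  obtain ⟨i, _⟩ := (Finset.mem_filter.1 hI).2
  exact i.elim0

variable {M'' : Type*} [AddCommGroup M''] [Module F2 M'']

/-- The composition of two unary families, summed over unshuffles. -/
theorem sum_unaryFamily_comp (c : M' →ₗ[F2] M'') (r : Sl2dg →ₗ[F2] M' →ₗ[F2] M'')
    (c' : M →ₗ[F2] M') (r' : Sl2dg →ₗ[F2] M →ₗ[F2] M') (a : ℕ) (x : Fin a → Sl2dg) (m : M) :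
    ∑ I : Finset (Fin a), unaryFamily c r Iᶜ.card (restrict x Iᶜ)
        (unaryFamily c' r' I.card (restrict x I) m) =
      match List.ofFn x with
      | [] => c (c' m)
      | [u] => r u (c' m) + c (r' u m)
      | [u, w] => r u (r' w m) + r w (r' u m)
      | _ => 0 := by
  simp only [unaryFamily_apply, ofFn_restrict]
  match a, x with
  | 0, x => simp [unaryOp]
  | 1, x =>
    have h1 : (List.finRange 1).filter (· ∈ ({0} : Finset (Fin 1))ᶜ) = [] := by decide
    have h2 : (List.finRange 1).filter (· ∈ ({0} : Finset (Fin 1))) = [0] := by decide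
    have h3 : (List.finRange 1).filter (· ∈ (∅ : Finset (Fin 1))ᶜ) = [0] := by decide
    have h4 : (List.finRange 1).filter (· ∈ (∅ : Finset (Fin 1))) = [] := by decide
    rw [univ_finset_fin_one, Finset.sum_insert (by decide), Finset.sum_singleton, h1, h2, h3, h4]
    rfl
  | 2, x =>
    have h1 : (List.finRange 2).filter (· ∈ ({0} : Finset (Fin 2))ᶜ) = [1] := by decide
    have h2 : (List.finRange 2).filter (· ∈ ({0} : Finset (Fin 2))) = [0] := by decide
    have h3 : (List.finRange 2).filter (· ∈ ({1} : Finset (Fin 2))ᶜ) = [0] := by decide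
    have h4 : (List.finRange 2).filter (· ∈ ({1} : Finset (Fin 2))) = [1] := by decide
    have h5 : (List.finRange 2).filter (· ∈ (∅ : Finset (Fin 2))ᶜ) = [0, 1] := by decide
    have h6 : (List.finRange 2).filter (· ∈ ({0, 1} : Finset (Fin 2))) = [0, 1] := by decide
    rw [univ_finset_fin_two, Finset.sum_insert (by decide), Finset.sum_insert (by decide),
      Finset.sum_insert (by decide), Finset.sum_singleton, h1, h2, h3, h4, h5, h6]
    simp [unaryOp, List.ofFn_succ, add_comm]
  | n + 3, x =>
    simp only [List.ofFn_succ]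
    refine Finset.sum_eq_zero fun I _ => ?_
    have h1 := length_ofFn_restrict x I
    have h2 := length_ofFn_restrict x Iᶜ
    rw [ofFn_restrict] at h1 h2
    have h3 := Finset.card_add_card_compl I
    rw [Fintype.card_fin] at h3
    -- At least three arguments are shared between the two families, so one of them receives two or
    -- more.
    by_cases h : 2 ≤ I.card
    · rw [unaryOp_of_length c' r' (by omega), LinearMap.zero_apply, map_zero]
    · rw [unaryOp_of_length c r (by omega), LinearMap.zero_apply]

theorem sum_unaryFamily_comp' (c : M' →ₗ[F2] M'') (r : Sl2dg →ₗ[F2] M' →ₗ[F2] M'')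
    (c' : M →ₗ[F2] M') (r' : Sl2dg →ₗ[F2] M →ₗ[F2] M') (a : ℕ) (x : Fin a → Sl2dg) (m : M) :
    ∑ I : Finset (Fin a), unaryFamily c r I.card (restrict x I)
        (unaryFamily c' r' Iᶜ.card (restrict x Iᶜ) m) =
      match List.ofFn x with
      | [] => c (c' m)
      | [u] => r u (c' m) + c (r' u m)
      | [u, w] => r u (r' w m) + r w (r' u m)
      | _ => 0 := by
  rw [← sum_unaryFamily_comp]
  simp only [unaryFamily_apply, ofFn_restrict]
  rw [← Equiv.sum_comp (Equiv.mk compl compl compl_compl compl_compl)]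
  simp only [Equiv.coe_fn_mk, compl_compl]

theorem add_self_F2 (m : M) : m + m = 0 := by
  rw [← two_smul F2 m, show (2 : F2) = 0 from rfl, zero_smul]

/-- Two bilinear maps on the Lie superalgebra agree if they agree on the basis. -/
theorem sl_ext₂ {A B : Sl2dg →ₗ[F2] Sl2dg →ₗ[F2] M}
    (h : ∀ a b, A (Pi.single a 1) (Pi.single b 1) = B (Pi.single a 1) (Pi.single b 1)) : A = B := by
  refine (Pi.basisFun F2 SlBasis).ext fun a => (Pi.basisFun F2 SlBasis).ext fun b => ?_
  simpa using h a b

theorem sl_ext₁ {A B : Sl2dg →ₗ[F2] M} (h : ∀ a, A (Pi.single a 1) = B (Pi.single a 1)) :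
    A = B := by
  refine (Pi.basisFun F2 SlBasis).ext fun a => ?_
  simpa using h a

/-- A unary family is homogeneous if its constant and linear parts are. -/
theorem unaryFamily_degree {gr : ℤ → Submodule F2 M} {gr' : ℤ → Submodule F2 M'} {k : ℤ}
    {c : M →ₗ[F2] M'} {r : Sl2dg →ₗ[F2] M →ₗ[F2] M'}
    (hc : ∀ m e, m ∈ gr e → c m ∈ gr' (e + k))
    (hr : ∀ b m e, m ∈ gr e → r (Pi.single b 1) m ∈ gr' (SlBasis.deg b + e + k - 1)) (a : ℕ)
    (x : Fin a → Sl2dg) (d : Fin a → ℤ) (m : M) (e : ℤ) (hx : ∀ i, x i ∈ sl2dg.gr (d i))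
    (hm : m ∈ gr e) : unaryFamily c r a x m ∈ gr' (∑ i, d i + e + k - a) := by
  match a, x, d, hx with
  | 0, x, d, hx => simpa [unaryFamily_apply, unaryOp] using hc m e hm
  | 1, x, d, hx =>
    have h : r (x 0) m ∈ gr' (d 0 + e + k - 1) := by
      rw [← Finset.univ_sum_single (x 0), map_sum, LinearMap.sum_apply]
      refine Submodule.sum_mem _ fun b _ => ?_
      by_cases hb : x 0 b = 0
      · simp [hb]
      · have h1 := hx 0 b hb
        rw [show (Pi.single b (x 0 b) : Sl2dg) = x 0 b • Pi.single b 1 by simp [← Pi.single_smul],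
          map_smul, LinearMap.smul_apply, ← h1]
        exact Submodule.smul_mem _ _ (hr b m e hm)
    simpa [unaryFamily_apply, unaryOp] using h
  | n + 2, x, d, hx => exact Submodule.zero_mem _

/-- A representation with an inner differential is an `L_∞`-module. -/
theorem isLInfModule_of_unary {K : LInfModuleData Sl2dg M} {c : M →ₗ[F2] M}
    {r : Sl2dg →ₗ[F2] M →ₗ[F2] M} (hK : ∀ a, K.op a = unaryFamily c r a)
    (hint : DirectSum.IsInternal K.gr) (hc : r (Pi.single .d 1) = c)
    (hr : ∀ b m e, m ∈ K.gr e → r (Pi.single b 1) m ∈ K.gr (SlBasis.deg b + e))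
    (hcc : ∀ m, c (c m) = 0)
    (hbr : ∀ a b, r (SlBasis.bracket a b) =
      r (Pi.single a 1) ∘ₗ r (Pi.single b 1) + r (Pi.single b 1) ∘ₗ r (Pi.single a 1)) :
    K.IsLInfModule sl2dg where
  internal := hint
  symm a x σ := by rw [hK, unaryFamily_symm]
  degree a x d m e hx hm := by
    rw [hK]
    refine unaryFamily_degree ?_ ?_ a x d m e hx hm
    · intro m e hm
      rw [← hc, add_comm]
      exact hr .d m e hm
    · intro b m e hm
      simpa using hr b m e hm
  relation a x m := by
    have hbr2 (u w : Sl2dg) (m : M) : r (Sl2dg.bracket u w) m = r u (r w m) + r w (r u m) := by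
      have h : Sl2dg.bracket.compr₂ r = (LinearMap.mul F2 (Module.End F2 M)).compl₁₂ r r +
          ((LinearMap.mul F2 (Module.End F2 M)).compl₁₂ r r).flip := by
        refine sl_ext₂ fun a b => ?_
        rw [LinearMap.compr₂_apply, bracket_single, hbr]
        rfl
      exact LinearMap.congr_fun (LinearMap.congr_fun (LinearMap.congr_fun h u) w) m
    simp only [hK]
    rw [sum_unaryFamily_comp]
    match a, x with
    | 0, x =>
      rw [sum_card_zero_bracket]
      simpa using hcc m
    | 1, x =>
      rw [sum_unaryFamily_bracket _ _ _ (by norm_num)]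
      -- As `d` acts by the differential, the relation in one argument `u` is the bracket relation
      -- for the pair `d`, `u`.
      simp only [List.ofFn_succ, List.ofFn_zero, slOp, hbr2, hc]
      rw [add_comm (c _), add_self_F2]
    | 2, x =>
      rw [sum_unaryFamily_bracket _ _ _ (by norm_num)]
      simp only [List.ofFn_succ, List.ofFn_zero, slOp, hbr2]
      exact add_self_F2 _
    | n + 3, x =>
      rw [sum_unaryFamily_bracket _ _ _ (by omega), slOp_of_length (by simp)]
      simp [List.ofFn_succ]

/-- A homomorphism of modules with a constant and a linear part. -/
def unaryHom {K : LInfModuleData Sl2dg M} {K' : LInfModuleData Sl2dg M'} {c : M →ₗ[F2] M}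
    {r : Sl2dg →ₗ[F2] M →ₗ[F2] M} {c' : M' →ₗ[F2] M'} {r' : Sl2dg →ₗ[F2] M' →ₗ[F2] M'}
    (hK : ∀ a, K.op a = unaryFamily c r a) (hK' : ∀ a, K'.op a = unaryFamily c' r' a)
    (φ : M →ₗ[F2] M') (η : Sl2dg →ₗ[F2] M →ₗ[F2] M')
    (hφ : ∀ m e, m ∈ K.gr e → φ m ∈ K'.gr e)
    (hη : ∀ b m e, m ∈ K.gr e → η (Pi.single b 1) m ∈ K'.gr (SlBasis.deg b + e - 1))
    (h0 : ∀ m, φ (c m) = c' (φ m))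
    (h1 : ∀ b m, η (Sl2dg.bracket (Pi.single .d 1) (Pi.single b 1)) m +
      (η (Pi.single b 1) (c m) + φ (r (Pi.single b 1) m)) +
      (r' (Pi.single b 1) (φ m) + c' (η (Pi.single b 1) m)) = 0)
    (h2 : ∀ a b m, η (SlBasis.bracket a b) m +
      (η (Pi.single a 1) (r (Pi.single b 1) m) + η (Pi.single b 1) (r (Pi.single a 1) m)) +
      (r' (Pi.single a 1) (η (Pi.single b 1) m) + r' (Pi.single b 1) (η (Pi.single a 1) m)) = 0) :
    LInfModuleHom sl2dg K K' where
  map := unaryFamily φ η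
  symm := unaryFamily_symm φ η
  degree a x d m e hx hm := by
    have h := unaryFamily_degree (c := φ) (r := η) (gr := K.gr) (gr' := K'.gr) (k := 0)
      (by simpa using hφ) (by simpa using hη) a x d m e hx hm
    simpa using h
  relation a x m := by
    simp only [hK, hK']
    rw [sum_unaryFamily_comp, sum_unaryFamily_comp']
    match a, x with
    | 0, x =>
      rw [sum_card_zero_bracket]
      simp [h0, add_self_F2]
    | 1, x =>
      rw [sum_unaryFamily_bracket _ _ _ (by norm_num)]
      -- The relation is linear in its argument; phrased as an equation of linear maps it follows
      -- from its values on the basis.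
      have h : (η ∘ₗ Sl2dg.bracket (Pi.single .d 1)) +
          ((LinearMap.lcomp F2 M' c) ∘ₗ η + (LinearMap.llcomp F2 M M M' φ) ∘ₗ r) +
          ((LinearMap.lcomp F2 M' φ) ∘ₗ r' + (LinearMap.llcomp F2 M M' M' c') ∘ₗ η) = 0 := by
        refine sl_ext₁ fun b => LinearMap.ext fun m => ?_
        exact h1 b m
      exact LinearMap.congr_fun (LinearMap.congr_fun h (x 0)) m
    | 2, x =>
      rw [sum_unaryFamily_bracket _ _ _ (by norm_num)]
      have h : Sl2dg.bracket.compr₂ η +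
          ((LinearMap.llcomp F2 M M M').compl₁₂ η r + ((LinearMap.llcomp F2 M M M').compl₁₂ η r).flip)
          + ((LinearMap.llcomp F2 M M' M').compl₁₂ r' η +
            ((LinearMap.llcomp F2 M M' M').compl₁₂ r' η).flip) = 0 := by
        refine sl_ext₂ fun a b => LinearMap.ext fun m => ?_
        have := h2 a b m
        rw [← bracket_single] at this
        exact this
      exact LinearMap.congr_fun (LinearMap.congr_fun (LinearMap.congr_fun h (x 0)) (x 1)) m
    | n + 3, x =>
      rw [sum_unaryFamily_bracket _ _ _ (by omega), slOp_of_length (by simp)]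
      simp [List.ofFn_succ]

end Modules

/-! # Transfer of the module structure along a contraction -/

section Contraction

variable {M M' : Type*} [AddCommGroup M] [Module F2 M] [AddCommGroup M'] [Module F2 M']

/-- No bracket has a component along `d`. The transfer formulas treat `d` separately, so they apply
uniformly to brackets. -/
theorem bracket_cases (a b : SlBasis) : SlBasis.bracket a b = 0 ∨
    ∃ c, c ≠ SlBasis.d ∧ SlBasis.bracket a b = Pi.single c 1 := by
  cases a <;> cases b <;>
    first
    | exact .inl rfl
    | exact .inr ⟨.h, by decide, rfl⟩
    | exact .inr ⟨.v0, by decide, rfl⟩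
    | exact .inr ⟨.x, by decide, rfl⟩

/-- A contraction of `M'` onto `M`, given by the inclusion `ι` and the projection `π` of a direct summand
and a homotopy `H`, together with subspaces `N` and `Q` of `M'` that control how the action on `M'` interacts
with `H`. -/
structure Contraction (c : M →ₗ[F2] M) (r : Sl2dg →ₗ[F2] M →ₗ[F2] M) (c' : M' →ₗ[F2] M')
    (r' : Sl2dg →ₗ[F2] M' →ₗ[F2] M') where
  ι : M →ₗ[F2] M'
  π : M' →ₗ[F2] M
  H : M' →ₗ[F2] M'
  N : Submodule F2 M'
  Q : Submodule F2 M'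
  π_ι : ∀ m, π (ι m) = m
  π_H : ∀ m, π (H m) = 0
  H_ι : ∀ m, H (ι m) = 0
  H_H : ∀ m, H (H m) = 0
  cc : ∀ m, c' (c' m) = 0
  -- The right-hand side is the perturbed inclusion applied to the perturbed projection of `m`.
  homotopy : ∀ m, m + c' (H m) + H (c' m) =
    (ι (π m + π (c' (H m))) + H (c' (ι (π m + π (c' (H m))))))
  H_N : ∀ m ∈ N, H m = 0
  π_N : ∀ m ∈ N, π m = 0
  H_Q : ∀ m ∈ Q, H m ∈ N
  H_mem : ∀ m, H m ∈ Q
  ι_mem : ∀ m, ι m ∈ Q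
  c_ι_mem : ∀ m, c' (ι m) ∈ Q
  π_c_N : ∀ m ∈ N, π (c' m) = 0
  act_N : ∀ b, b ≠ SlBasis.d → ∀ m ∈ N, r' (Pi.single b 1) m ∈ N
  act_Q : ∀ b, b ≠ SlBasis.d → ∀ m ∈ Q, r' (Pi.single b 1) m ∈ Q
  r_d : r (Pi.single .d 1) = c
  r_d' : r' (Pi.single .d 1) = c'
  -- The elements `ṽ₀` and `x` act by commutators, and compressing a product to a summand need not
  -- give the product of the compressions. They are handled in `proj_act_incl`.
  r_eq : ∀ b, b ≠ .v0 → b ≠ .x → ∀ m, π (r' (Pi.single b 1) (ι m)) = r (Pi.single b 1) m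
  br : ∀ a b m, r (SlBasis.bracket a b) m =
    r (Pi.single a 1) (r (Pi.single b 1) m) + r (Pi.single b 1) (r (Pi.single a 1) m)
  br' : ∀ a b m, r' (SlBasis.bracket a b) m =
    r' (Pi.single a 1) (r' (Pi.single b 1) m) + r' (Pi.single b 1) (r' (Pi.single a 1) m)

namespace Contraction

variable {c : M →ₗ[F2] M} {r : Sl2dg →ₗ[F2] M →ₗ[F2] M} {c' : M' →ₗ[F2] M'}
  {r' : Sl2dg →ₗ[F2] M' →ₗ[F2] M'} (C : Contraction c r c' r')

theorem eq_of_add_eq_zero {m m' : M} (h : m + m' = 0) : m = m' := by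
  rw [add_eq_zero_iff_eq_neg.1 h, ZModModule.neg_eq_self]

/-- The perturbed inclusion. -/
def incl : M →ₗ[F2] M' := C.ι + C.H ∘ₗ c' ∘ₗ C.ι

/-- The perturbed projection. -/
def proj : M' →ₗ[F2] M := C.π + C.π ∘ₗ c' ∘ₗ C.H

/-! ### The perturbed maps form a deformation retraction. -/

theorem incl_apply (m : M) : C.incl m = C.ι m + C.H (c' (C.ι m)) := rfl

theorem proj_apply (m : M') : C.proj m = C.π m + C.π (c' (C.H m)) := rfl

theorem incl_proj (m : M') : C.incl (C.proj m) = m + c' (C.H m) + C.H (c' m) :=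
  (C.homotopy m).symm

theorem H_incl (m : M) : C.H (C.incl m) = 0 := by
  rw [incl_apply, map_add, C.H_ι, C.H_H, add_zero]

theorem proj_H (m : M') : C.proj (C.H m) = 0 := by
  rw [proj_apply, C.π_H, C.H_H, map_zero, map_zero, add_zero]

theorem incl_mem (m : M) : C.incl m ∈ C.Q :=
  C.Q.add_mem (C.ι_mem m) (C.H_mem _)

theorem proj_N {m : M'} (h : m ∈ C.N) : C.proj m = 0 := by
  rw [proj_apply, C.H_N m h, C.π_N m h, map_zero, map_zero, add_zero]

/-- The correction `π c' H` vanishes on `Q`, because `H` sends `Q` into `N` and `π c'` kills `N`. -/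
theorem proj_Q {m : M'} (h : m ∈ C.Q) : C.proj m = C.π m := by
  rw [proj_apply, C.π_c_N _ (C.H_Q m h), add_zero]

theorem proj_incl (m : M) : C.proj (C.incl m) = m := by
  rw [C.proj_Q (C.incl_mem m), incl_apply, map_add, C.π_H, C.π_ι, add_zero]

/-- At a vector `incl m` the homotopy identity loses its other terms, since `proj` retracts `incl`
and `H` kills the image of `incl`. -/
theorem H_c_incl (m : M) : C.H (c' (C.incl m)) = 0 := by
  have h := C.incl_proj (C.incl m)
  rw [proj_incl, H_incl, map_zero, add_zero] at h
  exact left_eq_add.1 h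

theorem proj_c_H (m : M') : C.proj (c' (C.H m)) = 0 := by
  have h := congrArg C.proj (C.incl_proj m)
  rw [proj_incl, map_add, map_add, proj_H, add_zero] at h
  exact left_eq_add.1 h

/-- A cancellation could add the zigzag `π c' H c' ι` to the differential. It does not contribute
here: `proj c' H` is zero, and `c' ι` lands in `Q`, where `proj` is `π`. -/
theorem proj_c_incl (m : M) : C.proj (c' (C.incl m)) = c m := by
  rw [incl_apply, map_add, map_add, C.proj_c_H, C.proj_Q (C.c_ι_mem m), add_zero]
  have h := C.r_eq .d (by decide) (by decide) m
  rwa [C.r_d, C.r_d'] at h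

theorem incl_c (m : M) : C.incl (c m) = c' (C.incl m) := by
  rw [← C.proj_c_incl m, incl_proj, H_c_incl, C.cc, map_zero, map_zero, add_zero, add_zero]

theorem proj_c (m : M') : C.proj (c' m) = c (C.proj m) := by
  rw [← C.proj_c_incl, incl_proj, map_add, map_add, map_add, map_add, C.cc, proj_c_H, map_zero,
    add_zero, add_zero]

/-! ### The compressed action. -/

theorem br_N (a b : SlBasis) {m : M'} (h : m ∈ C.N) : r' (SlBasis.bracket a b) m ∈ C.N := by
  obtain h0 | ⟨z, hz, h0⟩ := bracket_cases a b
  · rw [h0, map_zero]; exact C.N.zero_mem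
  · rw [h0]; exact C.act_N z hz m h

theorem br_Q (a b : SlBasis) {m : M'} (h : m ∈ C.Q) : r' (SlBasis.bracket a b) m ∈ C.Q := by
  obtain h0 | ⟨z, hz, h0⟩ := bracket_cases a b
  · rw [h0, map_zero]; exact C.Q.zero_mem
  · rw [h0]; exact C.act_Q z hz m h

theorem c_act (C : Contraction c r c' r') (b : SlBasis) (m : M') : c' (r' (Pi.single b 1) m) =
    r' (Pi.single b 1) (c' m) + r' (SlBasis.bracket .d b) m := by
  rw [C.br', C.r_d', add_comm (c' _), ← add_assoc, add_self_F2, zero_add]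

/-- For `b ≠ d` the correction `H c' ι` of the inclusion lies in `N`, which `b` preserves and `π`
kills; only `π b ι` remains. -/
theorem proj_act_incl_gen (b : SlBasis) (h0 : b ≠ .v0) (hx : b ≠ .x) (m : M) :
    C.proj (r' (Pi.single b 1) (C.incl m)) = r (Pi.single b 1) m := by
  by_cases hd : b = .d
  · rw [hd, C.r_d, C.r_d', proj_c_incl]
  · rw [C.proj_Q (C.act_Q b hd _ (C.incl_mem m)), incl_apply, map_add, map_add,
      C.π_N _ (C.act_N b hd _ (C.H_Q _ (C.c_ι_mem m))), add_zero, C.r_eq b h0 hx]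

/-- The projection intertwines products of two elements of the action. -/
theorem proj_act_act_incl (a b : SlBasis) (ha : a ≠ .d) (hb : b ≠ .d) (m : M) :
    C.proj (r' (Pi.single a 1) (r' (Pi.single b 1) (C.incl m))) =
      C.proj (r' (Pi.single a 1) (C.incl (C.proj (r' (Pi.single b 1) (C.incl m))))) := by
  have hn := C.act_N a ha _ (C.H_Q _ (C.act_Q b hb _ (C.incl_mem m)))
  -- Moving `c'` to the left past `a` costs a bracket. The resulting vectors are in `N` or in `c'
  -- N`, and the chain map `proj` kills both.
  have h1 : C.proj (r' (Pi.single a 1) (c' (C.H (r' (Pi.single b 1) (C.incl m))))) = 0 := by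
    have h := congrArg C.proj (C.c_act a (C.H (r' (Pi.single b 1) (C.incl m))))
    rw [proj_c, map_add, C.proj_N hn, C.proj_N (C.br_N _ _ (C.H_Q _ (C.act_Q b hb _ (C.incl_mem m)))),
      map_zero, add_zero] at h
    exact h.symm
  have h2 : C.proj (r' (Pi.single a 1) (C.H (c' (r' (Pi.single b 1) (C.incl m))))) = 0 := by
    refine C.proj_N (C.act_N a ha _ (C.H_Q _ ?_))
    rw [C.c_act, ← incl_c]
    exact C.Q.add_mem (C.act_Q b hb _ (C.incl_mem _)) (C.br_Q _ _ (C.incl_mem _))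
  rw [incl_proj, map_add, map_add, map_add, map_add, h1, h2, add_zero, add_zero]

/-- For `ṽ₀ = [e, v₋₂]` and `x = [v₂, v₋₂]` one expands the bracket on both sides;
`proj_act_act_incl` inserts `incl ∘ proj` between the two factors, which reduces them to the other
basis elements. -/
theorem proj_act_incl (b : SlBasis) (m : M) :
    C.proj (r' (Pi.single b 1) (C.incl m)) = r (Pi.single b 1) m := by
  have key (a b : SlBasis) (ha : a ≠ .v0 ∧ a ≠ .x ∧ a ≠ .d) (hb : b ≠ .v0 ∧ b ≠ .x ∧ b ≠ .d) :
      C.proj (r' (SlBasis.bracket a b) (C.incl m)) = r (SlBasis.bracket a b) m := by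
    rw [C.br, C.br', map_add, C.proj_act_act_incl a b ha.2.2 hb.2.2,
      C.proj_act_act_incl b a hb.2.2 ha.2.2, C.proj_act_incl_gen a ha.1 ha.2.1,
      C.proj_act_incl_gen b hb.1 hb.2.1, C.proj_act_incl_gen a ha.1 ha.2.1,
      C.proj_act_incl_gen b hb.1 hb.2.1]
  by_cases h0 : b = .v0
  · rw [h0]; exact key .e .vm2 (by decide) (by decide)
  by_cases hx : b = .x
  · rw [hx]; exact key .v2 .vm2 (by decide) (by decide)
  exact C.proj_act_incl_gen b h0 hx m

theorem H_act_incl_mem {b : SlBasis} (hb : b ≠ .d) (m : M) :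
    C.H (r' (Pi.single b 1) (C.incl m)) ∈ C.N :=
  C.H_Q _ (C.act_Q b hb _ (C.incl_mem m))

theorem proj_act_H_act_H {a b : SlBasis} (ha : a ≠ .d) (hb : b ≠ .d) (m : M') :
    C.proj (r' (Pi.single a 1) (C.H (r' (Pi.single b 1) (C.H m)))) = 0 :=
  C.proj_N (C.act_N a ha _ (C.H_Q _ (C.act_Q b hb _ (C.H_mem m))))

/-- The linear part of the inclusion homomorphism. -/
noncomputable def inclLin : Sl2dg →ₗ[F2] M →ₗ[F2] M' :=
  (Pi.basisFun F2 SlBasis).constr F2 fun b =>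
    -- With this value at `d` the relation for the pair `d`, `b` becomes the relation for `b` alone.
    -- The degree is right, since `d` has degree one and the component with one Lie argument has
    -- degree `-1`.
    if b = .d then C.incl else C.H ∘ₗ r' (Pi.single b 1) ∘ₗ C.incl

/-- The linear part of the projection homomorphism. -/
noncomputable def projLin : Sl2dg →ₗ[F2] M' →ₗ[F2] M :=
  (Pi.basisFun F2 SlBasis).constr F2 fun b =>
    if b = .d then C.proj else C.proj ∘ₗ r' (Pi.single b 1) ∘ₗ C.H

theorem inclLin_d : C.inclLin (Pi.single .d 1) = C.incl := by
  have h := (Pi.basisFun F2 SlBasis).constr_basis F2 (fun b =>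
    if b = .d then C.incl else C.H ∘ₗ r' (Pi.single b 1) ∘ₗ C.incl) .d
  rwa [if_pos rfl, Pi.basisFun_apply] at h

theorem inclLin_of_ne {b : SlBasis} (hb : b ≠ .d) (m : M) :
    C.inclLin (Pi.single b 1) m = C.H (r' (Pi.single b 1) (C.incl m)) := by
  have h := (Pi.basisFun F2 SlBasis).constr_basis F2 (fun b =>
    if b = .d then C.incl else C.H ∘ₗ r' (Pi.single b 1) ∘ₗ C.incl) b
  rw [if_neg hb, Pi.basisFun_apply] at h
  exact LinearMap.congr_fun h m

theorem inclLin_bracket (a b : SlBasis) (m : M) :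
    C.inclLin (SlBasis.bracket a b) m = C.H (r' (SlBasis.bracket a b) (C.incl m)) := by
  obtain h0 | ⟨z, hz, h0⟩ := bracket_cases a b
  · simp [h0]
  · rw [h0, C.inclLin_of_ne hz]

theorem projLin_d : C.projLin (Pi.single .d 1) = C.proj := by
  have h := (Pi.basisFun F2 SlBasis).constr_basis F2 (fun b =>
    if b = .d then C.proj else C.proj ∘ₗ r' (Pi.single b 1) ∘ₗ C.H) .d
  rwa [if_pos rfl, Pi.basisFun_apply] at h

theorem projLin_of_ne {b : SlBasis} (hb : b ≠ .d) (m : M') :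
    C.projLin (Pi.single b 1) m = C.proj (r' (Pi.single b 1) (C.H m)) := by
  have h := (Pi.basisFun F2 SlBasis).constr_basis F2 (fun b =>
    if b = .d then C.proj else C.proj ∘ₗ r' (Pi.single b 1) ∘ₗ C.H) b
  rw [if_neg hb, Pi.basisFun_apply] at h
  exact LinearMap.congr_fun h m

theorem projLin_bracket (a b : SlBasis) (m : M') :
    C.projLin (SlBasis.bracket a b) m = C.proj (r' (SlBasis.bracket a b) (C.H m)) := by
  obtain h0 | ⟨z, hz, h0⟩ := bracket_cases a b
  · simp [h0]
  · rw [h0, C.projLin_of_ne hz]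

/-- The failure of the inclusion to be equivariant is a homotopy. -/
theorem inclLin_relation (b : SlBasis) (m : M) :
    C.H (r' (SlBasis.bracket .d b) (C.incl m)) + C.H (r' (Pi.single b 1) (C.incl (c m))) +
      c' (C.H (r' (Pi.single b 1) (C.incl m))) =
    C.incl (r (Pi.single b 1) m) + r' (Pi.single b 1) (C.incl m) := by
  have h := C.incl_proj (r' (Pi.single b 1) (C.incl m))
  rw [proj_act_incl, C.c_act, map_add, ← incl_c] at h
  rw [h]
  have := add_self_F2 (r' (Pi.single b 1) (C.incl m))
  linear_combination (norm := module) -this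

/-- Apply `proj ∘ b` to the homotopy identity at `m`. Commuting `b` with `c'` produces the bracket
term, and `proj` turns `c'` into `c`. -/
theorem projLin_relation (b : SlBasis) (m : M') :
    C.proj (r' (SlBasis.bracket .d b) (C.H m)) + C.proj (r' (Pi.single b 1) (C.H (c' m))) +
      c (C.proj (r' (Pi.single b 1) (C.H m))) =
    C.proj (r' (Pi.single b 1) m) + r (Pi.single b 1) (C.proj m) := by
  have h := congrArg (fun m => C.proj (r' (Pi.single b 1) m)) (C.incl_proj m)
  simp only [proj_act_incl, map_add] at h
  rw [h, ← proj_c, C.c_act, map_add]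
  have h1 := add_self_F2 (C.proj (r' (Pi.single b 1) m))
  have h2 := add_self_F2 (C.proj (r' (SlBasis.bracket .d b) (C.H m)))
  linear_combination (norm := module) h2 - h1

/-- Insert the homotopy identity between the two actions. The term `H a H c' b incl` vanishes
because `H` kills `N`; the term `H a c' H b incl` becomes `a H b incl` because `H c'` is the
identity on `N`. Adding the same formula with `a` and `b` exchanged gives the relation in two
arguments, without a higher component. -/
theorem inclLin_bracket_relation (a b : SlBasis) (ha : a ≠ .d) (hb : b ≠ .d) (m : M) :
    C.H (r' (Pi.single a 1) (r' (Pi.single b 1) (C.incl m))) =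
      C.H (r' (Pi.single a 1) (C.incl (r (Pi.single b 1) m))) +
      r' (Pi.single a 1) (C.H (r' (Pi.single b 1) (C.incl m))) := by
  have hn := C.act_N a ha _ (C.H_act_incl_mem hb m)
  have h1 : C.H (r' (Pi.single a 1) (c' (C.H (r' (Pi.single b 1) (C.incl m))))) =
      r' (Pi.single a 1) (C.H (r' (Pi.single b 1) (C.incl m))) := by
    have h := congrArg C.H (C.c_act a (C.H (r' (Pi.single b 1) (C.incl m))))
    rw [map_add, C.H_N _ (C.br_N _ _ (C.H_act_incl_mem hb m)), add_zero] at h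
    rw [← h]
    have h' := C.incl_proj (r' (Pi.single a 1) (C.H (r' (Pi.single b 1) (C.incl m))))
    rw [C.proj_N hn, C.H_N _ hn, map_zero, map_zero, add_zero] at h'
    exact (eq_of_add_eq_zero h'.symm).symm
  have h2 : C.H (r' (Pi.single a 1) (C.H (c' (r' (Pi.single b 1) (C.incl m))))) = 0 := by
    refine C.H_N _ (C.act_N a ha _ (C.H_Q _ ?_))
    rw [C.c_act, ← incl_c]
    exact C.Q.add_mem (C.act_Q b hb _ (C.incl_mem _)) (C.br_Q _ _ (C.incl_mem _))
  have h := congrArg (fun m => C.H (r' (Pi.single a 1) m))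
    (C.incl_proj (r' (Pi.single b 1) (C.incl m)))
  simp only [proj_act_incl, map_add] at h
  rw [h, h1, h2, add_zero, add_assoc, add_self_F2, add_zero]

/-- Insert the homotopy identity at `b H m`. Now `proj a c' H b H` vanishes, and the surviving term
`proj a H c' b H` is rewritten as `proj a H b` by a second use of the identity, at `m`. -/
theorem projLin_bracket_relation (a b : SlBasis) (ha : a ≠ .d) (hb : b ≠ .d) (m : M') :
    C.proj (r' (Pi.single a 1) (r' (Pi.single b 1) (C.H m))) =
      C.proj (r' (Pi.single a 1) (C.H (r' (Pi.single b 1) m))) +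
      r (Pi.single a 1) (C.proj (r' (Pi.single b 1) (C.H m))) := by
  have hn : C.H (r' (Pi.single b 1) (C.H m)) ∈ C.N := C.H_Q _ (C.act_Q b hb _ (C.H_mem m))
  have h1 : C.proj (r' (Pi.single a 1) (c' (C.H (r' (Pi.single b 1) (C.H m))))) = 0 := by
    have h := congrArg C.proj (C.c_act a (C.H (r' (Pi.single b 1) (C.H m))))
    rw [map_add, C.proj_N (C.br_N _ _ hn), proj_c, C.proj_act_H_act_H ha hb, map_zero,
      add_zero] at h
    exact h.symm
  have h2 : C.proj (r' (Pi.single a 1) (C.H (c' (r' (Pi.single b 1) (C.H m))))) =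
      C.proj (r' (Pi.single a 1) (C.H (r' (Pi.single b 1) m))) := by
    have h3 := congrArg (fun m => C.proj (r' (Pi.single a 1) (C.H (r' (Pi.single b 1) m))))
      (C.incl_proj m)
    simp only [map_add] at h3
    rw [C.proj_act_H_act_H ha hb, C.proj_N (C.act_N a ha _ (C.H_act_incl_mem hb _)),
      add_zero] at h3
    rw [C.c_act, map_add, map_add, map_add,
      C.proj_N (C.act_N a ha _ (C.H_Q _ (C.br_Q _ _ (C.H_mem m)))), add_zero]
    exact (eq_of_add_eq_zero h3.symm).symm
  have h := congrArg (fun m => C.proj (r' (Pi.single a 1) m))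
    (C.incl_proj (r' (Pi.single b 1) (C.H m)))
  simp only [proj_act_incl, map_add] at h
  rw [h, h1, h2, add_zero, add_comm, add_assoc, add_self_F2, add_zero]

/-! ### The two `L_∞`-quasi-isomorphisms of a contraction. -/

variable {K : LInfModuleData Sl2dg M} {K' : LInfModuleData Sl2dg M'}

theorem exists_quasiIso_incl (hK : ∀ a, K.op a = unaryFamily c r a)
    (hK' : ∀ a, K'.op a = unaryFamily c' r' a)
    (hr' : ∀ b m e, m ∈ K'.gr e → r' (Pi.single b 1) m ∈ K'.gr (SlBasis.deg b + e))
    (hι : ∀ m e, m ∈ K.gr e → C.ι m ∈ K'.gr e)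
    (hH : ∀ m e, m ∈ K'.gr e → C.H m ∈ K'.gr (e - 1)) :
    ∃ h : LInfModuleHom sl2dg K K', h.IsQuasiIso := by
  have hi (m : M) (e : ℤ) (hm : m ∈ K.gr e) : C.incl m ∈ K'.gr e := by
    refine Submodule.add_mem _ (hι m e hm) ?_
    have h := hH _ _ (hr' .d _ _ (hι m e hm))
    rw [C.r_d'] at h
    change C.H (c' (C.ι m)) ∈ _
    convert h using 2
    simp [SlBasis.deg]
  refine ⟨unaryHom hK hK' C.incl C.inclLin hi ?_ C.incl_c ?_ ?_, ?_, ?_⟩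
  · intro b m e hm
    by_cases hb : b = .d
    · rw [hb, C.inclLin_d]
      simpa [SlBasis.deg] using hi m e hm
    · rw [C.inclLin_of_ne hb]
      exact hH _ _ (hr' _ _ _ (hi m e hm))
  · intro b m
    rw [bracket_single, inclLin_bracket]
    by_cases hb : b = .d
    · simp [hb, SlBasis.bracket, C.inclLin_d, C.r_d, C.r_d', C.incl_c, add_self_F2]
    · have h := C.inclLin_relation b m
      rw [C.inclLin_of_ne hb, C.inclLin_of_ne hb]
      have h1 := add_self_F2 (C.incl (r (Pi.single b 1) m))
      have h2 := add_self_F2 (r' (Pi.single b 1) (C.incl m))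
      linear_combination (norm := module) h + h1 + h2
  · intro a b m
    -- This is the relation for a pair containing `d`, once the component at `d` is replaced by
    -- `incl` and the action of `d` by the differential.
    have key (b : SlBasis) (hb : b ≠ .d) (m : M) : C.H (r' (SlBasis.bracket .d b) (C.incl m)) +
        (C.incl (r (Pi.single b 1) m) + C.H (r' (Pi.single b 1) (C.incl (c m)))) +
        (c' (C.H (r' (Pi.single b 1) (C.incl m))) + r' (Pi.single b 1) (C.incl m)) = 0 := by
      have h := C.inclLin_relation b m
      have h1 := add_self_F2 (C.incl (r (Pi.single b 1) m))
      have h2 := add_self_F2 (r' (Pi.single b 1) (C.incl m))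
      linear_combination (norm := module) h + h1 + h2
    rw [inclLin_bracket]
    by_cases ha : a = .d
    · by_cases hb : b = .d
      · simp [ha, hb, SlBasis.bracket, add_self_F2]
      · rw [ha, C.inclLin_d, C.inclLin_of_ne hb, C.inclLin_of_ne hb, C.r_d, C.r_d']
        exact key b hb m
    · by_cases hb : b = .d
      · rw [hb, C.inclLin_d, C.inclLin_of_ne ha, C.inclLin_of_ne ha, C.r_d, C.r_d', ← key a ha m,
          show SlBasis.bracket a .d = SlBasis.bracket .d a by cases a <;> rfl]
        module
      · rw [C.inclLin_of_ne ha, C.inclLin_of_ne ha, C.inclLin_of_ne hb, C.inclLin_of_ne hb, C.br',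
          map_add, C.inclLin_bracket_relation a b ha hb, C.inclLin_bracket_relation b a hb ha]
        have h1 := add_self_F2 (C.H (r' (Pi.single a 1) (C.incl (r (Pi.single b 1) m))))
        have h2 := add_self_F2 (C.H (r' (Pi.single b 1) (C.incl (r (Pi.single a 1) m))))
        have h3 := add_self_F2 (r' (Pi.single a 1) (C.H (r' (Pi.single b 1) (C.incl m))))
        have h4 := add_self_F2 (r' (Pi.single b 1) (C.H (r' (Pi.single a 1) (C.incl m))))
        linear_combination (norm := module) h1 + h2 + h3 + h4
  · intro z hz hy
    simp only [LInfModuleData.differential, hK, hK', unaryFamily_apply] at *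
    obtain ⟨y, hy⟩ := hy
    -- The chain map `proj` retracts `incl`, so it carries a primitive of `incl z` to a primitive of
    -- `z`.
    refine ⟨C.proj y, ?_⟩
    have h := congrArg C.proj hy
    exact (C.proj_incl z).symm.trans (h.trans (C.proj_c y))
  · intro w hw
    simp only [LInfModuleData.differential, hK, hK', unaryFamily_apply] at *
    -- For a cycle `w` the homotopy identity says that `incl (proj w)` and `w` differ by `c' (H w)`.
    refine ⟨C.proj w, ?_, C.H w, ?_⟩
    · refine (C.proj_c w).symm.trans ?_
      rw [show c' w = 0 from hw, map_zero]
    · have h := C.incl_proj w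
      rw [show c' w = 0 from hw, map_zero, add_zero] at h
      have h' := add_self_F2 (c' (C.H w))
      change w = C.incl (C.proj w) + c' (C.H w)
      rw [h, add_assoc, h', add_zero]

theorem exists_quasiIso_proj (hK : ∀ a, K.op a = unaryFamily c r a)
    (hK' : ∀ a, K'.op a = unaryFamily c' r' a)
    (hr' : ∀ b m e, m ∈ K'.gr e → r' (Pi.single b 1) m ∈ K'.gr (SlBasis.deg b + e))
    (hπ : ∀ m e, m ∈ K'.gr e → C.π m ∈ K.gr e)
    (hH : ∀ m e, m ∈ K'.gr e → C.H m ∈ K'.gr (e - 1)) :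
    ∃ h : LInfModuleHom sl2dg K' K, h.IsQuasiIso := by
  have hp (m : M') (e : ℤ) (hm : m ∈ K'.gr e) : C.proj m ∈ K.gr e := by
    refine Submodule.add_mem _ (hπ m e hm) (hπ _ _ ?_)
    have h := hr' .d _ _ (hH m e hm)
    rw [C.r_d'] at h
    change c' (C.H m) ∈ _
    convert h using 2
    simp [SlBasis.deg]
  refine ⟨unaryHom hK' hK C.proj C.projLin hp ?_ C.proj_c ?_ ?_, ?_, ?_⟩
  · intro b m e hm
    by_cases hb : b = .d
    · rw [hb, C.projLin_d]
      simpa [SlBasis.deg] using hp m e hm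
    · rw [C.projLin_of_ne hb]
      have h := hp _ _ (hr' b _ _ (hH m e hm))
      convert h using 2
      ring
  · intro b m
    rw [bracket_single, projLin_bracket]
    by_cases hb : b = .d
    · simp [hb, SlBasis.bracket, C.projLin_d, C.r_d, C.r_d', C.proj_c, add_self_F2]
    · have h := C.projLin_relation b m
      rw [C.projLin_of_ne hb, C.projLin_of_ne hb]
      have h1 := add_self_F2 (C.proj (r' (Pi.single b 1) m))
      have h2 := add_self_F2 (r (Pi.single b 1) (C.proj m))
      linear_combination (norm := module) h + h1 + h2
  · intro a b m
    have key (b : SlBasis) (hb : b ≠ .d) (m : M') : C.proj (r' (SlBasis.bracket .d b) (C.H m)) +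
        (C.proj (r' (Pi.single b 1) m) + C.proj (r' (Pi.single b 1) (C.H (c' m)))) +
        (c (C.proj (r' (Pi.single b 1) (C.H m))) + r (Pi.single b 1) (C.proj m)) = 0 := by
      have h := C.projLin_relation b m
      have h1 := add_self_F2 (C.proj (r' (Pi.single b 1) m))
      have h2 := add_self_F2 (r (Pi.single b 1) (C.proj m))
      linear_combination (norm := module) h + h1 + h2
    rw [projLin_bracket]
    by_cases ha : a = .d
    · by_cases hb : b = .d
      · simp [ha, hb, SlBasis.bracket, add_self_F2]
      · rw [ha, C.projLin_d, C.projLin_of_ne hb, C.projLin_of_ne hb, C.r_d, C.r_d']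
        exact key b hb m
    · by_cases hb : b = .d
      · rw [hb, C.projLin_d, C.projLin_of_ne ha, C.projLin_of_ne ha, C.r_d, C.r_d', ← key a ha m,
          show SlBasis.bracket a .d = SlBasis.bracket .d a by cases a <;> rfl]
        module
      · rw [C.projLin_of_ne ha, C.projLin_of_ne ha, C.projLin_of_ne hb, C.projLin_of_ne hb, C.br',
          map_add, C.projLin_bracket_relation a b ha hb, C.projLin_bracket_relation b a hb ha]
        have h1 := add_self_F2 (C.proj (r' (Pi.single a 1) (C.H (r' (Pi.single b 1) m))))
        have h2 := add_self_F2 (C.proj (r' (Pi.single b 1) (C.H (r' (Pi.single a 1) m))))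
        have h3 := add_self_F2 (r (Pi.single a 1) (C.proj (r' (Pi.single b 1) (C.H m))))
        have h4 := add_self_F2 (r (Pi.single b 1) (C.proj (r' (Pi.single a 1) (C.H m))))
        linear_combination (norm := module) h1 + h2 + h3 + h4
  · intro z hz hy
    simp only [LInfModuleData.differential, hK, hK', unaryFamily_apply] at *
    obtain ⟨y, hy⟩ := hy
    -- If `z` is a cycle and `proj z = c y`, the homotopy identity reads `incl (c y) = z + c' (H
    -- z)`, and `incl` commutes with the differentials.
    refine ⟨C.incl y + C.H z, ?_⟩
    have h := C.incl_proj z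
    rw [show C.proj z = c y from hy, show c' z = 0 from hz, map_zero, add_zero, C.incl_c] at h
    change z = c' (C.incl y + C.H z)
    rw [map_add, h, add_assoc, add_self_F2, add_zero]
  · intro w hw
    simp only [LInfModuleData.differential, hK, hK', unaryFamily_apply] at *
    refine ⟨C.incl w, ?_, 0, ?_⟩
    · refine (C.incl_c w).symm.trans ?_
      rw [show c w = 0 from hw, map_zero]
    · change w = C.proj (C.incl w) + c 0
      rw [map_zero, add_zero, C.proj_incl]

end Contraction

end Contraction

/-! # The checkerboard colouring of a planar diagram -/

namespace AnnularDiagram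

section Checkerboard

variable {X M : Type}

/-- The vertex of a half-edge. -/
def vert : HalfEdge X M → X ⊕ M
  | .inl (x, _) => .inl x
  | .inr (p, _) => .inr p

theorem vert_rotate (a : HalfEdge X M) : vert (rotate a) = vert a := by
  rcases a with ⟨x, k⟩ | ⟨p, s⟩ <;> rfl

theorem rotate_injective : Function.Injective (rotate : HalfEdge X M → HalfEdge X M) := by
  rintro (⟨x, k⟩ | ⟨p, s⟩) (⟨y, l⟩ | ⟨q, t⟩) h <;> simp_all [rotate]

/-- The parity of the number of a half-edge at its vertex. -/
def halfParity : HalfEdge X M → F2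
  | .inl (_, k) => ZMod.castHom (show 2 ∣ 4 by norm_num) (ZMod 2) k
  | .inr (_, s) => if s then 1 else 0

theorem halfParity_rotate (a : HalfEdge X M) : halfParity (rotate a) = halfParity a + 1 := by
  rcases a with ⟨x, k⟩ | ⟨p, s⟩
  · simp [rotate, halfParity, ZMod.cast_add]
  · cases s <;> simp [rotate, halfParity]; rfl

/-- Rotation permutes the half-edges at a vertex, so the two sums are equal and cancel modulo two.
-/
theorem sum_vert_rotate [Fintype (HalfEdge X M)] [DecidableEq (X ⊕ M)] (g : HalfEdge X M → F2)
    (v : X ⊕ M) : ∑ a, (if vert a = v then g a + g (rotate a) else 0) = 0 := by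
  have h : ∑ a, (if vert a = v then g (rotate a) else 0) = ∑ a, if vert a = v then g a else 0 := by
    rw [← (Finite.injective_iff_bijective.1 (rotate_injective (X := X) (M := M))).sum_comp
      (fun a => if vert a = v then g a else 0)]
    simp [vert_rotate]
  have h2 (a : HalfEdge X M) : (if vert a = v then g a + g (rotate a) else 0) =
      (if vert a = v then g a else 0) + (if vert a = v then g (rotate a) else 0) := by
    split <;> simp
  simp only [h2]
  rw [Finset.sum_add_distrib, h, CharTwo.add_self_eq_zero]

end Checkerboard

variable (D : AnnularDiagram)

open Classical in
/-- In a planar diagram the faces can be coloured so that adjacent faces have different colours. -/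
theorem exists_checkerboard : ∃ σ : D.Half → F2,
    (∀ a, σ (D.opp a) = σ a + 1) ∧ ∀ a, σ (rotate a) = σ a + 1 := by
  have hfX := Fintype.ofFinite D.Crossing
  have hfM := Fintype.ofFinite D.Marker
  set Face := Quot fun a b : D.Half => b = rotate (D.opp a)
  set Comp := Quot fun a b : D.Half => b = D.opp a ∨ b = rotate a
  have hfF : Fintype Face := Fintype.ofFinite _
  have hfC : Fintype Comp := Fintype.ofFinite _
  -- The kernel of `θ` is the space of functions on edges, that is, of 1-chains modulo two. The
  -- strategy is to show that every 1-cycle is a boundary of faces, and to apply this to the sum of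
  -- all edges.
  let θ : (D.Half → F2) →ₗ[F2] (D.Half → F2) := LinearMap.id + LinearMap.funLeft F2 F2 D.opp
  have hθ (w : D.Half → F2) (a : D.Half) : θ w a = w a + w (D.opp a) := rfl
  -- `A w` is the boundary of the 1-chain `θ w`, so the image under `θ` of the kernel of `A`
  -- consists of cycles.
  let A : Matrix (D.Crossing ⊕ D.Marker) D.Half F2 := Matrix.of fun v a =>
    (if vert a = v then 1 else 0) + (if vert (D.opp a) = v then 1 else 0)
  have hbij : Function.Bijective D.opp := Function.Involutive.bijective D.opp_opp
  have hA (w : D.Half → F2) (v) :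
      A.mulVecLin w v = ∑ a, if vert a = v then w a + w (D.opp a) else 0 := by
    have h1 : A.mulVecLin w v = ∑ a, ((if vert a = v then w a else 0) +
        if vert (D.opp a) = v then w a else 0) := by
      simp [Matrix.mulVec, dotProduct, A, add_mul]
    have h2 : ∑ a, (if vert (D.opp a) = v then w a else 0) =
        ∑ a, if vert a = v then w (D.opp a) else 0 := by
      rw [← hbij.sum_comp (fun a => if vert (D.opp a) = v then w a else 0)]
      simp [D.opp_opp]
    rw [h1, Finset.sum_add_distrib, h2, ← Finset.sum_add_distrib]
    refine Finset.sum_congr rfl fun a _ => ?_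
    split <;> simp
  have hAt (ψ) (a : D.Half) : A.transpose.mulVecLin ψ a = ψ (vert a) + ψ (vert (D.opp a)) := by
    rw [Matrix.mulVecLin_apply]
    simp only [Matrix.mulVec, dotProduct, A, Matrix.transpose_apply, Matrix.of_apply, add_mul,
      Finset.sum_add_distrib, ite_mul, one_mul, zero_mul, Finset.sum_ite_eq, Finset.mem_univ, if_true]
  set K := LinearMap.ker A.mulVecLin
  have hK (w g : D.Half → F2) (h : ∀ a, w a + w (D.opp a) = g a + g (rotate a)) : w ∈ K := by
    rw [LinearMap.mem_ker]
    ext v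
    rw [hA]
    simp only [h, sum_vert_rotate, Pi.zero_apply]
  -- the kernel of `θ`
  have hker : LinearMap.ker θ ≤ K := by
    intro w hw
    refine hK w 0 fun a => ?_
    rw [← hθ, LinearMap.mem_ker.1 hw]
    rfl
  have hnum : Fintype.card D.Half ≤ 2 * Module.finrank F2 (LinearMap.ker θ) := by
    have h1 := LinearMap.finrank_range_add_finrank_ker θ
    have h2 : LinearMap.range θ ≤ LinearMap.ker θ := by
      rintro _ ⟨w, rfl⟩
      rw [LinearMap.mem_ker]
      ext a
      rw [hθ, hθ, hθ, D.opp_opp, add_comm (w (D.opp a)), CharTwo.add_self_eq_zero]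
      rfl
    have h3 := Submodule.finrank_mono h2
    rw [Module.finrank_fintype_fun_eq_card] at h1
    omega
  have hmapK : Module.finrank F2 (K.map θ) + Module.finrank F2 (LinearMap.ker θ) =
      Module.finrank F2 K := by
    have h1 := LinearMap.finrank_range_add_finrank_ker (θ.domRestrict K)
    rw [LinearMap.range_domRestrict, LinearMap.ker_domRestrict] at h1
    rw [← (Submodule.submoduleOfEquivOfLe hker).finrank_eq]
    exact h1
  -- The rank of `A` is that of its transpose, whose kernel consists of vertex functions that are
  -- constant along edges and hence on components. So the cycles have dimension at most `E - V + C`.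
  have hrank : Module.finrank F2 K + Fintype.card (D.Crossing ⊕ D.Marker) ≤
      Fintype.card D.Half + Fintype.card Comp := by
    have h1 := LinearMap.finrank_range_add_finrank_ker A.mulVecLin
    have h2 := LinearMap.finrank_range_add_finrank_ker A.transpose.mulVecLin
    have h3 : A.transpose.rank = A.rank := Matrix.rank_transpose A
    rw [Module.finrank_fintype_fun_eq_card] at h1 h2
    have h4 : Module.finrank F2 (LinearMap.ker A.transpose.mulVecLin) ≤ Fintype.card Comp := by
      rw [← Module.finrank_fintype_fun_eq_card F2 (η := Comp)]
      have hψ (ψ : LinearMap.ker A.transpose.mulVecLin) (a : D.Half) :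
          (ψ : _ → F2) (vert a) = (ψ : _ → F2) (vert (D.opp a)) := by
        have h := congrFun (LinearMap.mem_ker.1 ψ.2) a
        rw [hAt] at h
        exact CharTwo.add_eq_zero.1 h
      let L : LinearMap.ker A.transpose.mulVecLin →ₗ[F2] (Comp → F2) :=
        { toFun := fun ψ => Quot.lift (fun a => (ψ : _ → F2) (vert a)) (by
            rintro a b (rfl | rfl)
            · exact hψ ψ a
            · rw [vert_rotate])
          map_add' := by intro ψ φ; ext ⟨a⟩; rfl
          map_smul' := by intro ψ φ; ext ⟨a⟩; rfl }
      refine LinearMap.finrank_le_finrank_of_injective (f := L) ?_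
      intro ψ φ h
      ext v
      obtain ⟨a, rfl⟩ : ∃ a : D.Half, vert a = v := by
        rcases v with x | p
        · exact ⟨.inl (x, 0), rfl⟩
        · exact ⟨.inr (p, false), rfl⟩
      exact congrFun h (Quot.mk _ a)
    simp only [Matrix.rank] at h3
    change _ + Module.finrank F2 K = _ at h1
    omega
  -- functions on faces
  let T : (Face → F2) →ₗ[F2] (D.Half → F2) := θ ∘ₗ LinearMap.funLeft F2 F2 (Quot.mk _)
  have hT (f : Face → F2) (a : D.Half) : T f a = f (Quot.mk _ a) + f (Quot.mk _ (D.opp a)) := rfl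
  have hface (a : D.Half) : (Quot.mk _ (D.opp a) : Face) = Quot.mk _ (rotate a) :=
    Quot.sound (by rw [D.opp_opp])
  -- `T` sends a set of faces to its boundary. Crossing an edge and rotating at the vertex lead to
  -- the same face, so the boundary has even valency everywhere.
  have hTK : LinearMap.range T ≤ K.map θ := by
    rintro _ ⟨f, rfl⟩
    refine ⟨_, hK _ (fun a => f (Quot.mk _ a)) fun a => ?_, rfl⟩
    rw [← hface]
    rfl
  have hTker : Module.finrank F2 (LinearMap.ker T) ≤ Fintype.card Comp := by
    rw [← Module.finrank_fintype_fun_eq_card F2 (η := Comp)]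
    have hψ (f : LinearMap.ker T) (a : D.Half) :
        f.1 (Quot.mk _ a) = f.1 (Quot.mk _ (D.opp a)) := by
      have h := congrFun (LinearMap.mem_ker.1 f.2) a
      rw [hT] at h
      exact CharTwo.add_eq_zero.1 h
    let L : LinearMap.ker T →ₗ[F2] (Comp → F2) :=
      { toFun := fun f => Quot.lift (fun a => f.1 (Quot.mk _ a)) (by
          rintro a b (rfl | rfl)
          · exact hψ f a
          · rw [← hface]; exact hψ f a)
        map_add' := by intro ψ φ; ext ⟨a⟩; rfl
        map_smul' := by intro ψ φ; ext ⟨a⟩; rfl }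
    refine LinearMap.finrank_le_finrank_of_injective (f := L) ?_
    intro ψ φ h
    ext ⟨a⟩
    exact congrFun h (Quot.mk _ a)
  have hTdim := LinearMap.finrank_range_add_finrank_ker T
  rw [Module.finrank_fintype_fun_eq_card] at hTdim
  have hcard : Fintype.card D.Half = 4 * Fintype.card D.Crossing + 2 * Fintype.card D.Marker := by
    simp [Fintype.card_sum, ZMod.card, mul_comm]
  have hpl : Fintype.card Face = Fintype.card D.Crossing + 2 * Fintype.card Comp := by
    have := D.planar
    simpa only [Nat.card_eq_fintype_card] using this
  rw [Fintype.card_sum] at hrank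
  -- The boundaries have dimension at least `F - C`, the cycles at most `E - V + C`; by Euler's
  -- formula these numbers agree.
  have heq : LinearMap.range T = K.map θ := Submodule.eq_of_le_of_finrank_le hTK (by omega)
  -- All vertices have even valency, so the sum of all edges is a cycle. The orientation provides a
  -- preimage under `θ`, and the parity of the half-edge numbers shows that it lies in `K`.
  have hone : (fun _ => 1 : D.Half → F2) ∈ K.map θ := by
    have h1 (a : D.Half) : ((if D.out a then 1 else 0) + if D.out (D.opp a) then 1 else 0 : F2) = 1 := by
      rw [D.out_opp]
      cases D.out a <;> simp
    refine ⟨fun a => if D.out a then 1 else 0, hK _ halfParity fun a => ?_, ?_⟩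
    · rw [h1, halfParity_rotate, ← add_assoc, CharTwo.add_self_eq_zero, zero_add]
    · ext a
      exact h1 a
  rw [← heq] at hone
  obtain ⟨f, hf⟩ := hone
  have hf' (a : D.Half) : f (Quot.mk _ (D.opp a)) = f (Quot.mk _ a) + 1 := by
    rw [← congrFun hf a, hT, ← add_assoc, CharTwo.add_self_eq_zero, zero_add]
  exact ⟨fun a => f (Quot.mk _ a), hf', fun a => (congrArg f (hface a)).symm.trans (hf' a)⟩

end AnnularDiagram

/-! # Circles of resolutions -/

/-- Composing a permutation with the transposition of two points joins their cycles or splits their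
common cycle; only the values at an invariant set matter. -/
theorem exists_iterate_swap_iff {α : Type*} [Finite α] {τ τ' : Equiv.Perm α} {a b : α} (hab : a ≠ b)
    {P : α → Prop} (hP : ∀ c, P c → P (τ c)) (ha : P a)
    (h : ∀ c, P c → τ c ≠ a → τ c ≠ b → τ' c = τ c) (h1 : ∀ c, P c → τ c = a → τ' c = b)
    (h2 : ∀ c, P c → τ c = b → τ' c = a) :
    (∃ n, τ'^[n] a = b) ↔ ¬ ∃ n, τ^[n] a = b := by
  classical
  have hPn (n : ℕ) : P (τ^[n] a) := by
    induction n with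
    | zero => exact ha
    | succ n ih => rw [Function.iterate_succ_apply']; exact hP _ ih
  -- Consider the first positive time at which the orbit of `a` under `τ` meets `a` or `b`. Before
  -- it `τ` and `τ'` agree along the orbit, and at that time they take opposite values in `{a, b}`.
  have hret : ∃ k, 0 < k ∧ (τ^[k] a = a ∨ τ^[k] a = b) := by
    refine ⟨orderOf τ, orderOf_pos τ, .inl ?_⟩
    rw [← Equiv.Perm.coe_pow, pow_orderOf_eq_one]; rfl
  obtain ⟨hk0, hk⟩ := Nat.find_spec hret
  have hmin (j : ℕ) (hj : j < Nat.find hret) (hj0 : 0 < j) : τ^[j] a ≠ a ∧ τ^[j] a ≠ b := by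
    have := Nat.find_min hret hj
    tauto
  have heq (j : ℕ) (hj : j < Nat.find hret) : τ'^[j] a = τ^[j] a := by
    induction j with
    | zero => rfl
    | succ j ih =>
      have h3 := hmin (j + 1) hj (by omega)
      rw [Function.iterate_succ_apply'] at h3
      rw [Function.iterate_succ_apply', Function.iterate_succ_apply', ih (by omega)]
      exact h _ (hPn j) h3.1 h3.2
  have hper {f : Equiv.Perm α} (hf : f^[Nat.find hret] a = a)
      (hf' : ∀ j < Nat.find hret, f^[j] a = τ^[j] a) : ¬ ∃ n, f^[n] a = b := by
    rintro ⟨n, hn⟩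
    have h3 : f^[n % Nat.find hret] a = b :=
      (Function.IsPeriodicPt.iterate_mod_apply hf n).trans hn
    have h4 := Nat.mod_lt n hk0
    rw [hf' _ h4] at h3
    by_cases h5 : n % Nat.find hret = 0
    · rw [h5] at h3; exact hab h3
    · exact (hmin _ h4 (by omega)).2 h3
  obtain ⟨k, hk1⟩ : ∃ k, Nat.find hret = k + 1 := ⟨Nat.find hret - 1, by omega⟩
  have hstep : τ'^[Nat.find hret] a = τ' (τ^[k] a) := by
    rw [hk1, Function.iterate_succ_apply', heq k (by omega)]
  have hstep' : τ^[Nat.find hret] a = τ (τ^[k] a) := by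
    rw [hk1, Function.iterate_succ_apply']
  rcases hk with hk | hk
  · refine ⟨fun _ => hper hk fun _ _ => rfl, fun _ => ⟨Nat.find hret, ?_⟩⟩
    rw [hstep]; exact h1 _ (hPn k) (hstep' ▸ hk)
  · have h3 : ¬ ∃ n, τ'^[n] a = b := hper (by rw [hstep]; exact h2 _ (hPn k) (hstep' ▸ hk)) heq
    exact ⟨fun h4 => absurd h4 h3, fun h4 => absurd ⟨_, hk⟩ h4⟩

namespace AnnularDiagram

variable {D : AnnularDiagram}

/-- The half-edge with number `k` at the crossing `x`. -/
abbrev half (x : D.Crossing) (k : ZMod 4) : D.Half := .inl (x, k)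

theorem zmod4_cases (k : ZMod 4) : k = 0 ∨ k = 1 ∨ k = 2 ∨ k = 3 := by
  revert k; decide

theorem smooth_smooth (v : D.State) (a : D.Half) : D.smooth v (D.smooth v a) = a := by
  rcases a with ⟨x, k⟩ | ⟨p, s⟩
  · cases h : v x <;> simp [smooth, h]
  · simp [smooth]

theorem smooth_half_false {v : D.State} {x : D.Crossing} (h : v x = false) :
    D.smooth v (half x 0) = half x 1 ∧ D.smooth v (half x 1) = half x 0 ∧
      D.smooth v (half x 2) = half x 3 ∧ D.smooth v (half x 3) = half x 2 := by
  simp only [smooth, h]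
  exact ⟨rfl, rfl, rfl, rfl⟩

theorem smooth_half_true {v : D.State} {x : D.Crossing} (h : v x = true) :
    D.smooth v (half x 0) = half x 3 ∧ D.smooth v (half x 1) = half x 2 ∧
      D.smooth v (half x 2) = half x 1 ∧ D.smooth v (half x 3) = half x 0 := by
  simp only [smooth, h]
  exact ⟨rfl, rfl, rfl, rfl⟩

theorem circ_opp (v : D.State) (a : D.Half) : D.circ v (D.opp a) = D.circ v a :=
  (Quot.sound (.inl rfl)).symm

theorem circ_smooth (v : D.State) (a : D.Half) : D.circ v (D.smooth v a) = D.circ v a :=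
  (Quot.sound (.inr rfl)).symm

theorem circ_false {v : D.State} {x : D.Crossing} (h : v x = false) :
    D.circ v (half x 1) = D.circ v (half x 0) ∧ D.circ v (half x 3) = D.circ v (half x 2) := by
  have h1 := circ_smooth v (half x 0)
  have h2 := circ_smooth v (half x 2)
  simp only [smooth, h] at h1 h2
  exact ⟨h1, h2⟩

theorem circ_true {v : D.State} {x : D.Crossing} (h : v x = true) :
    D.circ v (half x 1) = D.circ v (half x 2) ∧ D.circ v (half x 3) = D.circ v (half x 0) := by
  have h1 := circ_smooth v (half x 2)
  have h2 := circ_smooth v (half x 0)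
  simp only [smooth, h] at h1 h2
  exact ⟨h1, h2⟩

/-- A half-edge on a circle through `x` lies on the circle of `0` or `2`. -/
theorem circ_half (v : D.State) (x : D.Crossing) (k : ZMod 4) :
    D.circ v (half x k) = D.circ v (half x 0) ∨ D.circ v (half x k) = D.circ v (half x 2) := by
  cases h : v x
  · have := circ_false h
    obtain rfl | rfl | rfl | rfl := zmod4_cases k <;> tauto
  · have := circ_true h
    obtain rfl | rfl | rfl | rfl := zmod4_cases k <;> tauto

/-- Functions that are invariant along a circle are constant on it. -/
theorem eq_of_circ_eq {α : Sort*} {v : D.State} {a b : D.Half} (f : D.Half → α)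
    (h1 : ∀ a, f (D.opp a) = f a) (h2 : ∀ a, f (D.smooth v a) = f a)
    (h : D.circ v a = D.circ v b) : f a = f b :=
  congrArg (Quot.lift f (by rintro a b (rfl | rfl); exacts [(h1 a).symm, (h2 a).symm])) h

/-- The states `v` and `w` differ exactly at the crossing `x`. -/
def Flip (x : D.Crossing) (v w : D.State) : Prop := w x = (!v x) ∧ ∀ y, y ≠ x → w y = v y

theorem Flip.symm {x : D.Crossing} {v w : D.State} (h : Flip x v w) : Flip x w v :=
  ⟨by rw [h.1, Bool.not_not], fun y hy => (h.2 y hy).symm⟩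

theorem Flip.smooth_eq {x : D.Crossing} {v w : D.State} (h : Flip x v w) {a : D.Half}
    (ha : ∀ k, a ≠ half x k) : D.smooth w a = D.smooth v a := by
  rcases a with ⟨y, k⟩ | ⟨p, s⟩
  · have hy : y ≠ x := by rintro rfl; exact ha k rfl
    simp [smooth, h.2 y hy]
  · rfl

/-- The permutation of the half-edges that follows the circles of a resolution. -/
def travel (v : D.State) : Equiv.Perm D.Half :=
  (Function.Involutive.toPerm D.opp D.opp_opp).trans
    (Function.Involutive.toPerm (D.smooth v) (smooth_smooth v))

theorem travel_apply (v : D.State) (a : D.Half) : travel v a = D.smooth v (D.opp a) := rfl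

theorem circ_travel_iterate (v : D.State) (n : ℕ) (a : D.Half) :
    D.circ v ((travel v)^[n] a) = D.circ v a := by
  induction n with
  | zero => rfl
  | succ n ih => rw [Function.iterate_succ_apply', travel_apply, circ_smooth, circ_opp, ih]

/-- Either smoothing joins half-edges whose numbers have opposite parity, and colours alternate
around a vertex. -/
theorem smooth_color {σ : D.Half → F2} (h : ∀ a, σ (rotate a) = σ a + 1) (v : D.State)
    (a : D.Half) : σ (D.smooth v a) = σ a + 1 := by
  rcases a with ⟨x, k⟩ | ⟨p, s⟩
  · have h0 : σ (half x 1) = σ (half x 0) + 1 := h (half x 0)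
    have h1 : σ (half x 2) = σ (half x 1) + 1 := h (half x 1)
    have h2 : σ (half x 3) = σ (half x 2) + 1 := h (half x 2)
    have h4 (c : F2) : c + 1 + 1 = c := by rw [add_assoc, CharTwo.add_self_eq_zero, add_zero]
    rw [h0, h4] at h1
    rw [h1] at h2
    cases hv : v x
    · obtain ⟨e0, e1, e2, e3⟩ := smooth_half_false hv
      obtain rfl | rfl | rfl | rfl := zmod4_cases k <;> simp only [e0, e1, e2, e3, h0, h1, h2, h4]
    · obtain ⟨e0, e1, e2, e3⟩ := smooth_half_true hv
      obtain rfl | rfl | rfl | rfl := zmod4_cases k <;> simp only [e0, e1, e2, e3, h0, h1, h2, h4]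
  · exact h (.inr (p, s))

/-- Half-edges of the same colour lie on the same circle if and only if one is reached from the other
by travelling. -/
theorem circ_eq_iff_travel {σ : D.Half → F2} (h1 : ∀ a, σ (D.opp a) = σ a + 1)
    (h2 : ∀ a, σ (rotate a) = σ a + 1) (v : D.State) {a b : D.Half} (hab : σ a = σ b) :
    D.circ v a = D.circ v b ↔ ∃ n, (travel v)^[n] a = b := by
  classical
  constructor
  · intro h
    have hne (c : F2) : c + 1 ≠ c := by simp
    have hc (c d : F2) (h : c ≠ d) : c + 1 = d := by revert c d; decide
    -- Both `opp` and smoothing change the colour, so a circle consists of two orbits of `travel`,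
    -- one of each colour. The invariant is the orbit of whichever of `c` and `opp c` has the colour
    -- of `a`.
    let f : D.Half → Set D.Half := fun c =>
      {e | (travel v).SameCycle (if σ c = σ a then c else D.opp c) e}
    have hf := eq_of_circ_eq (v := v) f ?_ ?_ h
    · have hb : b ∈ f b := by
        simp only [f, Set.mem_ofPred_eq, hab, if_true]; exact Equiv.Perm.SameCycle.refl _ _
      rw [← hf] at hb
      simp only [f, Set.mem_ofPred_eq, if_true] at hb
      obtain ⟨n, hn⟩ := hb.exists_nat_pow_eq
      exact ⟨n, by rw [← Equiv.Perm.coe_pow, hn]⟩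
    · intro c
      by_cases hca : σ c = σ a
      · simp only [f, h1, hca, hne, if_false, if_true, D.opp_opp]
      · simp only [f, h1, hca, hc _ _ hca, if_false, if_true]
    · intro c
      have key (e : D.Half) : {u | (travel v).SameCycle (travel v e) u} =
          {u | (travel v).SameCycle e u} := by
        ext u; exact Equiv.Perm.sameCycle_apply_left
      by_cases hca : σ c = σ a
      · simp only [f, smooth_color h2, hca, hne, if_false, if_true]
        rw [← key, travel_apply, D.opp_opp, smooth_smooth]
      · simp only [f, smooth_color h2, hca, hc _ _ hca, if_false, if_true]
        rw [← key (D.opp c), travel_apply, D.opp_opp]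
  · rintro ⟨n, rfl⟩
    exact (circ_travel_iterate v n a).symm

/-- In a planar diagram, changing the resolution of a crossing merges two circles or splits one. -/
theorem Flip.circ_iff {x : D.Crossing} {v w : D.State} (h : Flip x v w) :
    D.circ w (half x 0) = D.circ w (half x 2) ↔ ¬ D.circ v (half x 0) = D.circ v (half x 2) := by
  obtain ⟨σ, h1, h2⟩ := D.exists_checkerboard
  have h4 (c : F2) : c + 1 + 1 = c := by rw [add_assoc, CharTwo.add_self_eq_zero, add_zero]
  have h01 : σ (half x 1) = σ (half x 0) + 1 := h2 (half x 0)
  have h12 : σ (half x 2) = σ (half x 1) + 1 := h2 (half x 1)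
  have h23 : σ (half x 3) = σ (half x 2) + 1 := h2 (half x 2)
  have h02 : σ (half x 0) = σ (half x 2) := by rw [h12, h01, h4]
  rw [circ_eq_iff_travel h1 h2 v h02, circ_eq_iff_travel h1 h2 w h02]
  -- The half-edges 0 and 2 are those of one colour at `x`. On this colour class, changing the
  -- smoothing composes `travel` with their transposition, which joins or splits cycles and never
  -- leaves their number unchanged.
  refine exists_iterate_swap_iff (P := fun a => σ a = σ (half x 0)) (by simp [half]; decide) ?_ rfl ?_ ?_ ?_
  · intro c hc
    rw [travel_apply, smooth_color h2, h1, h4, hc]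
  · intro c hc ha hb
    rw [travel_apply, travel_apply]
    refine h.smooth_eq fun k hk => ?_
    rw [travel_apply, hk] at ha hb
    have hs := h1 c
    rw [hk, hc] at hs
    cases hv : v x
    · obtain ⟨e0, e1, e2, e3⟩ := smooth_half_false hv
      obtain rfl | rfl | rfl | rfl := zmod4_cases k <;> simp [e0, e1, e2, e3, h02] at ha hb hs
    · obtain ⟨e0, e1, e2, e3⟩ := smooth_half_true hv
      obtain rfl | rfl | rfl | rfl := zmod4_cases k <;> simp [e0, e1, e2, e3, h02] at ha hb hs
  all_goals
    intro c hc ha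
    have hd := h.1
    have hc' : D.opp c = D.smooth v (travel v c) := by rw [travel_apply, smooth_smooth]
    rw [travel_apply, hc', ha]
    cases hv : v x <;> rw [hv] at hd
    · obtain ⟨e0, e1, e2, e3⟩ := smooth_half_false hv
      obtain ⟨e0', e1', e2', e3'⟩ := smooth_half_true hd
      simp only [e0, e2, e1', e3']
    · obtain ⟨e0, e1, e2, e3⟩ := smooth_half_true hv
      obtain ⟨e0', e1', e2', e3'⟩ := smooth_half_false hd
      simp only [e0, e2, e1', e3']

/-- The circles that do not touch `x` do not change. -/
theorem Flip.circ_eq_of_ne {x : D.Crossing} {v w : D.State} (h : Flip x v w) {a b : D.Half}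
    (h0 : D.circ v a ≠ D.circ v (half x 0)) (h2 : D.circ v a ≠ D.circ v (half x 2))
    (hab : D.circ v a = D.circ v b) : D.circ w a = D.circ w b := by
  have h3 := eq_of_circ_eq (v := v)
    (fun c => D.circ v c = D.circ v a → D.circ w c = D.circ w a) ?_ ?_ hab.symm
  · have h4 : D.circ v b = D.circ v a → D.circ w b = D.circ w a := by rw [h3]; exact fun _ => rfl
    exact (h4 hab.symm).symm
  · intro c; rw [circ_opp, circ_opp]
  · intro c
    rw [circ_smooth]
    by_cases hc : D.circ v c = D.circ v a
    · rw [← h.smooth_eq (a := c), circ_smooth]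
      rintro k rfl
      obtain h5 | h5 := circ_half v x k
      · exact h0 (hc.symm.trans h5)
      · exact h2 (hc.symm.trans h5)
    · simp [hc]

/-- The half-edge `a` lies on a circle that touches the crossing `x`. -/
def Touches (v : D.State) (x : D.Crossing) (a : D.Half) : Prop :=
  D.circ v a = D.circ v (half x 0) ∨ D.circ v a = D.circ v (half x 2)

theorem touches_iff {v : D.State} {x : D.Crossing} {a : D.Half} :
    Touches v x a ↔ ∃ k, D.circ v a = D.circ v (half x k) := by
  constructor
  · rintro (h | h)
    exacts [⟨0, h⟩, ⟨2, h⟩]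
  · rintro ⟨k, hk⟩
    rw [Touches, hk]
    exact circ_half v x k

theorem Touches.congr {v : D.State} {x : D.Crossing} {a b : D.Half}
    (h : D.circ v a = D.circ v b) : Touches v x a ↔ Touches v x b := by
  rw [Touches, Touches, h]

/-- A circle that avoids `x` is the same set of half-edges in both states, since no smoothing along
it changes. -/
theorem Flip.circ_iff_of_not_touches {x : D.Crossing} {v w : D.State} (h : Flip x v w)
    {a : D.Half} (ha : ¬ Touches v x a) (b : D.Half) :
    D.circ w a = D.circ w b ↔ D.circ v a = D.circ v b := by
  simp only [Touches, not_or] at ha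
  refine ⟨fun hab => ?_, h.circ_eq_of_ne ha.1 ha.2⟩
  have h3 := eq_of_circ_eq (v := w) (fun c => D.circ v c = D.circ v a) ?_ ?_ hab
  · simp only [true_iff, eq_iff_iff] at h3; exact h3.symm
  · intro c; rw [circ_opp]
  · intro c
    by_cases hc : ∀ k, c ≠ half x k
    · rw [h.smooth_eq hc, circ_smooth]
    · push Not at hc
      obtain ⟨k, rfl⟩ := hc
      have key (k : ZMod 4) : ¬ D.circ v (half x k) = D.circ v a := by
        intro h5
        obtain h6 | h6 := circ_half v x k
        · exact ha.1 (h5.symm.trans h6)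
        · exact ha.2 (h5.symm.trans h6)
      simp only [smooth, key]

/-- The circles through `x` fill the complement of the circles avoiding `x`, and the latter do not
change. -/
theorem Flip.touches_iff {x : D.Crossing} {v w : D.State} (h : Flip x v w) (a : D.Half) :
    Touches w x a ↔ Touches v x a := by
  by_cases ha : Touches v x a
  · by_cases hb : Touches w x a
    · simp [ha, hb]
    · have h0 := h.symm.circ_iff_of_not_touches hb
      exfalso
      apply hb
      rcases ha with h1 | h1
      · exact .inl ((h0 _).1 h1)
      · exact .inr ((h0 _).1 h1)
  · have h0 := h.circ_iff_of_not_touches ha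
    simp only [Touches] at ha ⊢
    rw [h0, h0]

/-- Two circles merge: circles become coarser. -/
theorem Flip.circ_eq_of_merge {x : D.Crossing} {v w : D.State} (h : Flip x v w)
    (hv : D.circ v (half x 0) ≠ D.circ v (half x 2)) {a b : D.Half}
    (hab : D.circ v a = D.circ v b) : D.circ w a = D.circ w b := by
  by_cases ha : Touches v x a
  · have hb := (Touches.congr hab).1 ha
    have hw := h.circ_iff.2 hv
    rw [← h.touches_iff] at ha hb
    simp only [Touches, ← hw, or_self] at ha hb
    rw [ha, hb]
  · exact (h.circ_iff_of_not_touches ha b).2 hab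

/-- After a merge all half-edges that touch `x` lie on one circle. -/
theorem Flip.circ_of_touches {x : D.Crossing} {v w : D.State} (h : Flip x v w)
    (hv : D.circ v (half x 0) ≠ D.circ v (half x 2)) {a : D.Half}
    (ha : Touches v x a) : D.circ w a = D.circ w (half x 0) := by
  have hw := h.circ_iff.2 hv
  rw [← h.touches_iff] at ha
  simpa only [Touches, ← hw, or_self] using ha

end AnnularDiagram

/-! # The total differential -/

namespace AnnularDiagram

variable {D : AnnularDiagram}

theorem label_congr {g : D.Gen} {a b : D.Half} (h : D.circ g.1 a = D.circ g.1 b) :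
    label g a = label g b := congrArg g.2 h

theorem label_opp (g : D.Gen) (a : D.Half) : label g (D.opp a) = label g a :=
  label_congr (circ_opp _ _)

theorem label_smooth (g : D.Gen) (a : D.Half) : label g (D.smooth g.1 a) = label g a :=
  label_congr (circ_smooth _ _)

theorem gen_ext {g g' : D.Gen} (h1 : g.1 = g'.1) (h2 : ∀ a, label g a = label g' a) : g = g' := by
  obtain ⟨v, l⟩ := g
  obtain ⟨w, l'⟩ := g'
  obtain rfl : v = w := h1
  congr 1
  ext ⟨a⟩
  exact h2 a

/-- The generator with given labels on the half-edges. -/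
def mkGen (v : D.State) (l : D.Half → Bool) (h1 : ∀ a, l (D.opp a) = l a)
    (h2 : ∀ a, l (D.smooth v a) = l a) : D.Gen :=
  ⟨v, Quot.lift l (by rintro a b (rfl | rfl); exacts [(h1 a).symm, (h2 a).symm])⟩

/-- Labels of circles that do not touch `x` extend to the other resolution of `x`, with prescribed
labels of the circles that touch `x`. -/
theorem Flip.exists_gen {x : D.Crossing} {g : D.Gen} {w : D.State} (h : Flip x g.1 w)
    (c : ZMod 2 → Bool)
    (hc : D.circ w (half x 0) = D.circ w (half x 2) → c 0 = c 1) :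
    ∃ g' : D.Gen, g'.1 = w ∧ (∀ a, ¬ Touches g.1 x a → label g' a = label g a) ∧
      label g' (half x 0) = c 0 ∧ label g' (half x 2) = c 1 := by
  classical
  let l : D.Half → Bool := fun a => if D.circ w a = D.circ w (half x 0) then c 0 else
    if D.circ w a = D.circ w (half x 2) then c 1 else label g a
  refine ⟨mkGen w l ?_ ?_, rfl, ?_, ?_, ?_⟩
  · intro a; simp only [l, circ_opp, label_opp]
  · intro a
    simp only [l, circ_smooth]
    by_cases h0 : D.circ w a = D.circ w (half x 0)
    · simp [h0]
    by_cases h2 : D.circ w a = D.circ w (half x 2)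
    · simp [h2]
    rw [if_neg h0, if_neg h2, if_neg h0, if_neg h2, h.smooth_eq, label_smooth]
    rintro k rfl
    obtain h5 | h5 := circ_half w x k
    exacts [h0 h5, h2 h5]
  · intro a ha
    rw [← h.touches_iff, Touches, not_or] at ha
    change l a = _
    simp only [l, ha.1, ha.2, if_false]
  · change l _ = _
    simp [l]
  · change l _ = _
    simp only [l, if_true]
    split
    · next h => exact hc h.symm
    · rfl

theorem gen_ext_of_touches {x : D.Crossing} {g g' : D.Gen} (h : g.1 = g'.1)
    (ha : ∀ a, ¬ Touches g.1 x a → label g a = label g' a)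
    (h0 : label g (half x 0) = label g' (half x 0))
    (h2 : label g (half x 2) = label g' (half x 2)) : g = g' := by
  refine gen_ext h fun a => ?_
  by_cases ht : Touches g.1 x a
  · rcases ht with ht | ht
    · rw [label_congr ht, h0]; exact label_congr (by rw [← h, ht])
    · rw [label_congr ht, h2]; exact label_congr (by rw [← h, ht])
  · exact ha a ht

/-- The coefficients of the sum of the Khovanov and the Lee differential at the crossing `x`. -/
def TotalEdge (x : D.Crossing) (g g' : D.Gen) : Prop :=
  g.1 x = false ∧ Flip x g.1 g'.1 ∧ (∀ a, ¬ Touches g.1 x a → label g' a = label g a) ∧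
    (D.circ g.1 (half x 0) = D.circ g.1 (half x 2) →
      label g (half x 0) = (label g' (half x 0) ^^ label g' (half x 2))) ∧
    (D.circ g.1 (half x 0) ≠ D.circ g.1 (half x 2) →
      label g' (half x 0) = (label g (half x 0) == label g (half x 2)))

/-- The requirement that a split really separates the two strands is automatic by `Flip.circ_iff`.
-/
theorem cubeEdge_iff {mrg spl : Bool → Bool → Bool → Prop} {g g' : D.Gen} :
    D.CubeEdge mrg spl g g' ↔ ∃ x, g.1 x = false ∧ Flip x g.1 g'.1 ∧
      (∀ a, ¬ Touches g.1 x a → label g' a = label g a) ∧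
      ((D.circ g.1 (half x 0) ≠ D.circ g.1 (half x 2) ∧
        mrg (label g (half x 0)) (label g (half x 2)) (label g' (half x 0))) ∨
      (D.circ g.1 (half x 0) = D.circ g.1 (half x 2) ∧
        spl (label g (half x 0)) (label g' (half x 0)) (label g' (half x 2)))) := by
  refine exists_congr fun x => ?_
  constructor
  · rintro ⟨h1, h2, h3, h4, h5⟩
    refine ⟨h1, ⟨by rw [h1, h2]; rfl, h3⟩, fun a ha => h4 a ?_, ?_⟩
    · intro k hk
      exact ha (touches_iff.2 ⟨k, hk⟩)
    · rcases h5 with h5 | h5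
      · exact .inl h5
      · exact .inr ⟨h5.1, h5.2.2⟩
  · rintro ⟨h1, h2, h4, h5⟩
    refine ⟨h1, by rw [h2.1, h1]; rfl, h2.2, fun a ha => h4 a ?_, ?_⟩
    · intro h
      obtain ⟨k, hk⟩ := touches_iff.1 h
      exact ha k hk
    · rcases h5 with h5 | h5
      · exact .inl h5
      · exact .inr ⟨h5.1, fun h => h2.circ_iff.1 h h5.1, h5.2⟩

/-- With the Lee terms the tables become uniform: read `+` as `1` and `-` as `X` with `X² = 1`.
Merging multiplies the labels; splitting gives all pairs of labels whose product is `X` times the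
old one. -/
theorem khovanov_or_lee_iff {g g' : D.Gen} :
    (D.KhovanovEdge g g' ∨ D.LeeEdge g g') ↔ ∃ x, TotalEdge x g g' := by
  rw [KhovanovEdge, LeeEdge, cubeEdge_iff, cubeEdge_iff, ← exists_or]
  refine exists_congr fun x => ?_
  rw [TotalEdge]
  by_cases h : D.circ g.1 (half x 0) = D.circ g.1 (half x 2)
  · simp only [h, ne_eq, not_true, false_and, false_or, true_and, forall_true_left, false_imp_iff,
      and_true]
    rw [← and_or_left, ← and_or_left, ← and_or_left]
    refine and_congr_right fun _ => and_congr_right fun _ => and_congr_right fun _ => ?_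
    cases label g (half x 0) <;> cases label g' (half x 0) <;> cases label g' (half x 2) <;> simp
  · simp only [h, ne_eq, not_false_eq_true, false_and, or_false, true_and, forall_true_left,
      false_imp_iff]
    rw [← and_or_left, ← and_or_left, ← and_or_left]
    refine and_congr_right fun _ => and_congr_right fun _ => and_congr_right fun _ => ?_
    cases label g (half x 0) <;> cases label g' (half x 0) <;> cases label g (half x 2) <;> simp

/-! ## Toggling the label of a circle -/

open Classical in
/-- Change the label of the circle through `a`. -/
noncomputable def toggle (a : D.Half) (g : D.Gen) : D.Gen :=
  ⟨g.1, fun c => g.2 c ^^ decide (c = D.circ g.1 a)⟩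

open Classical in
/-- Whether two half-edges lie on the same circle. -/
noncomputable def sameCircle (v : D.State) (a b : D.Half) : Bool := decide (D.circ v a = D.circ v b)

theorem sameCircle_of_eq {v : D.State} {a b : D.Half} (h : D.circ v a = D.circ v b) :
    sameCircle v a b = true := by simp [sameCircle, h]

theorem sameCircle_of_ne {v : D.State} {a b : D.Half} (h : D.circ v a ≠ D.circ v b) :
    sameCircle v a b = false := by simp [sameCircle, h]

theorem label_toggle (a b : D.Half) (g : D.Gen) :
    label (toggle a g) b = (label g b ^^ sameCircle g.1 b a) := rfl

theorem toggle_fst (a : D.Half) (g : D.Gen) : (toggle a g).1 = g.1 := rfl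

theorem toggle_toggle (a : D.Half) (g : D.Gen) : toggle a (toggle a g) = g :=
  gen_ext rfl fun b => by
    rw [label_toggle, label_toggle, toggle_fst]
    cases sameCircle g.1 b a <;> simp

theorem toggle_comm (a b : D.Half) (g : D.Gen) : toggle a (toggle b g) = toggle b (toggle a g) :=
  gen_ext rfl fun c => by
    rw [label_toggle, label_toggle, label_toggle, label_toggle, toggle_fst, toggle_fst]
    cases sameCircle g.1 c a <;> cases sameCircle g.1 c b <;> simp

theorem toggle_congr {a b : D.Half} {g : D.Gen} (h : D.circ g.1 a = D.circ g.1 b) :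
    toggle a g = toggle b g := by
  rw [toggle, toggle, h]

theorem Flip.sameCircle_merge {x : D.Crossing} {v w : D.State} (h : Flip x v w)
    (hv : D.circ v (half x 0) ≠ D.circ v (half x 2)) (a : D.Half) :
    sameCircle w (half x 0) a = (sameCircle v (half x 0) a ^^ sameCircle v (half x 2) a) := by
  by_cases ha : Touches v x a
  · rw [sameCircle_of_eq (h.circ_of_touches hv ha).symm]
    rcases ha with h1 | h1
    · rw [sameCircle_of_eq h1.symm, sameCircle_of_ne]
      · rfl
      · rw [h1]; exact hv.symm
    · rw [sameCircle_of_eq h1.symm, sameCircle_of_ne]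
      · rfl
      · rw [h1]; exact hv
  · have hw := (h.touches_iff a).not.2 ha
    rw [Touches, not_or] at ha hw
    rw [sameCircle_of_ne (Ne.symm ha.1), sameCircle_of_ne (Ne.symm ha.2),
      sameCircle_of_ne (Ne.symm hw.1)]
    rfl

/-- Toggling multiplies by `X` on one circle, and merge and split maps of a Frobenius algebra are
linear over it. If `a` lies on a circle through `x`, this uses that the merged circle is the
disjoint union of the two others. -/
theorem TotalEdge.toggle {x : D.Crossing} {g g' : D.Gen} (h : TotalEdge x g g') (a : D.Half) :
    TotalEdge x (toggle a g) (toggle a g') := by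
  obtain ⟨h1, h2, h3, h4, h5⟩ := h
  refine ⟨h1, h2, fun b hb => ?_, fun hv => ?_, fun hv => ?_⟩
  · have := h2.circ_iff_of_not_touches hb a
    rw [label_toggle, label_toggle, h3 b hb]
    rw [sameCircle, sameCircle, decide_eq_decide.2 this]
  · rw [label_toggle, label_toggle, label_toggle,
      h2.symm.sameCircle_merge (fun h => h2.circ_iff.1 h hv) a, h4 hv]
    simp only [Bool.xor_assoc, Bool.xor_left_comm]
  · rw [label_toggle, label_toggle, label_toggle, h2.sameCircle_merge hv a, h5 hv]
    generalize sameCircle g.1 (half x 0) a = p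
    generalize sameCircle g.1 (half x 2) a = q
    cases label g (half x 0) <;> cases label g (half x 2) <;> cases p <;> cases q <;> rfl

theorem totalEdge_toggle_iff {x : D.Crossing} {g g' : D.Gen} (a : D.Half) :
    TotalEdge x (toggle a g) (toggle a g') ↔ TotalEdge x g g' :=
  ⟨fun h => by simpa only [toggle_toggle] using h.toggle a, fun h => h.toggle a⟩

/-- The generator with all labels `+`. -/
def allPlus (v : D.State) : D.Gen := ⟨v, fun _ => true⟩

/-- Any labelling arises from the constant label `+` by toggling the circles labelled `-` one at a
time. -/
theorem gen_induction {P : D.Gen → Prop} (h0 : ∀ v, P (allPlus v))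
    (h1 : ∀ g a, P g → P (toggle a g)) (g : D.Gen) : P g := by
  classical
  obtain ⟨v, l⟩ := g
  have := Fintype.ofFinite (D.Circle v)
  have key (s : Finset (D.Circle v)) : P ⟨v, fun c => decide (c ∉ s)⟩ := by
    induction s using Finset.induction_on with
    | empty => exact h0 v
    | insert c s hc ih =>
      obtain ⟨a, rfl⟩ := Quot.exists_rep c
      convert h1 _ a ih using 1
      refine gen_ext rfl fun b => ?_
      rw [label_toggle]
      by_cases hb : D.circ v b = D.circ v a
      · rw [sameCircle_of_eq hb]
        simp [label, hb, hc]
      · rw [sameCircle_of_ne hb]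
        simp [label, hb]
  convert key (Finset.univ.filter fun c => l c = false) using 2
  ext c
  cases hc : l c <;> simp [hc]

/-! ## Operators -/

theorem linOfRel_apply (R : D.Gen → D.Gen → Prop) [∀ g g', Decidable (R g g')] (m : D.Chain)
    (g' : D.Gen) : D.linOfRel R m g' = ∑ g, if R g g' then m g else 0 := by
  simp only [linOfRel, Matrix.mulVecLin_apply, Matrix.mulVec, dotProduct, Matrix.of_apply]
  refine Finset.sum_congr rfl fun g _ => ?_
  by_cases h : R g g' <;> simp [h]

open Classical in
theorem linOfRel_single (R : D.Gen → D.Gen → Prop) (g g' : D.Gen) :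
    D.linOfRel R (Pi.single g 1) g' = if R g g' then 1 else 0 := by
  rw [linOfRel_apply, Finset.sum_eq_single g]
  · simp
  · intro h _ hne; simp [hne]
  · simp

open Classical in
theorem end_ext {A B : Module.End F2 D.Chain}
    (h : ∀ g, A (Pi.single g 1) = B (Pi.single g 1)) : A = B := by
  refine (Pi.basisFun F2 D.Gen).ext fun g => ?_
  simpa using h g

/-- The operator that changes the label of the circle through `a`. -/
noncomputable def toggleOp (a : D.Half) : Module.End F2 D.Chain := LinearMap.funLeft F2 F2 (toggle a)

open Classical in
theorem toggleOp_single (a : D.Half) (g : D.Gen) :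
    toggleOp a (Pi.single g 1) = Pi.single (toggle a g) 1 := by
  ext g'
  simp only [toggleOp, LinearMap.funLeft_apply, Pi.single_apply]
  congr 1
  exact propext ⟨fun h => by rw [← h, toggle_toggle], fun h => by rw [h, toggle_toggle]⟩

theorem toggleOp_mul_self (a : D.Half) : toggleOp a * toggleOp a = 1 := by
  classical
  exact end_ext fun g => by
    rw [Module.End.mul_apply, toggleOp_single, toggleOp_single, toggle_toggle]; rfl

theorem toggleOp_comm (a b : D.Half) : Commute (toggleOp a) (toggleOp b) := by
  classical
  exact end_ext fun g => by
    rw [Module.End.mul_apply, Module.End.mul_apply, toggleOp_single, toggleOp_single,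
      toggleOp_single, toggleOp_single, toggle_comm]

theorem linOfRel_commute_toggleOp {R : D.Gen → D.Gen → Prop} {a : D.Half}
    (h : ∀ g g', R (toggle a g) (toggle a g') ↔ R g g') :
    Commute (D.linOfRel R) (toggleOp a) := by
  classical
  refine end_ext fun g => ?_
  ext g'
  rw [Module.End.mul_apply, Module.End.mul_apply, toggleOp_single, linOfRel_single]
  change _ = D.linOfRel R (Pi.single g 1) (toggle a g')
  rw [linOfRel_single]
  congr 1
  rw [← h g, toggle_toggle]

open Classical in
/-- Operators that commute with all toggles are determined by their values at the generators with all
labels `+`. -/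
theorem end_ext_allPlus {A B : Module.End F2 D.Chain} (hA : ∀ a, Commute A (toggleOp a))
    (hB : ∀ a, Commute B (toggleOp a))
    (h : ∀ v, A (Pi.single (allPlus v) 1) = B (Pi.single (allPlus v) 1)) : A = B := by
  refine end_ext fun g => gen_induction (P := fun g => A (Pi.single g 1) = B (Pi.single g 1)) h ?_ g
  intro g a hg
  rw [← toggleOp_single, ← Module.End.mul_apply, ← Module.End.mul_apply, hA, hB,
    Module.End.mul_apply, Module.End.mul_apply, hg]

/-- The total differential at a crossing. -/
noncomputable def totalAt (x : D.Crossing) : Module.End F2 D.Chain := D.linOfRel (TotalEdge x)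

theorem totalAt_commute (x : D.Crossing) (a : D.Half) : Commute (totalAt x) (toggleOp a) :=
  linOfRel_commute_toggleOp fun _ _ => totalEdge_toggle_iff a

open Classical in
theorem totalAt_of_true {x : D.Crossing} {g : D.Gen} (h : g.1 x = true) :
    totalAt x (Pi.single g 1) = 0 := by
  ext g'
  rw [totalAt, linOfRel_single, if_neg]
  · rfl
  · intro h'; rw [h'.1] at h; exact absurd h (by decide)

/-- The factor of a cube edge: `1` for a merge, and the sum of the two toggles for a split. -/
noncomputable def edgeFactor (x : D.Crossing) (v : D.State) : Module.End F2 D.Chain :=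
  open Classical in
  if D.circ v (half x 0) = D.circ v (half x 2) then toggleOp (half x 0) + toggleOp (half x 2) else 1

theorem Flip.eq {x : D.Crossing} {u v w : D.State} (h : Flip x u v) (h' : Flip x u w) : v = w := by
  funext y
  by_cases hy : y = x
  · rw [hy, h.1, h'.1]
  · rw [h.2 y hy, h'.2 y hy]

theorem totalEdge_allPlus_of_merge {x : D.Crossing} {v w : D.State} (h : Flip x v w)
    (hv : v x = false) (h2 : D.circ v (half x 0) ≠ D.circ v (half x 2)) (g : D.Gen) :
    TotalEdge x (allPlus v) g ↔ g = allPlus w := by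
  constructor
  · rintro ⟨-, h3, h4, -, h5⟩
    have hg := h3.eq h
    have hw : D.circ g.1 (half x 0) = D.circ g.1 (half x 2) := by rw [hg]; exact h.circ_iff.2 h2
    refine gen_ext_of_touches (x := x) hg (fun a ha => h4 a fun h' => ha ((h3.touches_iff a).2 h'))
      (h5 h2) ?_
    rw [← label_congr hw]; exact h5 h2
  · rintro rfl
    exact ⟨hv, h, fun _ _ => rfl, fun h' => absurd h' h2, fun _ => rfl⟩

theorem totalEdge_allPlus_of_split {x : D.Crossing} {v w : D.State} (h : Flip x v w)
    (hv : v x = false) (h2 : D.circ v (half x 0) = D.circ v (half x 2)) (g : D.Gen) :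
    TotalEdge x (allPlus v) g ↔
      g = toggle (half x 0) (allPlus w) ∨ g = toggle (half x 2) (allPlus w) := by
  have hw : ¬ D.circ w (half x 0) = D.circ w (half x 2) := fun h' => h.circ_iff.1 h' h2
  have hw' : ¬ D.circ w (half x 2) = D.circ w (half x 0) := fun h' => hw h'.symm
  have hl (a b : D.Half) : label (toggle b (allPlus w)) a = !(sameCircle w a b) := by
    rw [label_toggle]; exact Bool.true_xor _
  have hun {a b : D.Half} (ha : ¬ Touches v x a) (hb : b = half x 0 ∨ b = half x 2) :
      label (toggle b (allPlus w)) a = true := by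
    rw [← h.touches_iff, Touches, not_or] at ha
    rw [hl]
    rcases hb with rfl | rfl
    · rw [sameCircle_of_ne ha.1]; rfl
    · rw [sameCircle_of_ne ha.2]; rfl
  have s02 := sameCircle_of_ne hw
  have s20 := sameCircle_of_ne hw'
  have s00 := sameCircle_of_eq (rfl : D.circ w (half x 0) = _)
  have s22 := sameCircle_of_eq (rfl : D.circ w (half x 2) = _)
  constructor
  · rintro ⟨-, h3, h4, h5, -⟩
    have hg := h3.eq h
    have h4' (a : D.Half) (ha : ¬ Touches g.1 x a) : ¬ Touches v x a := fun h' =>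
      ha ((h3.touches_iff a).2 h')
    have h6 : true = (label g (half x 0) ^^ label g (half x 2)) := h5 h2
    cases h7 : label g (half x 0) <;> cases h8 : label g (half x 2) <;> rw [h7, h8] at h6
    · exact absurd h6 (by decide)
    · left
      refine gen_ext_of_touches (x := x) hg (fun a ha => ?_) ?_ ?_
      · rw [hun (h4' a ha) (.inl rfl)]; exact h4 a (h4' a ha)
      · rw [h7, hl, s00]; rfl
      · rw [h8, hl, s20]; rfl
    · right
      refine gen_ext_of_touches (x := x) hg (fun a ha => ?_) ?_ ?_
      · rw [hun (h4' a ha) (.inr rfl)]; exact h4 a (h4' a ha)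
      · rw [h7, hl, s02]; rfl
      · rw [h8, hl, s22]; rfl
    · exact absurd h6 (by decide)
  · intro hg
    have key (b : D.Half) (hb : b = half x 0 ∨ b = half x 2) :
        TotalEdge x (allPlus v) (toggle b (allPlus w)) := by
      refine ⟨hv, h, fun a ha => hun ha hb, fun _ => ?_, fun h' => absurd h2 h'⟩
      rw [hl, hl]
      rcases hb with rfl | rfl
      · rw [s00, s20]; rfl
      · rw [s02, s22]; rfl
    rcases hg with rfl | rfl
    · exact key _ (.inl rfl)
    · exact key _ (.inr rfl)

open Classical in
-- In the Frobenius algebra `1 · 1 = 1`, while the coproduct of `1` is `X ⊗ 1 + 1 ⊗ X`.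
theorem totalAt_allPlus {x : D.Crossing} {v w : D.State} (h : Flip x v w) (hv : v x = false) :
    totalAt x (Pi.single (allPlus v) 1) = edgeFactor x v (Pi.single (allPlus w) 1) := by
  ext g
  rw [totalAt, linOfRel_single, edgeFactor]
  by_cases h2 : D.circ v (half x 0) = D.circ v (half x 2)
  · have hne : toggle (half x 0) (allPlus w) ≠ toggle (half x 2) (allPlus w) := by
      intro h'
      have h3 := congrArg (fun g => label g (half x 0)) h'
      have hw : ¬ D.circ w (half x 0) = D.circ w (half x 2) := fun h' => h.circ_iff.1 h' h2
      simp only [label_toggle] at h3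
      rw [sameCircle_of_eq rfl, sameCircle_of_ne (show D.circ (allPlus w).1 _ ≠ _ from hw)] at h3
      exact absurd h3 (by rw [show label (allPlus w) (half x 0) = true from rfl]; decide)
    rw [if_pos h2, LinearMap.add_apply, toggleOp_single, toggleOp_single, Pi.add_apply,
      Pi.single_apply, Pi.single_apply]
    simp only [totalEdge_allPlus_of_split h hv h2]
    by_cases h3 : g = toggle (half x 0) (allPlus w)
    · simp [h3, hne]
    · simp [h3]
  · rw [if_neg h2, Module.End.one_apply, Pi.single_apply]
    simp only [totalEdge_allPlus_of_merge h hv h2]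

end AnnularDiagram

/-! # The total differential squares to zero -/

/-- The cross terms occur twice, so in characteristic two commuting faces need no signs. -/
theorem sum_mul_sum_eq_zero {R ι : Type*} [Ring R] (h2 : ∀ r : R, r + r = 0) (s : Finset ι)
    (f : ι → R) (hf : ∀ i, f i * f i = 0) (hc : ∀ i j, f i * f j = f j * f i) :
    (∑ i ∈ s, f i) * ∑ i ∈ s, f i = 0 := by
  classical
  induction s using Finset.induction_on with
  | empty => simp
  | insert i s hi ih =>
    have h : (∑ j ∈ s, f j) * f i = f i * ∑ j ∈ s, f j := by
      rw [Finset.sum_mul, Finset.mul_sum]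
      exact Finset.sum_congr rfl fun j _ => hc j i
    rw [Finset.sum_insert hi, add_mul, mul_add, mul_add, hf, ih, h, zero_add, add_zero, h2]

namespace AnnularDiagram

variable {D : AnnularDiagram}

theorem end_add_self (A : Module.End F2 D.Chain) : A + A = 0 := add_self_F2 A

theorem edgeFactor_split {x : D.Crossing} {v : D.State}
    (h : D.circ v (half x 0) = D.circ v (half x 2)) :
    edgeFactor x v = toggleOp (half x 0) + toggleOp (half x 2) := if_pos h

theorem edgeFactor_merge {x : D.Crossing} {v : D.State}
    (h : D.circ v (half x 0) ≠ D.circ v (half x 2)) : edgeFactor x v = 1 := if_neg h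

theorem commute_edgeFactor {A : Module.End F2 D.Chain} (hA : ∀ a, Commute A (toggleOp a))
    (x : D.Crossing) (v : D.State) : Commute A (edgeFactor x v) := by
  rw [edgeFactor]
  split_ifs
  · exact (hA _).add_right (hA _)
  · exact Commute.one_right A

open Classical in
theorem toggle_add_toggle_of_eq {x : D.Crossing} {w : D.State}
    (h : D.circ w (half x 0) = D.circ w (half x 2)) :
    (toggleOp (half x 0) + toggleOp (half x 2)) (Pi.single (allPlus w) (1 : F2)) = 0 := by
  rw [LinearMap.add_apply, toggleOp_single, toggleOp_single,
    toggle_congr (show D.circ (allPlus w).1 _ = _ from h), add_self_F2]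

open Classical in
theorem toggle_add_toggle_congr {x y : D.Crossing} {w : D.State}
    (h : D.circ w (half x 0) = D.circ w (half y 0) ∧ D.circ w (half x 2) = D.circ w (half y 2) ∨
      D.circ w (half x 0) = D.circ w (half y 2) ∧ D.circ w (half x 2) = D.circ w (half y 0)) :
    (toggleOp (half x 0) + toggleOp (half x 2)) (Pi.single (allPlus w) (1 : F2)) =
      (toggleOp (half y 0) + toggleOp (half y 2)) (Pi.single (allPlus w) (1 : F2)) := by
  simp only [LinearMap.add_apply, toggleOp_single]
  rcases h with ⟨h1, h2⟩ | ⟨h1, h2⟩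
  · rw [toggle_congr (show D.circ (allPlus w).1 _ = _ from h1),
      toggle_congr (show D.circ (allPlus w).1 _ = _ from h2)]
  · rw [toggle_congr (show D.circ (allPlus w).1 _ = _ from h1),
      toggle_congr (show D.circ (allPlus w).1 _ = _ from h2), add_comm]

/-- If two crossings both merge the same two circles, then either of them splits the result of the
other one, and the circles after both changes are the same. -/
theorem circ_of_merge_split {x y : D.Crossing} {v u w : D.State} (hx : Flip x v u)
    (hy : Flip y u w) (hAx : D.circ v (half x 0) ≠ D.circ v (half x 2))
    (hAy : D.circ v (half y 0) ≠ D.circ v (half y 2))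
    (hBy : D.circ u (half y 0) = D.circ u (half y 2))
    (hw : D.circ w (half x 0) ≠ D.circ w (half x 2)) :
    D.circ w (half x 0) = D.circ w (half y 0) ∧ D.circ w (half x 2) = D.circ w (half y 2) ∨
      D.circ w (half x 0) = D.circ w (half y 2) ∧ D.circ w (half x 2) = D.circ w (half y 0) := by
  have ht : Touches v x (half y 0) := by
    by_contra ht
    exact hAy ((hx.circ_iff_of_not_touches ht _).1 hBy)
  have h1 : D.circ u (half y 0) = D.circ u (half x 0) := hx.circ_of_touches hAx ht
  have h2 : D.circ u (half x 2) = D.circ u (half x 0) := (hx.circ_iff.2 hAx).symm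
  have h3 : Touches w y (half x 0) := (hy.touches_iff _).2 (.inl h1.symm)
  have h4 : Touches w y (half x 2) := (hy.touches_iff _).2 (.inl (h2.trans h1.symm))
  rcases h3 with h3 | h3 <;> rcases h4 with h4 | h4
  · exact absurd (h3.trans h4.symm) hw
  · exact .inl ⟨h3, h4⟩
  · exact .inr ⟨h3, h4⟩
  · exact absurd (h3.trans h4.symm) hw

open Classical in
-- Merges coarsen the partition into circles and splits refine it. Together with the merge-or-split
-- alternative on the four edges, this leaves a few types of faces, which are sorted by the types of
-- the two edges into `w`.
theorem edgeFactor_face {x y : D.Crossing} {v u t w : D.State} (hvu : Flip x v u)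
    (hvt : Flip y v t) (huw : Flip y u w) (htw : Flip x t w) :
    edgeFactor x v (edgeFactor y u (Pi.single (allPlus w) 1)) =
      edgeFactor y v (edgeFactor x t (Pi.single (allPlus w) 1)) := by
  have a1 (h : ¬ D.circ v (half y 0) = D.circ v (half y 2))
    (h' : D.circ v (half x 0) = D.circ v (half x 2)) :
      D.circ t (half x 0) = D.circ t (half x 2) := hvt.circ_eq_of_merge h h'
  have a2 (h : ¬ D.circ v (half x 0) = D.circ v (half x 2))
    (h' : D.circ v (half y 0) = D.circ v (half y 2)) :
      D.circ u (half y 0) = D.circ u (half y 2) := hvu.circ_eq_of_merge h h'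
  have b1 (h : D.circ v (half y 0) = D.circ v (half y 2))
    (h' : D.circ t (half x 0) = D.circ t (half x 2)) :
      D.circ v (half x 0) = D.circ v (half x 2) :=
    hvt.symm.circ_eq_of_merge (fun h'' => hvt.circ_iff.1 h'' h) h'
  have b2 (h : D.circ v (half x 0) = D.circ v (half x 2))
    (h' : D.circ u (half y 0) = D.circ u (half y 2)) :
      D.circ v (half y 0) = D.circ v (half y 2) :=
    hvu.symm.circ_eq_of_merge (fun h'' => hvu.circ_iff.1 h'' h) h'
  have c1 (h : ¬ D.circ u (half y 0) = D.circ u (half y 2))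
    (h' : D.circ u (half x 0) = D.circ u (half x 2)) :
      D.circ w (half x 0) = D.circ w (half x 2) := huw.circ_eq_of_merge h h'
  have c2 (h : ¬ D.circ t (half x 0) = D.circ t (half x 2))
    (h' : D.circ t (half y 0) = D.circ t (half y 2)) :
      D.circ w (half y 0) = D.circ w (half y 2) := htw.circ_eq_of_merge h h'
  have d1 (h : D.circ u (half y 0) = D.circ u (half y 2))
    (h' : D.circ w (half x 0) = D.circ w (half x 2)) :
      D.circ u (half x 0) = D.circ u (half x 2) :=
    huw.symm.circ_eq_of_merge (fun h'' => huw.circ_iff.1 h'' h) h'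
  have d2 (h : D.circ t (half x 0) = D.circ t (half x 2))
    (h' : D.circ w (half y 0) = D.circ w (half y 2)) :
      D.circ t (half y 0) = D.circ t (half y 2) :=
    htw.symm.circ_eq_of_merge (fun h'' => htw.circ_iff.1 h'' h) h'
  have e1 := hvu.circ_iff
  have e2 := hvt.circ_iff
  have e3 := huw.circ_iff
  have e4 := htw.circ_iff
  by_cases hBx : D.circ t (half x 0) = D.circ t (half x 2) <;>
  by_cases hBy : D.circ u (half y 0) = D.circ u (half y 2)
  · by_cases hAx : D.circ v (half x 0) = D.circ v (half x 2)
    · rw [edgeFactor_split hAx, edgeFactor_split hBx, edgeFactor_split hBy,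
        edgeFactor_split (b2 hAx hBy), ← Module.End.mul_apply, ← Module.End.mul_apply]
      have hc : Commute (toggleOp (half x 0) + toggleOp (half x 2))
          (toggleOp (half y 0) + toggleOp (half y 2)) :=
        ((toggleOp_comm _ _).add_left (toggleOp_comm _ _)).add_right
          ((toggleOp_comm _ _).add_left (toggleOp_comm _ _))
      rw [hc.eq]
    · have hAy := fun h => hAx (b1 h hBx)
      rw [edgeFactor_merge hAx, edgeFactor_split hBx, edgeFactor_split hBy, edgeFactor_merge hAy,
        Module.End.one_apply, Module.End.one_apply]
      exact (toggle_add_toggle_congr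
        (circ_of_merge_split hvu huw hAx hAy hBy fun h => e4.1 h hBx)).symm
  · have hAy := fun h => e2.1 (d2 hBx (e3.2 hBy)) h
    have hAx : D.circ v (half x 0) = D.circ v (half x 2) := by
      by_contra h
      exact e4.1 (c1 hBy (e1.2 h)) hBx
    rw [edgeFactor_split hAx, edgeFactor_split hBx, edgeFactor_merge hBy, edgeFactor_merge hAy]
    rfl
  · have hAx := fun h => e1.1 (d1 hBy (e4.2 hBx)) h
    have hAy : D.circ v (half y 0) = D.circ v (half y 2) := by
      by_contra h
      exact e3.1 (c2 hBx (e2.2 h)) hBy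
    rw [edgeFactor_split hAy, edgeFactor_split hBy, edgeFactor_merge hBx, edgeFactor_merge hAx]
    rfl
  · by_cases hAx : D.circ v (half x 0) = D.circ v (half x 2)
    · have hAy : D.circ v (half y 0) = D.circ v (half y 2) := by
        by_contra h
        exact hBx (a1 h hAx)
      rw [edgeFactor_split hAx, edgeFactor_split hAy, edgeFactor_merge hBx, edgeFactor_merge hBy,
        Module.End.one_apply, toggle_add_toggle_of_eq (e4.2 hBx),
        toggle_add_toggle_of_eq (e3.2 hBy)]
    · have hAy := fun h => hBy (a2 hAx h)
      rw [edgeFactor_merge hAx, edgeFactor_merge hAy, edgeFactor_merge hBx, edgeFactor_merge hBy]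

theorem Flip.update {x : D.Crossing} (v : D.State) [DecidableEq D.Crossing] :
    Flip x v (Function.update v x (!v x)) :=
  ⟨by simp, fun y hy => by simp [hy]⟩

open Classical in
theorem totalAt_mul_allPlus {x y : D.Crossing} {v : D.State} (hxy : x ≠ y) (hx : v x = true) :
    totalAt x (totalAt y (Pi.single (allPlus v) 1)) = 0 := by
  cases hy : v y
  · have hf := Flip.update (x := y) v
    rw [totalAt_allPlus hf hy, ← Module.End.mul_apply,
      (commute_edgeFactor (totalAt_commute x) y v).eq, Module.End.mul_apply, totalAt_of_true, map_zero]
    change Function.update v y _ x = true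
    rw [hf.2 x hxy, hx]
  · rw [totalAt_of_true (x := y) hy, map_zero]

theorem totalAt_mul_self (x : D.Crossing) : totalAt x * totalAt x = 0 := by
  classical
  refine end_ext_allPlus (fun a => (totalAt_commute x a).mul_left (totalAt_commute x a))
    (fun a => Commute.zero_left _) fun v => ?_
  rw [Module.End.mul_apply, LinearMap.zero_apply]
  cases hx : v x
  · have hf := Flip.update (x := x) v
    rw [totalAt_allPlus hf hx, ← Module.End.mul_apply,
      (commute_edgeFactor (totalAt_commute x) x v).eq, Module.End.mul_apply, totalAt_of_true, map_zero]
    change Function.update v x _ x = true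
    rw [hf.1, hx]; rfl
  · rw [totalAt_of_true (x := x) hx, map_zero]

theorem totalAt_comm (x y : D.Crossing) : totalAt x * totalAt y = totalAt y * totalAt x := by
  classical
  by_cases hxy : x = y
  · rw [hxy]
  refine end_ext_allPlus (fun a => (totalAt_commute x a).mul_left (totalAt_commute y a))
    (fun a => (totalAt_commute y a).mul_left (totalAt_commute x a)) fun v => ?_
  rw [Module.End.mul_apply, Module.End.mul_apply]
  cases hx : v x
  · cases hy : v y
    · have hvu := Flip.update (x := x) v
      have hvt := Flip.update (x := y) v
      set u := Function.update v x (!v x)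
      set t := Function.update v y (!v y)
      have huw := Flip.update (x := y) u
      have htw : Flip x t (Function.update u y (!u y)) := by
        have h1 : Function.update u y (!u y) = Function.update t x (!t x) := by
          rw [hvu.2 y (Ne.symm hxy), hvt.2 x hxy]
          exact Function.update_comm hxy _ _ _
        rw [h1]
        exact Flip.update t
      have huy : u y = false := by rw [hvu.2 y (Ne.symm hxy), hy]
      have htx : t x = false := by rw [hvt.2 x hxy, hx]
      rw [totalAt_allPlus hvu hx, totalAt_allPlus hvt hy, ← Module.End.mul_apply,
        ← Module.End.mul_apply, (commute_edgeFactor (totalAt_commute x) y v).eq,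
        (commute_edgeFactor (totalAt_commute y) x v).eq, Module.End.mul_apply, Module.End.mul_apply,
        totalAt_allPlus htw htx, totalAt_allPlus huw huy, edgeFactor_face hvu hvt huw htw]
    · rw [totalAt_mul_allPlus (Ne.symm hxy) hy, totalAt_of_true (x := y) hy, map_zero]
  · rw [totalAt_mul_allPlus hxy hx, totalAt_of_true (x := x) hx, map_zero]

variable (D) in
/-- The sum of the Khovanov and the Lee differential. -/
noncomputable def total : Module.End F2 D.Chain := D.linOfRel fun g g' => ∃ x, TotalEdge x g g'

theorem TotalEdge.unique {x y : D.Crossing} {g g' : D.Gen} (h : TotalEdge x g g')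
    (h' : TotalEdge y g g') : x = y := by
  by_contra hxy
  have h1 := h.2.1.1
  rw [h'.2.1.2 x hxy] at h1
  exact absurd h1 (by cases g.1 x <;> decide)

theorem total_eq_sum [Fintype D.Crossing] : D.total = ∑ x, totalAt x := by
  classical
  refine end_ext fun g => ?_
  ext g'
  rw [total, linOfRel_single, LinearMap.sum_apply, Finset.sum_apply]
  simp only [totalAt, linOfRel_single]
  by_cases h : ∃ x, TotalEdge x g g'
  · rw [if_pos h]
    obtain ⟨x, hx⟩ := h
    rw [Finset.sum_eq_single x]
    · rw [if_pos hx]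
    · intro y _ hy
      rw [if_neg fun h' => hy (h'.unique hx)]
    · simp
  · rw [if_neg h, Finset.sum_eq_zero]
    intro x _
    rw [if_neg fun h' => h ⟨x, h'⟩]

theorem total_mul_total : D.total * D.total = 0 := by
  have := Fintype.ofFinite D.Crossing
  rw [total_eq_sum]
  exact sum_mul_sum_eq_zero end_add_self _ _ totalAt_mul_self totalAt_comm

theorem total_commute (a : D.Half) : Commute D.total (toggleOp a) :=
  linOfRel_commute_toggleOp fun _ _ => exists_congr fun _ => totalEdge_toggle_iff a

end AnnularDiagram

/-! # Gradings of the generators -/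

namespace AnnularDiagram

variable {D : AnnularDiagram}

noncomputable instance : Fintype D.Half := Fintype.ofFinite _

/-- The circles of a resolution form a finite set. -/
@[reducible] noncomputable def fintypeCircle (v : D.State) : Fintype (D.Circle v) := Fintype.ofFinite _

attribute [local instance] fintypeCircle

/-- The number, modulo two, of intersections of a circle with the arc. -/
noncomputable def parity {v : D.State} (c : D.Circle v) : F2 :=
  ∑ᶠ a ∈ {a | D.circ v a = c}, D.cut a

theorem nontrivial_iff {v : D.State} (c : D.Circle v) : D.Nontrivial c ↔ parity c = 1 := Iff.rfl

open Classical in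
theorem parity_eq_sum {v : D.State} (c : D.Circle v) :
    parity c = ∑ a, if D.circ v a = c then D.cut a else 0 := by
  rw [parity, finsum_mem_def, finsum_eq_sum_of_fintype]
  exact Finset.sum_congr rfl fun a _ => Set.indicator_apply _ _ _

theorem Flip.parity_of_not_touches {x : D.Crossing} {v w : D.State} (h : Flip x v w) {a : D.Half}
    (ha : ¬ Touches v x a) : parity (D.circ w a) = parity (D.circ v a) := by
  classical
  rw [parity_eq_sum, parity_eq_sum]
  refine Finset.sum_congr rfl fun b _ => ?_
  have h1 := h.circ_iff_of_not_touches ha b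
  rw [eq_comm, eq_comm (a := D.circ v a)] at h1
  simp only [h1]

theorem Flip.parity_merge {x : D.Crossing} {v w : D.State} (h : Flip x v w)
    (hv : D.circ v (half x 0) ≠ D.circ v (half x 2)) :
    parity (D.circ w (half x 0)) = parity (D.circ v (half x 0)) + parity (D.circ v (half x 2)) := by
  classical
  rw [parity_eq_sum, parity_eq_sum, parity_eq_sum, ← Finset.sum_add_distrib]
  refine Finset.sum_congr rfl fun a _ => ?_
  have hw : D.circ w (half x 0) = D.circ w (half x 2) := h.circ_iff.2 hv
  have h1 : D.circ w a = D.circ w (half x 0) ↔ Touches v x a := by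
    rw [← h.touches_iff, Touches, ← hw, or_self]
  simp only [h1, Touches]
  by_cases h0 : D.circ v a = D.circ v (half x 0)
  · have h2 : D.circ v a ≠ D.circ v (half x 2) := by rw [h0]; exact hv
    simp [h0, hv]
  · simp [h0]

/-- A sum over the circles of a generator. -/
noncomputable def circSum (φ : F2 → Bool → ℤ) (g : D.Gen) : ℤ :=
  ∑ c : D.Circle g.1, φ (parity c) (g.2 c)

/-- Circles away from `x` correspond bijectively with equal parities and labels, so only the three
circles at `x` matter. Splits are treated by reading the edge backwards. -/
theorem circSum_merge (φ : F2 → Bool → ℤ) {x : D.Crossing} {g g' : D.Gen} (h : Flip x g.1 g'.1)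
    (hv : D.circ g.1 (half x 0) ≠ D.circ g.1 (half x 2))
    (hl : ∀ a, ¬ Touches g.1 x a → label g' a = label g a) :
    circSum φ g + φ (parity (D.circ g.1 (half x 0)) + parity (D.circ g.1 (half x 2)))
        (label g' (half x 0)) =
      circSum φ g' + φ (parity (D.circ g.1 (half x 0))) (label g (half x 0)) +
        φ (parity (D.circ g.1 (half x 2))) (label g (half x 2)) := by
  classical
  let m : D.Circle g.1 → D.Circle g'.1 := Quot.lift (D.circ g'.1) (by
    intro a b hab; exact h.circ_eq_of_merge hv (Quot.sound hab))
  have h1 : circSum φ g = φ (parity (D.circ g.1 (half x 0))) (label g (half x 0)) +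
      (φ (parity (D.circ g.1 (half x 2))) (label g (half x 2)) +
      ∑ c ∈ (Finset.univ.erase (D.circ g.1 (half x 0))).erase (D.circ g.1 (half x 2)),
        φ (parity c) (g.2 c)) := by
    rw [circSum, ← Finset.add_sum_erase _ _ (Finset.mem_univ (D.circ g.1 (half x 0))),
      ← Finset.add_sum_erase _ _ (Finset.mem_erase.2 ⟨hv.symm, Finset.mem_univ _⟩)]
    rfl
  have h2 : circSum φ g' = φ (parity (D.circ g'.1 (half x 0))) (label g' (half x 0)) +
      ∑ c ∈ Finset.univ.erase (D.circ g'.1 (half x 0)), φ (parity c) (g'.2 c) := by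
    rw [circSum, ← Finset.add_sum_erase _ _ (Finset.mem_univ (D.circ g'.1 (half x 0)))]
    rfl
  have h3 : ∑ c ∈ (Finset.univ.erase (D.circ g.1 (half x 0))).erase (D.circ g.1 (half x 2)),
        φ (parity c) (g.2 c) =
      ∑ c ∈ Finset.univ.erase (D.circ g'.1 (half x 0)), φ (parity c) (g'.2 c) := by
    have key (a : D.Half) : D.circ g.1 a ∈
        (Finset.univ.erase (D.circ g.1 (half x 0))).erase (D.circ g.1 (half x 2)) ↔
        ¬ Touches g.1 x a := by
      simp only [Finset.mem_erase, Finset.mem_univ, and_true, Touches, not_or]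
      tauto
    have key' (a : D.Half) : D.circ g'.1 a ∈ Finset.univ.erase (D.circ g'.1 (half x 0)) ↔
        ¬ Touches g.1 x a := by
      rw [← h.touches_iff]
      have hw : D.circ g'.1 (half x 0) = D.circ g'.1 (half x 2) := h.circ_iff.2 hv
      simp only [Finset.mem_erase, Finset.mem_univ, and_true, Touches, ← hw, or_self, ne_eq]
    refine Finset.sum_bij (fun c _ => m c) ?_ ?_ ?_ ?_
    · rintro ⟨a⟩ ha
      exact (key' a).2 ((key a).1 ha)
    · rintro ⟨a⟩ ha ⟨b⟩ hb hab
      exact (h.circ_iff_of_not_touches ((key a).1 ha) b).1 hab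
    · rintro ⟨a⟩ ha
      exact ⟨D.circ g.1 a, (key a).2 ((key' a).1 ha), rfl⟩
    · rintro ⟨a⟩ ha
      have ha' := (key a).1 ha
      change φ (parity (D.circ g.1 a)) (label g a) = φ (parity (D.circ g'.1 a)) (label g' a)
      rw [h.parity_of_not_touches ha', hl a ha']
  rw [h1, h2, h3, h.parity_merge hv]
  ring

theorem circSum_toggle (φ : F2 → Bool → ℤ) (a : D.Half) (g : D.Gen) :
    circSum φ (toggle a g) + φ (parity (D.circ g.1 a)) (label g a) =
      circSum φ g + φ (parity (D.circ g.1 a)) (!label g a) := by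
  classical
  have h1 (g' : D.Gen) (hg : g'.1 = g.1) : circSum φ g' = φ (parity (D.circ g'.1 a)) (label g' a) +
      ∑ c ∈ Finset.univ.erase (D.circ g'.1 a), φ (parity c) (g'.2 c) := by
    rw [circSum, ← Finset.add_sum_erase _ _ (Finset.mem_univ (D.circ g'.1 a))]
    rfl
  rw [h1 g rfl, h1 (toggle a g) rfl, label_toggle, sameCircle_of_eq rfl, Bool.xor_true]
  have h2 : ∑ c ∈ Finset.univ.erase (D.circ (toggle a g).1 a), φ (parity c) ((toggle a g).2 c) =
      ∑ c ∈ Finset.univ.erase (D.circ g.1 a), φ (parity c) (g.2 c) := by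
    refine Finset.sum_congr rfl ?_
    intro c hc
    have hc' : ¬ c = D.circ g.1 a := (Finset.mem_erase.1 hc).1
    refine congrArg (φ (parity c)) ?_
    change (g.2 c ^^ decide (c = D.circ g.1 a)) = g.2 c
    rw [decide_eq_false hc', Bool.xor_false]
  rw [h2]
  change φ (parity (D.circ g.1 a)) (!label g a) + _ + _ = _
  ring

/-- The contribution of a circle to the winding number grading. -/
def windTerm (p : F2) (s : Bool) : ℤ := if p = 1 then (if s then 1 else -1) else 0

/-- The contribution of a circle to the weight. -/
def weightTerm (p : F2) (s : Bool) : ℤ := (if s then 5 else -5) - windTerm p s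

theorem windDeg_eq (g : D.Gen) : D.windDeg g = circSum windTerm g := by
  classical
  rw [windDeg, finsum_eq_sum_of_fintype, circSum]
  refine Finset.sum_congr rfl fun c _ => ?_
  simp only [windTerm, nontrivial_iff]

/-- The number of crossings with the `1`-resolution. -/
noncomputable def ones (v : D.State) : ℕ := Nat.card {x : D.Crossing // v x = true}

theorem Flip.ones {x : D.Crossing} {v w : D.State} (h : Flip x v w) (hv : v x = false) :
    ones w = ones v + 1 := by
  classical
  have := Fintype.ofFinite D.Crossing
  rw [AnnularDiagram.ones, AnnularDiagram.ones, Nat.card_eq_fintype_card, Nat.card_eq_fintype_card,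
    Fintype.card_subtype, Fintype.card_subtype]
  have : Finset.univ.filter (fun y => w y = true) =
      insert x (Finset.univ.filter fun y => v y = true) := by
    ext y
    simp only [Finset.mem_filter, Finset.mem_univ, true_and, Finset.mem_insert]
    by_cases hy : y = x
    · simp [hy, h.1, hv]
    · simp [hy, h.2 y hy]
  rw [this, Finset.card_insert_of_notMem (by simp [hv])]

theorem homDeg_eq (g : D.Gen) : D.homDeg g = ones g.1 - D.negCrossings := rfl

/-- A combination of the winding number grading and the quantum grading. -/
noncomputable def weight (g : D.Gen) : ℤ := circSum weightTerm g + 5 * ones g.1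

theorem f2_cases (p : F2) : p = 0 ∨ p = 1 := by
  revert p; decide

/-- The weight is `5 q - k`, where `q` counts circles with the sign of their labels plus the
1-resolutions. A Khovanov edge preserves `q` and changes `k` by 0 or -2. -/
theorem khovanovEdge_weight {g g' : D.Gen} (h : D.KhovanovEdge g g') :
    (D.windDeg g' = D.windDeg g ∧ weight g' = weight g) ∨
      (D.windDeg g' = D.windDeg g - 2 ∧ weight g' = weight g + 2) := by
  rw [KhovanovEdge, cubeEdge_iff] at h
  obtain ⟨x, hx, hf, hl, h⟩ := h
  rw [windDeg_eq, windDeg_eq, weight, weight, hf.ones hx]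
  rcases h with ⟨hv, h⟩ | ⟨hv, h⟩
  · have h1 := circSum_merge windTerm hf hv hl
    have h2 := circSum_merge weightTerm hf hv hl
    generalize circSum windTerm g = A, circSum windTerm g' = A', circSum weightTerm g = B,
      circSum weightTerm g' = B' at *
    generalize parity (D.circ g.1 (half x 0)) = p, parity (D.circ g.1 (half x 2)) = q at *
    simp only [Set.mem_insert_iff, Set.mem_singleton_iff, Prod.mk.injEq] at h
    push_cast
    rcases h with ⟨e1, e2, e3⟩ | ⟨e1, e2, e3⟩ | ⟨e1, e2, e3⟩ <;> rw [e1, e2, e3] at h1 h2 <;>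
    rcases f2_cases p with rfl | rfl <;> rcases f2_cases q with rfl | rfl <;>
    simp [windTerm, weightTerm, CharTwo.add_self_eq_zero] at h1 h2 <;> omega
  · have hw : D.circ g'.1 (half x 0) ≠ D.circ g'.1 (half x 2) := fun h' => hf.circ_iff.1 h' hv
    have hl' : ∀ a, ¬ Touches g'.1 x a → label g a = label g' a := fun a ha =>
      (hl a fun h' => ha ((hf.touches_iff a).2 h')).symm
    have h1 := circSum_merge windTerm hf.symm hw hl'
    have h2 := circSum_merge weightTerm hf.symm hw hl'
    generalize circSum windTerm g = A, circSum windTerm g' = A', circSum weightTerm g = B,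
      circSum weightTerm g' = B' at *
    generalize parity (D.circ g'.1 (half x 0)) = p, parity (D.circ g'.1 (half x 2)) = q at *
    simp only [Set.mem_insert_iff, Set.mem_singleton_iff, Prod.mk.injEq] at h
    push_cast
    rcases h with ⟨e1, e2, e3⟩ | ⟨e1, e2, e3⟩ | ⟨e1, e2, e3⟩ <;> rw [e1, e2, e3] at h1 h2 <;>
    rcases f2_cases p with rfl | rfl <;> rcases f2_cases q with rfl | rfl <;>
    simp [windTerm, weightTerm, CharTwo.add_self_eq_zero] at h1 h2 <;> omega

/-- A Lee edge raises `q` by 4, which contributes 20, and raises `k` by 0 or 2. -/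
theorem leeEdge_weight {g g' : D.Gen} (h : D.LeeEdge g g') :
    (D.windDeg g' = D.windDeg g ∧ weight g' = weight g + 20) ∨
      (D.windDeg g' = D.windDeg g + 2 ∧ weight g' = weight g + 18) := by
  rw [LeeEdge, cubeEdge_iff] at h
  obtain ⟨x, hx, hf, hl, h⟩ := h
  rw [windDeg_eq, windDeg_eq, weight, weight, hf.ones hx]
  rcases h with ⟨hv, h⟩ | ⟨hv, h⟩
  · have h1 := circSum_merge windTerm hf hv hl
    have h2 := circSum_merge weightTerm hf hv hl
    generalize circSum windTerm g = A, circSum windTerm g' = A', circSum weightTerm g = B,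
      circSum weightTerm g' = B' at *
    generalize parity (D.circ g.1 (half x 0)) = p, parity (D.circ g.1 (half x 2)) = q at *
    simp only [Set.mem_singleton_iff, Prod.mk.injEq] at h
    push_cast
    obtain ⟨e1, e2, e3⟩ := h
    rw [e1, e2, e3] at h1 h2
    rcases f2_cases p with rfl | rfl <;> rcases f2_cases q with rfl | rfl <;>
    simp [windTerm, weightTerm, CharTwo.add_self_eq_zero] at h1 h2 <;> omega
  · have hw : D.circ g'.1 (half x 0) ≠ D.circ g'.1 (half x 2) := fun h' => hf.circ_iff.1 h' hv
    have hl' : ∀ a, ¬ Touches g'.1 x a → label g a = label g' a := fun a ha =>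
      (hl a fun h' => ha ((hf.touches_iff a).2 h')).symm
    have h1 := circSum_merge windTerm hf.symm hw hl'
    have h2 := circSum_merge weightTerm hf.symm hw hl'
    generalize circSum windTerm g = A, circSum windTerm g' = A', circSum weightTerm g = B,
      circSum weightTerm g' = B' at *
    generalize parity (D.circ g'.1 (half x 0)) = p, parity (D.circ g'.1 (half x 2)) = q at *
    simp only [Set.mem_singleton_iff, Prod.mk.injEq] at h
    push_cast
    obtain ⟨e1, e2, e3⟩ := h
    rw [e1, e2, e3] at h1 h2
    rcases f2_cases p with rfl | rfl <;> rcases f2_cases q with rfl | rfl <;>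
    simp [windTerm, weightTerm, CharTwo.add_self_eq_zero] at h1 h2 <;> omega

theorem weight_toggle {a : D.Half} {g : D.Gen} (h : D.Nontrivial (D.circ g.1 a)) :
    weight (toggle a g) = weight g + if label g a then -8 else 8 := by
  have h1 := circSum_toggle weightTerm a g
  rw [(nontrivial_iff _).1 h] at h1
  change circSum weightTerm (toggle a g) + 5 * ones g.1 = circSum weightTerm g + 5 * ones g.1 + _
  cases hl : label g a <;> rw [hl] at h1 <;> simp [windTerm, weightTerm] at h1 ⊢ <;> omega

end AnnularDiagram

/-! # Homogeneous operators -/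

/-- A linear map between spaces with graded bases that raises the degree by `d`. -/
def HomogMap {ι κ : Type*} (w : ι → ℤ) (w' : κ → ℤ) (d : ℤ) (A : (ι → F2) →ₗ[F2] (κ → F2)) : Prop :=
  ∀ e, ∀ m ∈ basisGrading w e, A m ∈ basisGrading w' (d + e)

namespace HomogMap

variable {ι κ μ : Type*} {w : ι → ℤ} {w' : κ → ℤ} {w'' : μ → ℤ} {d e : ℤ}

theorem add {A B : (ι → F2) →ₗ[F2] (κ → F2)} (hA : HomogMap w w' d A) (hB : HomogMap w w' d B) :
    HomogMap w w' d (A + B) :=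
  fun e m hm => Submodule.add_mem _ (hA e m hm) (hB e m hm)

theorem comp {B : (κ → F2) →ₗ[F2] (μ → F2)} {A : (ι → F2) →ₗ[F2] (κ → F2)}
    (hB : HomogMap w' w'' d B) (hA : HomogMap w w' e A) : HomogMap w w'' (d + e) (B ∘ₗ A) :=
  fun n m hm => by rw [add_assoc]; exact hB _ _ (hA n m hm)

theorem mul {A B : Module.End F2 (ι → F2)} (hA : HomogMap w w d A) (hB : HomogMap w w e B) :
    HomogMap w w (d + e) (A * B) := hA.comp hB

theorem smul_one (c : F2) : HomogMap w w 0 (c • (1 : Module.End F2 (ι → F2))) := fun e m hm => by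
  rw [zero_add]; exact Submodule.smul_mem _ c hm

end HomogMap

namespace AnnularDiagram

variable {D : AnnularDiagram}

theorem homogMap_linOfRel {w : D.Gen → ℤ} {d : ℤ} {R : D.Gen → D.Gen → Prop}
    (h : ∀ g g', R g g' → w g' = w g + d) : HomogMap w w d (D.linOfRel R) := by
  classical
  intro e m hm g' hg'
  rw [linOfRel_apply] at hg'
  obtain ⟨g, -, hg⟩ := Finset.exists_ne_zero_of_sum_ne_zero hg'
  by_cases hR : R g g'
  · rw [if_pos hR] at hg
    rw [h g g' hR, hm g hg, add_comm]
  · rw [if_neg hR] at hg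
    exact absurd rfl hg

open Classical in
/-- The homogeneous component of degree `d` of an operator. -/
noncomputable def component (w : D.Gen → ℤ) (d : ℤ) (A : Module.End F2 D.Chain) :
    Module.End F2 D.Chain :=
  D.linOfRel fun g g' => A (Pi.single g 1) g' = 1 ∧ w g' = w g + d

open Classical in
theorem component_single (w : D.Gen → ℤ) (d : ℤ) (A : Module.End F2 D.Chain) (g g' : D.Gen) :
    component w d A (Pi.single g 1) g' = if w g' = w g + d then A (Pi.single g 1) g' else 0 := by
  rw [component, linOfRel_single]
  by_cases h : w g' = w g + d
  · obtain h1 | h1 := f2_cases (A (Pi.single g 1) g') <;> simp [h, h1]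
  · simp [h]

theorem component_add (w : D.Gen → ℤ) (d : ℤ) (A B : Module.End F2 D.Chain) :
    component w d (A + B) = component w d A + component w d B := by
  classical
  refine end_ext fun g => ?_
  ext g'
  rw [LinearMap.add_apply, Pi.add_apply, component_single, component_single, component_single]
  split_ifs <;> simp

theorem component_zero (w : D.Gen → ℤ) (d : ℤ) :
    component w d (0 : Module.End F2 D.Chain) = 0 := by
  classical
  refine end_ext fun g => ?_
  ext g'
  rw [component_single]
  simp

theorem _root_.HomogMap.component_eq {w : D.Gen → ℤ} {d : ℤ} {A : Module.End F2 D.Chain}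
    (hA : HomogMap w w d A) (e : ℤ) : component w e A = if e = d then A else 0 := by
  classical
  refine end_ext fun g => ?_
  ext g'
  rw [component_single]
  have h := hA _ _ (single_mem_basisGrading w g 1) g'
  by_cases h0 : A (Pi.single g 1) g' = 0
  · rw [h0]
    by_cases he : e = d
    · simp [he, h0]
    · simp [he]
  · rw [h h0, add_comm]
    by_cases he : e = d
    · simp [he]
    · simp [he, Ne.symm he]

theorem component_linOfRel (w : D.Gen → ℤ) (d : ℤ) (R : D.Gen → D.Gen → Prop) :
    component w d (D.linOfRel R) = D.linOfRel fun g g' => R g g' ∧ w g' = w g + d := by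
  classical
  refine end_ext fun g => ?_
  ext g'
  rw [component_single, linOfRel_single, linOfRel_single]
  by_cases h1 : R g g' <;> by_cases h2 : w g' = w g + d <;> simp [h1, h2]

theorem linOfRel_congr {R R' : D.Gen → D.Gen → Prop} (h : ∀ g g', R g g' ↔ R' g g') :
    D.linOfRel R = D.linOfRel R' :=
  congrArg D.linOfRel (by funext g g'; exact propext (h g g'))

/-! ## The differentials as components of the total differential -/

theorem dZero_eq : D.dZero = component weight 0 D.total := by
  rw [total, component_linOfRel]
  refine linOfRel_congr fun g g' => ?_
  rw [← khovanov_or_lee_iff]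
  constructor
  · rintro ⟨h, h'⟩
    refine ⟨.inl h, ?_⟩
    rcases khovanovEdge_weight h with h1 | h1 <;> omega
  · rintro ⟨h | h, h'⟩
    · refine ⟨h, ?_⟩
      rcases khovanovEdge_weight h with h1 | h1 <;> omega
    · rcases leeEdge_weight h with h1 | h1 <;> omega

theorem dMinus_eq : D.dMinus = component weight 2 D.total := by
  rw [total, component_linOfRel]
  refine linOfRel_congr fun g g' => ?_
  rw [← khovanov_or_lee_iff]
  constructor
  · rintro ⟨h, h'⟩
    refine ⟨.inl h, ?_⟩
    rcases khovanovEdge_weight h with h1 | h1 <;> omega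
  · rintro ⟨h | h, h'⟩
    · refine ⟨h, ?_⟩
      rcases khovanovEdge_weight h with h1 | h1 <;> omega
    · rcases leeEdge_weight h with h1 | h1 <;> omega

theorem leeZero_eq : D.leeZero = component weight 20 D.total := by
  rw [total, component_linOfRel]
  refine linOfRel_congr fun g g' => ?_
  rw [← khovanov_or_lee_iff]
  constructor
  · rintro ⟨h, h'⟩
    refine ⟨.inr h, ?_⟩
    rcases leeEdge_weight h with h1 | h1 <;> omega
  · rintro ⟨h | h, h'⟩
    · rcases khovanovEdge_weight h with h1 | h1 <;> omega
    · refine ⟨h, ?_⟩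
      rcases leeEdge_weight h with h1 | h1 <;> omega

theorem leePlus_eq : D.leePlus = component weight 18 D.total := by
  rw [total, component_linOfRel]
  refine linOfRel_congr fun g g' => ?_
  rw [← khovanov_or_lee_iff]
  constructor
  · rintro ⟨h, h'⟩
    refine ⟨.inr h, ?_⟩
    rcases leeEdge_weight h with h1 | h1 <;> omega
  · rintro ⟨h | h, h'⟩
    · rcases khovanovEdge_weight h with h1 | h1 <;> omega
    · refine ⟨h, ?_⟩
      rcases leeEdge_weight h with h1 | h1 <;> omega

theorem homogMap_component (w : D.Gen → ℤ) (d : ℤ) (A : Module.End F2 D.Chain) :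
    HomogMap w w d (component w d A) := homogMap_linOfRel fun _ _ h => h.2

theorem total_eq : D.total = D.dZero + D.dMinus + D.leeZero + D.leePlus := by
  classical
  rw [dZero_eq, dMinus_eq, leeZero_eq, leePlus_eq]
  refine end_ext fun g => ?_
  ext g'
  simp only [LinearMap.add_apply, Pi.add_apply, component_single]
  by_cases h : ∃ x, TotalEdge x g g'
  · have h' : weight g' = weight g + 0 ∨ weight g' = weight g + 2 ∨ weight g' = weight g + 20 ∨
        weight g' = weight g + 18 := by
      rcases khovanov_or_lee_iff.2 h with h | h
      · rcases khovanovEdge_weight h with h1 | h1 <;> omega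
      · rcases leeEdge_weight h with h1 | h1 <;> omega
    rcases h' with h' | h' | h' | h' <;> simp [h']
  · rw [total, linOfRel_single, if_neg h]
    simp

/-! ## The action of `e`, `f` and `h` -/

variable (D) in
/-- The sum of the actions of `e` and `f`. -/
noncomputable def labelOp : Module.End F2 D.Chain := ∑ a, D.cut a • toggleOp a

theorem commute_labelOp {A : Module.End F2 D.Chain} (hA : ∀ a, Commute A (toggleOp a)) :
    Commute A D.labelOp :=
  Commute.sum_right _ _ _ fun a _ => (hA a).smul_right _

variable (D) in
/-- The number, modulo two, of intersections of the diagram with the arc. -/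
noncomputable def totalCut : F2 := ∑ a, D.cut a

theorem f2_mul_self (c : F2) : c * c = c := by revert c; decide

/-- The toggles are commuting involutions: modulo two the square of their sum is the sum of the
squares. -/
theorem labelOp_mul_self : D.labelOp * D.labelOp = D.totalCut • 1 := by
  classical
  have key (s : Finset D.Half) : (∑ a ∈ s, D.cut a • toggleOp a) * (∑ a ∈ s, D.cut a • toggleOp a) =
      (∑ a ∈ s, D.cut a) • (1 : Module.End F2 D.Chain) := by
    induction s using Finset.induction_on with
    | empty => simp
    | insert a s ha ih =>
      have hc : Commute (D.cut a • toggleOp a) (∑ b ∈ s, D.cut b • toggleOp b) :=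
        Commute.sum_right _ _ _ fun b _ => ((toggleOp_comm a b).smul_right _).smul_left _
      rw [Finset.sum_insert ha, add_mul, mul_add, mul_add, ih, hc.eq, Finset.sum_insert ha,
        add_smul, smul_mul_smul_comm, toggleOp_mul_self, f2_mul_self]
      have h2 := end_add_self ((∑ b ∈ s, D.cut b • toggleOp b) * (D.cut a • toggleOp a))
      linear_combination (norm := module) h2
  exact key _

theorem toggle_eq_iff {a b : D.Half} {g : D.Gen} :
    toggle a g = toggle b g ↔ D.circ g.1 a = D.circ g.1 b := by
  refine ⟨fun h => ?_, toggle_congr⟩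
  by_contra hab
  have h1 := congrArg (fun g => label g a) h
  simp only [label_toggle] at h1
  rw [sameCircle_of_eq rfl, sameCircle_of_ne hab] at h1
  revert h1
  cases label g a <;> decide

/-- Half-edges of one circle define the same toggle, which therefore occurs with the intersection
parity of the circle as its coefficient. Exactly the nontrivial circles survive. -/
theorem labelOp_eq : D.labelOp = D.linOfRel fun g g' =>
    ∃ a, D.Nontrivial (D.circ g.1 a) ∧ g' = toggle a g := by
  classical
  refine end_ext fun g => ?_
  ext g'
  rw [linOfRel_single, labelOp, LinearMap.sum_apply, Finset.sum_apply]
  simp only [LinearMap.smul_apply, Pi.smul_apply, toggleOp_single, Pi.single_apply, smul_eq_mul,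
    mul_ite, mul_one, mul_zero]
  by_cases h : ∃ a, g' = toggle a g
  · obtain ⟨a, rfl⟩ := h
    simp only [toggle_eq_iff]
    have h1 : ∀ b, (D.circ g.1 a = D.circ g.1 b) = (D.circ g.1 b = D.circ g.1 a) :=
      fun b => propext eq_comm
    simp only [h1]
    rw [← parity_eq_sum]
    by_cases hn : D.Nontrivial (D.circ g.1 a)
    · rw [if_pos ⟨a, hn, rfl⟩]; exact hn
    · rw [if_neg]
      · exact (f2_cases _).resolve_right hn
      · rintro ⟨b, hb, hab⟩
        rw [hab] at hb
        exact hn hb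
  · rw [if_neg fun ⟨a, ha⟩ => h ⟨a, ha.2⟩]
    exact Finset.sum_eq_zero fun a _ => if_neg fun h' => h ⟨a, h'⟩

theorem labelChange_iff {s : Bool} {g g' : D.Gen} : D.LabelChange s g g' ↔
    ∃ a, (D.Nontrivial (D.circ g.1 a) ∧ g' = toggle a g) ∧ label g a = s := by
  constructor
  · rintro ⟨h1, a, h2, h3, h4, h5⟩
    refine ⟨a, ⟨h2, gen_ext h1 fun b => ?_⟩, h3⟩
    rw [label_toggle]
    by_cases hb : D.circ g.1 b = D.circ g.1 a
    · have hb' : D.circ g'.1 b = D.circ g'.1 a := by rw [h1]; exact hb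
      rw [sameCircle_of_eq hb, label_congr hb, label_congr hb', h3, h4, Bool.xor_true]
    · rw [sameCircle_of_ne hb, Bool.xor_false, h5 b hb]
  · rintro ⟨a, ⟨h1, rfl⟩, h2⟩
    refine ⟨rfl, a, h1, h2, ?_, fun b hb => ?_⟩
    · rw [label_toggle, sameCircle_of_eq rfl, h2, Bool.xor_true]
    · rw [label_toggle, sameCircle_of_ne hb, Bool.xor_false]

theorem actE_eq : D.actE = component weight 8 D.labelOp := by
  rw [labelOp_eq, component_linOfRel]
  refine linOfRel_congr fun g g' => ?_
  rw [labelChange_iff]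
  constructor
  · rintro ⟨a, ⟨h1, rfl⟩, h2⟩
    exact ⟨⟨a, h1, rfl⟩, by rw [weight_toggle h1, h2]; rfl⟩
  · rintro ⟨⟨a, h1, rfl⟩, h2⟩
    refine ⟨a, ⟨h1, rfl⟩, ?_⟩
    rw [weight_toggle h1] at h2
    cases h : label g a
    · rfl
    · rw [h] at h2; simp at h2

theorem actF_eq : D.actF = component weight (-8) D.labelOp := by
  rw [labelOp_eq, component_linOfRel]
  refine linOfRel_congr fun g g' => ?_
  rw [labelChange_iff]
  constructor
  · rintro ⟨a, ⟨h1, rfl⟩, h2⟩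
    exact ⟨⟨a, h1, rfl⟩, by rw [weight_toggle h1, h2]; rfl⟩
  · rintro ⟨⟨a, h1, rfl⟩, h2⟩
    refine ⟨a, ⟨h1, rfl⟩, ?_⟩
    rw [weight_toggle h1] at h2
    cases h : label g a
    · rw [h] at h2; simp at h2
    · rfl

theorem labelOp_eq_add : D.labelOp = D.actE + D.actF := by
  classical
  rw [actE_eq, actF_eq]
  refine end_ext fun g => ?_
  ext g'
  simp only [LinearMap.add_apply, Pi.add_apply, component_single]
  rw [labelOp_eq, linOfRel_single]
  by_cases h : ∃ a, D.Nontrivial (D.circ g.1 a) ∧ g' = toggle a g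
  · rw [if_pos h]
    obtain ⟨a, h1, rfl⟩ := h
    rw [weight_toggle h1]
    cases label g a <;> simp
  · simp [h]

/-- Modulo two a nontrivial circle contributes 1 whatever its label, and the parities of all circles
add up to that of the whole diagram. -/
theorem actH_eq : D.actH = D.totalCut • 1 := by
  classical
  let _ := @fintypeCircle D
  have h (g : D.Gen) : ((D.windDeg g : ℤ) : F2) = D.totalCut := by
    rw [windDeg_eq, circSum, Int.cast_sum, totalCut,
      ← Finset.sum_fiberwise (s := Finset.univ) (g := fun a => D.circ g.1 a)]
    refine Finset.sum_congr rfl fun c _ => ?_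
    rw [Finset.sum_filter, ← parity_eq_sum]
    generalize parity c = p
    obtain rfl | rfl := f2_cases p <;> cases g.2 c <;> simp [windTerm]
  refine LinearMap.ext fun m => ?_
  ext g
  change ((D.windDeg g : ℤ) : F2) • m g = D.totalCut • m g
  rw [h]

/-! ## The module structure -/

theorem dZero_homogMap : HomogMap weight weight 0 D.dZero :=
  dZero_eq (D := D) ▸ homogMap_component _ _ _

theorem dMinus_homogMap : HomogMap weight weight 2 D.dMinus :=
  dMinus_eq (D := D) ▸ homogMap_component _ _ _

theorem leeZero_homogMap : HomogMap weight weight 20 D.leeZero :=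
  leeZero_eq (D := D) ▸ homogMap_component _ _ _

theorem leePlus_homogMap : HomogMap weight weight 18 D.leePlus :=
  leePlus_eq (D := D) ▸ homogMap_component _ _ _

theorem actE_homogMap : HomogMap weight weight 8 D.actE :=
  actE_eq (D := D) ▸ homogMap_component _ _ _

theorem actF_homogMap : HomogMap weight weight (-8) D.actF :=
  actF_eq (D := D) ▸ homogMap_component _ _ _

/-- These are the homogeneous components of the one identity that the total differential squares to
zero. The only coincidence among sums of two of the degrees 0, 2, 18, 20 is `0 + 20 = 2 + 18`, which
yields `[d, D] = [v₂, v₋₂]`. -/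
theorem total_relations : D.dZero * D.dZero = 0 ∧ D.dMinus * D.dMinus = 0 ∧
    D.leeZero * D.leeZero = 0 ∧ D.leePlus * D.leePlus = 0 ∧
    D.dZero * D.dMinus + D.dMinus * D.dZero = 0 ∧ D.dZero * D.leePlus + D.leePlus * D.dZero = 0 ∧
    D.leeZero * D.dMinus + D.dMinus * D.leeZero = 0 ∧
    D.leeZero * D.leePlus + D.leePlus * D.leeZero = 0 ∧
    D.dZero * D.leeZero + D.leeZero * D.dZero + (D.leePlus * D.dMinus + D.dMinus * D.leePlus) = 0 := by
  have h := total_mul_total (D := D)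
  rw [total_eq] at h
  simp only [add_mul, mul_add] at h
  have k (d : ℤ) := congrArg (component weight d) h
  have h0 := dZero_homogMap (D := D)
  have hm := dMinus_homogMap (D := D)
  have l0 := leeZero_homogMap (D := D)
  have lp := leePlus_homogMap (D := D)
  simp only [component_add, component_zero, (h0.mul h0).component_eq, (h0.mul hm).component_eq,
    (h0.mul l0).component_eq, (h0.mul lp).component_eq, (hm.mul h0).component_eq,
    (hm.mul hm).component_eq, (hm.mul l0).component_eq, (hm.mul lp).component_eq,
    (l0.mul h0).component_eq, (l0.mul hm).component_eq, (l0.mul l0).component_eq,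
    (l0.mul lp).component_eq, (lp.mul h0).component_eq, (lp.mul hm).component_eq,
    (lp.mul l0).component_eq, (lp.mul lp).component_eq] at k
  refine ⟨?_, ?_, ?_, ?_, ?_, ?_, ?_, ?_, ?_⟩
  · simpa using k 0
  · simpa using k 4
  · simpa using k 40
  · simpa using k 36
  · simpa [add_comm] using k 2
  · simpa [add_comm] using k 18
  · simpa [add_comm] using k 22
  · simpa [add_comm] using k 38
  · have := k 20
    norm_num at this
    rw [← this]
    abel

theorem label_relations : D.actE * D.actE = 0 ∧ D.actF * D.actF = 0 ∧
    D.actE * D.actF + D.actF * D.actE = D.actH := by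
  have h := labelOp_mul_self (D := D)
  rw [← actH_eq, labelOp_eq_add] at h
  simp only [add_mul, mul_add] at h
  have k (d : ℤ) := congrArg (component weight d) h
  have he := actE_homogMap (D := D)
  have hf := actF_homogMap (D := D)
  have hh : HomogMap weight weight 0 D.actH := actH_eq (D := D) ▸ HomogMap.smul_one _
  simp only [component_add, (he.mul he).component_eq, (he.mul hf).component_eq,
    (hf.mul he).component_eq, (hf.mul hf).component_eq, hh.component_eq] at k
  refine ⟨?_, ?_, ?_⟩
  · simpa using k 16
  · simpa using k (-16)
  · simpa [add_comm] using k 0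

/-- Components of the commutator of `labelOp` with the total differential. The only coincidence of
degrees is `8 + 2 = -8 + 18`, which yields `[e, v₋₂] = [f, v₂]`. -/
theorem label_total_relations : D.actE * D.dZero + D.dZero * D.actE = 0 ∧
    D.actF * D.dZero + D.dZero * D.actF = 0 ∧ D.actE * D.leeZero + D.leeZero * D.actE = 0 ∧
    D.actF * D.leeZero + D.leeZero * D.actF = 0 ∧ D.actE * D.leePlus + D.leePlus * D.actE = 0 ∧
    D.actF * D.dMinus + D.dMinus * D.actF = 0 ∧
    D.actE * D.dMinus + D.dMinus * D.actE + (D.actF * D.leePlus + D.leePlus * D.actF) = 0 := by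
  have h := (commute_labelOp (D := D) total_commute).eq
  have h := (congrArg (· + D.labelOp * D.total) h).trans (end_add_self _)
  simp only [total_eq, labelOp_eq_add, add_mul, mul_add] at h
  have k (d : ℤ) := congrArg (component weight d) h
  have h0 := dZero_homogMap (D := D)
  have hm := dMinus_homogMap (D := D)
  have l0 := leeZero_homogMap (D := D)
  have lp := leePlus_homogMap (D := D)
  have he := actE_homogMap (D := D)
  have hf := actF_homogMap (D := D)
  simp only [component_add, component_zero, (he.mul h0).component_eq, (he.mul hm).component_eq,
    (he.mul l0).component_eq, (he.mul lp).component_eq, (hf.mul h0).component_eq,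
    (hf.mul hm).component_eq, (hf.mul l0).component_eq, (hf.mul lp).component_eq,
    (h0.mul he).component_eq, (hm.mul he).component_eq, (l0.mul he).component_eq,
    (lp.mul he).component_eq, (h0.mul hf).component_eq, (hm.mul hf).component_eq,
    (l0.mul hf).component_eq, (lp.mul hf).component_eq] at k
  refine ⟨?_, ?_, ?_, ?_, ?_, ?_, ?_⟩
  · simpa [add_comm] using k 8
  · simpa [add_comm] using k (-8)
  · simpa [add_comm] using k 28
  · simpa [add_comm] using k 12
  · simpa [add_comm] using k 26
  · simpa [add_comm] using k (-6)
  · have := k 10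
    norm_num at this
    rw [← this]
    abel

theorem end_eq_of_add_eq_zero {A B : Module.End F2 D.Chain} (h : A + B = 0) : A = B := by
  rw [add_eq_zero_iff_eq_neg.1 h, ZModModule.neg_eq_self]

/-- If `A² = 0`, both products reduce to `A B A`. -/
theorem commute_anticommutator {A B : Module.End F2 D.Chain} (h : A * A = 0) :
    Commute A (A * B + B * A) := by
  rw [commute_iff_eq, mul_add, add_mul, ← mul_assoc, h, mul_assoc B, h]
  simp [mul_assoc]

/-- Each of `ṽ₀` and `x` is a commutator in two ways. To show that an element commutes with it, one
uses the expression whose factors commute with that element, or one containing the element itself,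
which squares to zero. -/
theorem act_bracket (a b : SlBasis) :
    (Pi.basisFun F2 SlBasis).constr F2 D.act (SlBasis.bracket a b) =
      D.act a * D.act b + D.act b * D.act a := by
  obtain ⟨t1, t2, t3, t4, t5, t6, t7, t8, t9⟩ := total_relations (D := D)
  obtain ⟨s1, s2, s3⟩ := label_relations (D := D)
  obtain ⟨u1, u2, u3, u4, u5, u6, u7⟩ := label_total_relations (D := D)
  have single (c : SlBasis) :
      (Pi.basisFun F2 SlBasis).constr F2 D.act (Pi.single c 1) = D.act c := by
    have h := (Pi.basisFun F2 SlBasis).constr_basis F2 D.act c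
    rwa [Pi.basisFun_apply] at h
  have hv : D.act .v0 = D.actE * D.dMinus + D.dMinus * D.actE :=
    ZModModule.sub_eq_add _ _
  have hv' : D.act .v0 = D.actF * D.leePlus + D.leePlus * D.actF := by
    rw [hv]; exact end_eq_of_add_eq_zero u7
  have hx : D.act .x = D.leePlus * D.dMinus + D.dMinus * D.leePlus := rfl
  have hx' : D.act .x = D.dZero * D.leeZero + D.leeZero * D.dZero := by
    rw [hx]; exact (end_eq_of_add_eq_zero t9).symm
  have comm {A B : Module.End F2 D.Chain} (h : A * B + B * A = 0) : Commute A B :=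
    end_eq_of_add_eq_zero h
  have hh (A : Module.End F2 D.Chain) : Commute D.actH A := by
    rw [actH_eq]; exact (Commute.one_left A).smul_left _
  have acomm {A B C : Module.End F2 D.Chain} (h1 : Commute A B) (h2 : Commute A C) :
      Commute A (B * C + C * B) := (h1.mul_right h2).add_right (h2.mul_right h1)
  have ve : Commute D.actE (D.act .v0) := hv ▸ commute_anticommutator s1
  have vf : Commute D.actF (D.act .v0) := hv' ▸ commute_anticommutator s2
  have vm : Commute D.dMinus (D.act .v0) := by
    rw [hv, add_comm]; exact commute_anticommutator t2
  have vp : Commute D.leePlus (D.act .v0) := by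
    rw [hv', add_comm]; exact commute_anticommutator t4
  have vz : Commute D.dZero (D.act .v0) := hv ▸ acomm (comm u1).symm (comm t5)
  have vl : Commute D.leeZero (D.act .v0) := hv ▸ acomm (comm u3).symm (comm t7)
  have xe : Commute D.actE (D.act .x) := hx' ▸ acomm (comm u1) (comm u3)
  have xf : Commute D.actF (D.act .x) := hx' ▸ acomm (comm u2) (comm u4)
  have xp : Commute D.leePlus (D.act .x) := hx ▸ commute_anticommutator t4
  have xm : Commute D.dMinus (D.act .x) := by
    rw [hx, add_comm]; exact commute_anticommutator t2
  have xz : Commute D.dZero (D.act .x) := hx' ▸ commute_anticommutator t1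
  have xl : Commute D.leeZero (D.act .x) := by
    rw [hx', add_comm]; exact commute_anticommutator t3
  have xv : Commute (D.act .v0) (D.act .x) := hx ▸ acomm vp.symm vm.symm
  have of_comm {a b : SlBasis} (h0 : SlBasis.bracket a b = 0) (h : Commute (D.act a) (D.act b)) :
      (Pi.basisFun F2 SlBasis).constr F2 D.act (SlBasis.bracket a b) =
        D.act a * D.act b + D.act b * D.act a := by
    rw [h0, map_zero, h.eq, end_add_self]
  let P (a b : SlBasis) : Prop :=
    (Pi.basisFun F2 SlBasis).constr F2 D.act (SlBasis.bracket a b) =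
      D.act a * D.act b + D.act b * D.act a
  -- Both sides are symmetric, so only half of the multiplication table has to be filled in.
  have hs {a b : SlBasis} (h : P a b) : P b a := by
    refine Eq.trans (congrArg _ ?_) (h.trans (add_comm _ _))
    cases a <;> cases b <;> rfl
  have kh (b : SlBasis) : P .h b := of_comm (by cases b <;> rfl) (hh _)
  have self (b : SlBasis) : P b b := of_comm (by cases b <;> rfl) (Commute.refl _)
  have ke (b : SlBasis) : P .e b := by
    cases b
    exacts [self _, (single _).trans s3.symm, hs (kh _), of_comm rfl (comm u5),
      (single _).trans hv, of_comm rfl ve, of_comm rfl (comm u1), of_comm rfl (comm u3),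
      of_comm rfl xe]
  have kf (b : SlBasis) : P .f b := by
    cases b
    exacts [hs (ke _), self _, hs (kh _), (single _).trans hv', of_comm rfl (comm u6),
      of_comm rfl vf, of_comm rfl (comm u2), of_comm rfl (comm u4), of_comm rfl xf]
  have kp (b : SlBasis) : P .v2 b := by
    cases b
    exacts [hs (ke _), hs (kf _), hs (kh _), self _, (single _).trans hx, of_comm rfl vp,
      of_comm rfl (comm t6).symm, of_comm rfl (comm t8).symm, of_comm rfl xp]
  have km (b : SlBasis) : P .vm2 b := by
    cases b
    exacts [hs (ke _), hs (kf _), hs (kh _), hs (kp _), self _, of_comm rfl vm,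
      of_comm rfl (comm t5).symm, of_comm rfl (comm t7).symm, of_comm rfl xm]
  have kv (b : SlBasis) : P .v0 b := by
    cases b
    exacts [hs (ke _), hs (kf _), hs (kh _), hs (kp _), hs (km _), self _,
      of_comm rfl vz.symm, of_comm rfl vl.symm, of_comm rfl xv]
  have kd (b : SlBasis) : P .d b := by
    cases b
    exacts [hs (ke _), hs (kf _), hs (kh _), hs (kp _), hs (km _), hs (kv _), self _,
      (single _).trans hx', of_comm rfl xz]
  have kl (b : SlBasis) : P .D b := by
    cases b
    exacts [hs (ke _), hs (kf _), hs (kh _), hs (kp _), hs (km _), hs (kv _), hs (kd _), self _,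
      of_comm rfl xl]
  cases a
  exacts [ke b, kf b, kh b, kp b, km b, kv b, kd b, kl b, by
    cases b
    exacts [hs (ke _), hs (kf _), hs (kh _), hs (kp _), hs (km _), hs (kv _), hs (kd _), hs (kl _),
      self _]]

/-! ### The homological degree of the action. -/

theorem total_homDeg {g g' : D.Gen} (h : ∃ x, TotalEdge x g g') : D.homDeg g' = D.homDeg g + 1 := by
  obtain ⟨x, h0, hf, -⟩ := h
  rw [homDeg_eq, homDeg_eq, hf.ones h0]
  push_cast
  ring

theorem _root_.HomogMap.component {w w' : D.Gen → ℤ} {d e : ℤ} {A : Module.End F2 D.Chain}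
    (hA : HomogMap w w d A) : HomogMap w w d (AnnularDiagram.component w' e A) := by
  classical
  refine homogMap_linOfRel fun g g' h => ?_
  have h1 : A (Pi.single g 1) g' = 1 := by convert h.1
  rw [hA _ _ (single_mem_basisGrading w g 1) g' (by rw [h1]; decide), add_comm]

theorem act_homDeg (b : SlBasis) : HomogMap D.homDeg D.homDeg b.deg (D.act b) := by
  have ht : HomogMap D.homDeg D.homDeg 1 D.total := homogMap_linOfRel fun _ _ => total_homDeg
  have hl : HomogMap D.homDeg D.homDeg 0 D.labelOp := by
    rw [labelOp_eq]
    refine homogMap_linOfRel fun g g' => ?_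
    rintro ⟨a, -, rfl⟩
    exact (add_zero _).symm
  have he : HomogMap D.homDeg D.homDeg 0 D.actE := actE_eq (D := D) ▸ hl.component
  have hm : HomogMap D.homDeg D.homDeg 1 D.dMinus := dMinus_eq (D := D) ▸ ht.component
  have hp : HomogMap D.homDeg D.homDeg 1 D.leePlus := leePlus_eq (D := D) ▸ ht.component
  have hf : HomogMap D.homDeg D.homDeg 0 D.actF := actF_eq (D := D) ▸ hl.component
  have hh : HomogMap D.homDeg D.homDeg 0 D.actH := actH_eq (D := D) ▸ HomogMap.smul_one _
  have hd : HomogMap D.homDeg D.homDeg 1 D.dZero := dZero_eq (D := D) ▸ ht.component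
  have hl : HomogMap D.homDeg D.homDeg 1 D.leeZero := leeZero_eq (D := D) ▸ ht.component
  have hv : HomogMap D.homDeg D.homDeg 1 (D.actE * D.dMinus - D.dMinus * D.actE) := by
    rw [ZModModule.sub_eq_add]
    exact (he.mul hm).add (hm.mul he)
  cases b
  exacts [he, hf, hh, hp, hm, hv, hd, hl, (hp.mul hm).add (hm.mul hp)]

variable (D) in
/-- The action of `sl₂(∧)_dg`. -/
noncomputable def actLin : Sl2dg →ₗ[F2] D.Chain →ₗ[F2] D.Chain :=
  (Pi.basisFun F2 SlBasis).constr F2 D.act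

theorem actLin_single (b : SlBasis) : D.actLin (Pi.single b 1) = D.act b := by
  have h := (Pi.basisFun F2 SlBasis).constr_basis F2 D.act b
  rwa [Pi.basisFun_apply] at h

theorem CKh_op (a : ℕ) : D.CKh.op a = unaryFamily D.dZero D.actLin a := by
  match a with
  | 0 => rfl
  | 1 => rfl
  | _ + 2 => rfl

theorem actLin_mem (b : SlBasis) (m : D.Chain) (e : ℤ) (hm : m ∈ D.CKh.gr e) :
    D.actLin (Pi.single b 1) m ∈ D.CKh.gr (SlBasis.deg b + e) := by
  rw [actLin_single]
  exact act_homDeg b e m hm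

theorem CKh_isLInfModule : D.CKh.IsLInfModule sl2dg := by
  classical
  refine isLInfModule_of_unary CKh_op (basisGrading_isInternal _) (actLin_single .d) actLin_mem
    (fun m => ?_) fun a b => ?_
  · exact LinearMap.congr_fun total_relations.1 m
  · rw [actLin_single, actLin_single]
    exact act_bracket a b

end AnnularDiagram

/-! # Bigons -/

namespace AnnularDiagram

variable {D : AnnularDiagram}

/-- The crossings `b` and `t` bound a bigon as in the second Reidemeister move. -/
structure Bigon (b t : D.Crossing) : Prop where
  ne : b ≠ t
  opp_one : D.opp (half b 1) = half t 1
  opp_two : D.opp (half b 2) = half t 0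
  cut_b_one : D.cut (half b 1) = 0
  cut_t_one : D.cut (half t 1) = 0
  cut_b_two : D.cut (half b 2) = 0
  cut_t_zero : D.cut (half t 0) = 0

/-- The half-edges inside the disk of the second Reidemeister move. -/
def Inner (b t : D.Crossing) (a : D.Half) : Prop :=
  a = half b 1 ∨ a = half b 2 ∨ a = half t 0 ∨ a = half t 1

namespace Bigon

variable {b t : D.Crossing} (hB : Bigon b t)
include hB

theorem cut_inner {a : D.Half} (h : Inner b t a) : D.cut a = 0 := by
  rcases h with rfl | rfl | rfl | rfl
  exacts [hB.cut_b_one, hB.cut_b_two, hB.cut_t_zero, hB.cut_t_one]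

theorem circ_one (v : D.State) : D.circ v (half b 1) = D.circ v (half t 1) := by
  rw [← hB.opp_one, circ_opp]

theorem circ_two (v : D.State) : D.circ v (half b 2) = D.circ v (half t 0) := by
  rw [← hB.opp_two, circ_opp]

theorem circ_inner {v : D.State} (hb : v b = true) {a : D.Half} (h : Inner b t a) :
    D.circ v a = D.circ v (half b 1) := by
  have h1 := circ_true hb
  have h2 := hB.circ_one v
  have h3 := hB.circ_two v
  rcases h with rfl | rfl | rfl | rfl
  exacts [rfl, h1.1.symm, h3.symm.trans h1.1.symm, h2.symm]

/-- The four inner half-edges are closed under `opp` and under both smoothings in question, so they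
form a whole circle. -/
theorem inner_of_circ {v : D.State} (hb : v b = true) (ht : v t = false) {a : D.Half}
    (h : D.circ v a = D.circ v (half b 1)) : Inner b t a := by
  have ho (a : D.Half) (ha : Inner b t a) : Inner b t (D.opp a) := by
    have h1 := hB.opp_one
    have h2 := hB.opp_two
    have h3 : D.opp (half t 1) = half b 1 := by rw [← h1, D.opp_opp]
    have h4 : D.opp (half t 0) = half b 2 := by rw [← h2, D.opp_opp]
    rcases ha with rfl | rfl | rfl | rfl
    · rw [h1]; exact .inr (.inr (.inr rfl))
    · rw [h2]; exact .inr (.inr (.inl rfl))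
    · rw [h4]; exact .inr (.inl rfl)
    · rw [h3]; exact .inl rfl
  have hs (a : D.Half) (ha : Inner b t a) : Inner b t (D.smooth v a) := by
    obtain ⟨e0, e1, e2, e3⟩ := smooth_half_true hb
    obtain ⟨e0', e1', e2', e3'⟩ := smooth_half_false ht
    rcases ha with rfl | rfl | rfl | rfl
    · rw [e1]; exact .inr (.inl rfl)
    · rw [e2]; exact .inl rfl
    · rw [e0']; exact .inr (.inr (.inr rfl))
    · rw [e1']; exact .inr (.inr (.inl rfl))
  have h1 := eq_of_circ_eq (Inner b t) (fun a => propext ⟨fun h => ?_, ho a⟩)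
    (fun a => propext ⟨fun h => ?_, hs a⟩) h
  · rw [h1]; exact .inl rfl
  · rw [← D.opp_opp a]; exact ho _ h
  · rw [← smooth_smooth v a]; exact hs _ h

theorem parity_inner {v : D.State} (hb : v b = true) (ht : v t = false) {a : D.Half}
    (h : Inner b t a) : parity (D.circ v a) = 0 := by
  classical
  rw [hB.circ_inner hb h, parity_eq_sum]
  refine Finset.sum_eq_zero fun c _ => ?_
  split_ifs with hc
  · exact hB.cut_inner (hB.inner_of_circ hb ht hc)
  · rfl

theorem circ_b_ne {v : D.State} (hb : v b = true) (ht : v t = false) :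
    D.circ v (half b 0) ≠ D.circ v (half b 2) := by
  intro h
  have h1 := hB.inner_of_circ hb ht (h.trans (hB.circ_inner hb (.inr (.inl rfl))))
  have := hB.ne
  simp [Inner, half, this] at h1
  exact absurd h1 (by decide)

theorem circ_t_ne {v : D.State} (hb : v b = true) (ht : v t = false) :
    D.circ v (half t 0) ≠ D.circ v (half t 2) := by
  intro h
  have h1 := hB.inner_of_circ hb ht (h.symm.trans (hB.circ_inner hb (.inr (.inr (.inl rfl)))))
  have := hB.ne.symm
  simp [Inner, half, this] at h1
  exact absurd h1 (by decide)

/-- An edge of the cube at another crossing does not change the circle inside the disk. -/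
theorem label_inner {x : D.Crossing} {g g' : D.Gen} (h : TotalEdge x g g') (hxb : x ≠ b) (hxt : x ≠ t)
    (hb : g.1 b = true) (ht : g.1 t = false) : label g' (half b 1) = label g (half b 1) := by
  refine h.2.2.1 _ ?_
  rw [touches_iff]
  rintro ⟨k, hk⟩
  have h1 := hB.inner_of_circ hb ht hk.symm
  simp [Inner, half, hxb, hxt] at h1

end Bigon

/-- The first half of the generators outside of the image of the other diagram: the circle inside the
disk, if there is one, has the label `+`. -/
def BigonSource (b t : D.Crossing) (g : D.Gen) : Prop :=
  g.1 t = false ∧ (g.1 b = true → label g (half b 1) = true)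

/-- The second half of the generators outside of the image of the other diagram. -/
def BigonTarget (b t : D.Crossing) (g : D.Gen) : Prop :=
  g.1 b = true ∧ (g.1 t = false → label g (half b 1) = false)

/-- The part of the differential that is cancelled by the second Reidemeister move. -/
def BigonEdge (b t : D.Crossing) (g g' : D.Gen) : Prop :=
  BigonSource b t g ∧ BigonTarget b t g' ∧ ∃ x, TotalEdge x g g'

theorem TotalEdge.eq_of_ne {x y : D.Crossing} {g g' : D.Gen} (h : TotalEdge x g g')
    (hy : g'.1 y ≠ g.1 y) : x = y := by
  by_contra hxy
  exact hy (h.2.1.2 y (Ne.symm hxy))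

theorem TotalEdge.not_of_true {x y : D.Crossing} {g g' : D.Gen} (h : TotalEdge x g g')
    (hy : g.1 y = true) : g'.1 y = true := by
  by_cases hxy : y = x
  · rw [hxy, h.1] at hy; exact absurd hy (by decide)
  · rw [h.2.1.2 y hxy, hy]

namespace Bigon

variable {b t : D.Crossing} (hB : Bigon b t)
include hB

theorem label_two {g : D.Gen} (hb : g.1 b = true) : label g (half b 2) = label g (half b 1) :=
  label_congr (hB.circ_inner hb (.inr (.inl rfl)))

theorem label_zero {g : D.Gen} (hb : g.1 b = true) : label g (half t 0) = label g (half b 1) :=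
  label_congr (hB.circ_inner hb (.inr (.inr (.inl rfl))))

/-- An edge changes one crossing, so it must be the split at `b` creating a small circle labelled
`-`, or the merge at `t` absorbing one labelled `+`. In both cases the label of the other strand is
carried over, even in the presence of the Lee terms. -/
theorem bigonEdge_cases {g g' : D.Gen} (h : BigonEdge b t g g') :
    (g.1 b = false ∧ g'.1 b = true ∧ g'.1 t = false ∧ TotalEdge b g g' ∧
      label g' (half b 2) = false ∧ label g (half b 0) = label g' (half b 0)) ∨
    (g.1 b = true ∧ g.1 t = false ∧ g'.1 t = true ∧ TotalEdge t g g' ∧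
      label g (half t 0) = true ∧ label g' (half t 0) = label g (half t 2)) := by
  obtain ⟨⟨h1, h2⟩, ⟨h3, h4⟩, x, hx⟩ := h
  cases hb : g.1 b
  · obtain rfl : x = b := hx.eq_of_ne (by rw [hb, h3]; decide)
    have ht : g'.1 t = false := by rw [hx.2.1.2 t hB.ne.symm, h1]
    have h5 := (hB.label_two h3).trans (h4 ht)
    refine .inl ⟨rfl, h3, ht, hx, h5, ?_⟩
    have h6 := hx.2.2.2.1 (by
      by_contra h7
      exact hB.circ_b_ne h3 ht (hx.2.1.circ_iff.2 h7))
    rw [h6, h5, Bool.xor_false]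
  · have h5 := (hB.label_zero hb).trans (h2 hb)
    cases ht : g'.1 t
    -- An edge at a third crossing keeps the small circle and its label, so it cannot lead from `+`
    -- to `-`.
    · have hxt : x ≠ t := by
        rintro rfl
        have := hx.2.1.1
        rw [ht, h1] at this
        exact absurd this (by decide)
      have hxb : x ≠ b := by
        rintro rfl
        have := hx.1
        rw [hb] at this
        exact absurd this (by decide)
      have h6 := hB.label_inner hx hxb hxt hb h1
      rw [h4 ht, h2 hb] at h6
      exact absurd h6 (by decide)
    · obtain rfl : x = t := hx.eq_of_ne (by rw [h1, ht]; decide)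
      refine .inr ⟨rfl, h1, rfl, hx, h5, ?_⟩
      rw [hx.2.2.2.2 (hB.circ_t_ne hb h1), h5]
      simp

/-- This and the next three statements say that the cancelled edges form a perfect matching between
sources and targets. -/
theorem exists_bigonEdge {g : D.Gen} (h : BigonSource b t g) : ∃ g', BigonEdge b t g g' := by
  classical
  cases hb : g.1 b
  · have hf := Flip.update (x := b) g.1
    set w := Function.update g.1 b (!g.1 b)
    have hwb : w b = true := by rw [hf.1, hb]; rfl
    have hwt : w t = false := by rw [hf.2 t hB.ne.symm, h.1]
    have hne := hB.circ_b_ne hwb hwt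
    obtain ⟨g', h1, h2, h3, h4⟩ := hf.exists_gen (fun i => if i = 0 then label g (half b 0) else false)
      fun h' => absurd h' hne
    simp only [if_true, one_ne_zero, if_false] at h3 h4
    have hg' : g'.1 b = true := by rw [h1, hwb]
    refine ⟨g', h, ⟨hg', fun _ => ?_⟩, b, hb, h1 ▸ hf, h2, fun _ => ?_, fun h' => ?_⟩
    · rw [← hB.label_two hg', h4]
    · rw [h3, h4, Bool.xor_false]
    · exact absurd (hf.circ_iff.2 h') hne
  · have hf := Flip.update (x := t) g.1
    set w := Function.update g.1 t (!g.1 t)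
    have hwt : w t = true := by rw [hf.1, h.1]; rfl
    have hwb : w b = true := by rw [hf.2 b hB.ne, hb]
    obtain ⟨g', h1, h2, h3, -⟩ := hf.exists_gen (fun _ => label g (half t 2)) fun _ => rfl
    refine ⟨g', h, ⟨by rw [h1, hwb], fun h' => ?_⟩, t, h.1, h1 ▸ hf, h2, fun h' => ?_, fun _ => ?_⟩
    · rw [h1, hwt] at h'
      exact absurd h' (by decide)
    · exact absurd h' (hB.circ_t_ne hb h.1)
    · rw [h3, hB.label_zero hb, h.2 hb]
      simp

theorem exists_bigonEdge' {g : D.Gen} (h : BigonTarget b t g) : ∃ g', BigonEdge b t g' g := by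
  classical
  cases ht : g.1 t
  · have hf := Flip.update (x := b) g.1
    set w := Function.update g.1 b (!g.1 b)
    have hwb : w b = false := by rw [hf.1, h.1]; rfl
    have hwt : w t = false := by rw [hf.2 t hB.ne.symm, ht]
    have hne := hB.circ_b_ne h.1 ht
    obtain ⟨g', h1, h2, h3, -⟩ := hf.exists_gen (fun _ => label g (half b 0)) fun _ => rfl
    have hf' : Flip b g'.1 g.1 := h1 ▸ hf.symm
    refine ⟨g', ⟨by rw [h1, hwt], fun h' => ?_⟩, h, b, by rw [h1, hwb], hf', fun a ha => ?_,
      fun _ => ?_, fun h' => ?_⟩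
    · rw [h1, hwb] at h'
      exact absurd h' (by decide)
    · exact (h2 a fun h' => ha ((hf'.symm.touches_iff a).2 h')).symm
    · rw [h3, hB.label_two h.1, h.2 ht, Bool.xor_false]
    · exact absurd (hf'.circ_iff.2 h') hne
  · have hf := Flip.update (x := t) g.1
    set w := Function.update g.1 t (!g.1 t)
    have hwt : w t = false := by rw [hf.1, ht]; rfl
    have hwb : w b = true := by rw [hf.2 b hB.ne, h.1]
    have hne := hB.circ_t_ne hwb hwt
    obtain ⟨g', h1, h2, h3, h4⟩ := hf.exists_gen (fun i => if i = 0 then true else label g (half t 0))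
      fun h' => absurd h' hne
    simp only [if_true, one_ne_zero, if_false] at h3 h4
    have hf' : Flip t g'.1 g.1 := h1 ▸ hf.symm
    have hg' : g'.1 b = true := by rw [h1, hwb]
    refine ⟨g', ⟨by rw [h1, hwt], fun _ => ?_⟩, h, t, by rw [h1, hwt], hf', fun a ha => ?_,
      fun h' => ?_, fun _ => ?_⟩
    · rw [← hB.label_zero hg', h3]
    · exact (h2 a fun h' => ha ((hf'.symm.touches_iff a).2 h')).symm
    · rw [h1] at h'
      exact absurd h' hne
    · rw [h3, h4]
      simp

theorem bigonEdge_unique {g g₁ g₂ : D.Gen} (h₁ : BigonEdge b t g g₁) (h₂ : BigonEdge b t g g₂) :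
    g₁ = g₂ := by
  rcases hB.bigonEdge_cases h₁ with ⟨a1, a2, a3, a4, a5, a6⟩ | ⟨a1, a2, a3, a4, a5, a6⟩ <;>
  rcases hB.bigonEdge_cases h₂ with ⟨c1, c2, c3, c4, c5, c6⟩ | ⟨c1, c2, c3, c4, c5, c6⟩
  · refine gen_ext_of_touches (x := b) (a4.2.1.eq c4.2.1) (fun a ha => ?_) ?_ ?_
    · rw [a4.2.1.touches_iff] at ha
      rw [a4.2.2.1 a ha, c4.2.2.1 a ha]
    · rw [← a6, c6]
    · rw [a5, c5]
  · rw [a1] at c1; exact absurd c1 (by decide)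
  · rw [a1] at c1; exact absurd c1 (by decide)
  · have hw (g' : D.Gen) (h' : TotalEdge t g g') : D.circ g'.1 (half t 0) = D.circ g'.1 (half t 2) :=
      h'.2.1.circ_iff.2 (hB.circ_t_ne a1 a2)
    refine gen_ext_of_touches (x := t) (a4.2.1.eq c4.2.1) (fun a ha => ?_) ?_ ?_
    · rw [a4.2.1.touches_iff] at ha
      rw [a4.2.2.1 a ha, c4.2.2.1 a ha]
    · rw [a6, c6]
    · rw [← label_congr (hw _ a4), ← label_congr (hw _ c4), a6, c6]

theorem bigonEdge_unique' {g g₁ g₂ : D.Gen} (h₁ : BigonEdge b t g₁ g) (h₂ : BigonEdge b t g₂ g) :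
    g₁ = g₂ := by
  rcases hB.bigonEdge_cases h₁ with ⟨a1, a2, a3, a4, a5, a6⟩ | ⟨a1, a2, a3, a4, a5, a6⟩ <;>
  rcases hB.bigonEdge_cases h₂ with ⟨c1, c2, c3, c4, c5, c6⟩ | ⟨c1, c2, c3, c4, c5, c6⟩
  · have hw (g' : D.Gen) (h' : TotalEdge b g' g) :
        D.circ g'.1 (half b 0) = D.circ g'.1 (half b 2) :=
      h'.2.1.symm.circ_iff.2 (hB.circ_b_ne a2 a3)
    refine gen_ext_of_touches (x := b) (a4.2.1.symm.eq c4.2.1.symm) (fun a ha => ?_) ?_ ?_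
    · rw [← a4.2.2.1 a ha]
      rw [← a4.2.1.touches_iff, c4.2.1.touches_iff] at ha
      rw [← c4.2.2.1 a ha]
    · rw [a6, c6]
    · rw [← label_congr (hw _ a4), ← label_congr (hw _ c4), a6, c6]
  · rw [a3] at c3; exact absurd c3 (by decide)
  · rw [a3] at c3; exact absurd c3 (by decide)
  · refine gen_ext_of_touches (x := t) (a4.2.1.symm.eq c4.2.1.symm) (fun a ha => ?_) ?_ ?_
    · rw [← a4.2.2.1 a ha]
      rw [← a4.2.1.touches_iff, c4.2.1.touches_iff] at ha
      rw [← c4.2.2.1 a ha]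
    · rw [a5, c5]
    · rw [← a6, c6]

/-- The small circle is trivial, so it counts with ±5. Creating it with label `-` or absorbing it
with label `+` costs 5, which the new 1-resolution restores. -/
theorem bigonEdge_weight {g g' : D.Gen} (h : BigonEdge b t g g') : weight g' = weight g := by
  rcases hB.bigonEdge_cases h with ⟨a1, a2, a3, a4, a5, a6⟩ | ⟨a1, a2, a3, a4, a5, a6⟩
  · have h1 := circSum_merge weightTerm a4.2.1.symm (hB.circ_b_ne a2 a3) fun a ha =>
      (a4.2.2.1 a fun h' => ha ((a4.2.1.touches_iff a).2 h')).symm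
    rw [hB.parity_inner a2 a3 (.inr (.inl rfl)), add_zero, a5, a6] at h1
    rw [weight, weight, a4.2.1.ones a1]
    push_cast
    simp [weightTerm, windTerm] at h1
    omega
  · have h1 := circSum_merge weightTerm a4.2.1 (hB.circ_t_ne a1 a2) a4.2.2.1
    rw [hB.parity_inner a1 a2 (.inr (.inr (.inl rfl))), zero_add, a5, a6] at h1
    rw [weight, weight, a4.2.1.ones a2]
    push_cast
    simp [weightTerm, windTerm] at h1
    omega

end Bigon

end AnnularDiagram

/-! # The homotopy of a bigon -/

namespace AnnularDiagram

variable {D : AnnularDiagram}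

/-- The chains supported on a set of generators. -/
def supportedIn (S : D.Gen → Prop) : Submodule F2 D.Chain where
  carrier := {m | ∀ g, m g ≠ 0 → S g}
  zero_mem' := by intro g hg; exact absurd rfl hg
  add_mem' := by
    intro m m' hm hm' g hg
    by_cases h : m g = 0
    · exact hm' g fun h' => hg (by simp [h, h'])
    · exact hm g h
  smul_mem' := by
    intro c m hm g hg
    exact hm g fun h => hg (by simp [h])

theorem supportedIn_mono {S T : D.Gen → Prop} (h : ∀ g, S g → T g) : supportedIn S ≤ supportedIn T :=
  fun _ hm g hg => h g (hm g hg)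

theorem linOfRel_mem_supportedIn {S T : D.Gen → Prop} {R : D.Gen → D.Gen → Prop}
    (h : ∀ g g', S g → R g g' → T g') {m : D.Chain} (hm : m ∈ supportedIn S) :
    D.linOfRel R m ∈ supportedIn T := by
  classical
  intro g' hg'
  rw [linOfRel_apply] at hg'
  obtain ⟨g, -, hg⟩ := Finset.exists_ne_zero_of_sum_ne_zero hg'
  by_cases hR : R g g'
  · rw [if_pos hR] at hg
    exact h g g' (hm g hg) hR
  · rw [if_neg hR] at hg
    exact absurd rfl hg

theorem linOfRel_eq_zero {S : D.Gen → Prop} {R : D.Gen → D.Gen → Prop}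
    (h : ∀ g g', S g → ¬ R g g') {m : D.Chain} (hm : m ∈ supportedIn S) : D.linOfRel R m = 0 := by
  have h1 := linOfRel_mem_supportedIn (T := fun _ => False) (fun g g' hg hR => h g g' hg hR) hm
  ext g
  by_contra hg
  exact h1 g hg

theorem mem_supportedIn_true (m : D.Chain) : m ∈ supportedIn (D := D) fun _ => True := fun _ _ => trivial

open Classical in
theorem linOfRel_single_of_unique {R : D.Gen → D.Gen → Prop} {g g' : D.Gen}
    (h : ∀ g'', R g g'' ↔ g'' = g') : D.linOfRel R (Pi.single g 1) = Pi.single g' 1 := by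
  ext g''
  rw [linOfRel_single, Pi.single_apply]
  simp only [h]

open Classical in
theorem linOfRel_single_of_not {R : D.Gen → D.Gen → Prop} {g : D.Gen}
    (h : ∀ g', ¬ R g g') : D.linOfRel R (Pi.single g 1) = 0 := by
  ext g''
  rw [linOfRel_single, if_neg (h g'')]
  rfl

/-- The part of the differential that is cancelled by the second Reidemeister move. -/
noncomputable def bigonOp (b t : D.Crossing) : Module.End F2 D.Chain := D.linOfRel (BigonEdge b t)

/-- The homotopy for the second Reidemeister move. -/
noncomputable def bigonHomotopy (b t : D.Crossing) : Module.End F2 D.Chain :=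
  D.linOfRel fun g g' => BigonEdge b t g' g

variable {b t : D.Crossing}

theorem BigonSource.not_target {g : D.Gen} (h : BigonSource b t g) : ¬ BigonTarget b t g := by
  intro h'
  have h1 := h.2 h'.1
  rw [h'.2 h.1] at h1
  exact absurd h1 (by decide)

theorem source_or_target {g : D.Gen} (h : ¬ (g.1 b = false ∧ g.1 t = true)) :
    BigonSource b t g ∨ BigonTarget b t g := by
  rw [BigonSource, BigonTarget]
  revert h
  cases g.1 b <;> cases g.1 t <;> cases label g (half b 1) <;> simp

theorem bigonHomotopy_mem (m : D.Chain) : bigonHomotopy b t m ∈ supportedIn (BigonSource b t) :=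
  linOfRel_mem_supportedIn (fun _ _ _ h => h.1) (mem_supportedIn_true m)

theorem bigonHomotopy_eq_zero {m : D.Chain} (h : m ∈ supportedIn fun g => ¬ BigonTarget b t g) :
    bigonHomotopy b t m = 0 :=
  linOfRel_eq_zero (fun _ _ h h' => h h'.2.1) h

theorem bigonHomotopy_bigonHomotopy (m : D.Chain) :
    bigonHomotopy b t (bigonHomotopy b t m) = 0 :=
  bigonHomotopy_eq_zero (supportedIn_mono (fun _ h => h.not_target) (bigonHomotopy_mem m))

theorem bigonHomotopy_homDeg : HomogMap D.homDeg D.homDeg (-1) (bigonHomotopy b t) :=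
  homogMap_linOfRel fun g g' h => by
    have := total_homDeg h.2.2
    omega

theorem dZero_eq_linOfRel :
    D.dZero = D.linOfRel fun g g' => (∃ x, TotalEdge x g g') ∧ weight g' = weight g + 0 := by
  rw [dZero_eq, total, component_linOfRel]

namespace Bigon

variable (hB : Bigon b t)
include hB

open Classical in
theorem bigonHomotopy_single {g g' : D.Gen} (h : BigonEdge b t g g') :
    bigonHomotopy b t (Pi.single g' 1) = Pi.single g 1 :=
  linOfRel_single_of_unique fun g'' =>
    ⟨fun h' => hB.bigonEdge_unique' h' h, by rintro rfl; exact h⟩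

open Classical in
theorem bigonOp_single {g g' : D.Gen} (h : BigonEdge b t g g') :
    bigonOp b t (Pi.single g 1) = Pi.single g' 1 :=
  linOfRel_single_of_unique fun g'' =>
    ⟨fun h' => hB.bigonEdge_unique h' h, by rintro rfl; exact h⟩

open Classical in
-- A source is recovered by going along its matching edge and back, a target by going back and
-- forth; generators in the copy of the old complex are unmatched.
theorem bigon_anticommutator_single (g : D.Gen) :
    bigonOp b t (bigonHomotopy b t (Pi.single g 1)) + bigonHomotopy b t (bigonOp b t (Pi.single g 1)) =
      if g.1 b = false ∧ g.1 t = true then 0 else Pi.single g 1 := by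
  have h1 (h : ¬ BigonTarget b t g) : bigonHomotopy b t (Pi.single g 1) = 0 :=
    linOfRel_single_of_not fun g' h' => h h'.2.1
  have h2 (h : ¬ BigonSource b t g) : bigonOp b t (Pi.single g 1) = 0 :=
    linOfRel_single_of_not fun g' h' => h h'.1
  split_ifs with h
  · rw [h1, h2, map_zero, map_zero, add_zero]
    · exact fun h' => absurd (h.2.symm.trans h'.1) (by decide)
    · exact fun h' => absurd (h.1.symm.trans h'.1) (by decide)
  · rcases source_or_target h with h' | h'
    · obtain ⟨g', hg'⟩ := hB.exists_bigonEdge h'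
      rw [h1 h'.not_target, map_zero, zero_add, hB.bigonOp_single hg', hB.bigonHomotopy_single hg']
    · obtain ⟨g', hg'⟩ := hB.exists_bigonEdge' h'
      rw [h2 fun h'' => h''.not_target h', map_zero, add_zero, hB.bigonHomotopy_single hg',
        hB.bigonOp_single hg']

theorem bigonHomotopy_bigonOp_bigonHomotopy (m : D.Chain) :
    bigonHomotopy b t (bigonOp b t (bigonHomotopy b t m)) = bigonHomotopy b t m := by
  classical
  have h : bigonHomotopy b t * bigonOp b t * bigonHomotopy b t = bigonHomotopy b t := by
    refine end_ext fun g => ?_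
    rw [Module.End.mul_apply, Module.End.mul_apply]
    by_cases h : BigonTarget b t g
    · obtain ⟨g', hg'⟩ := hB.exists_bigonEdge' h
      rw [hB.bigonHomotopy_single hg', hB.bigonOp_single hg', hB.bigonHomotopy_single hg']
    · rw [show bigonHomotopy b t (Pi.single g 1) = 0 from
        linOfRel_single_of_not fun g' h' => h h'.2.1, map_zero, map_zero]
  exact LinearMap.congr_fun h m

/-- `H` ends in sources and starts at targets, and an edge from a source to a target is a matching
edge. So only the cancelled part of `∂₀` contributes between two homotopies. -/
theorem bigonHomotopy_dZero_bigonHomotopy (m : D.Chain) :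
    bigonHomotopy b t (D.dZero (bigonHomotopy b t m)) = bigonHomotopy b t m := by
  classical
  have h : D.dZero = bigonOp b t + D.linOfRel fun g g' =>
      ((∃ x, TotalEdge x g g') ∧ weight g' = weight g + 0) ∧ ¬ BigonEdge b t g g' := by
    rw [dZero_eq_linOfRel, bigonOp]
    refine end_ext fun g => ?_
    ext g'
    rw [LinearMap.add_apply, Pi.add_apply, linOfRel_single, linOfRel_single, linOfRel_single]
    by_cases h : BigonEdge b t g g'
    · have h1 : (∃ x, TotalEdge x g g') ∧ weight g' = weight g + 0 :=
        ⟨h.2.2, by rw [hB.bigonEdge_weight h, add_zero]⟩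
      simp only [h, h1, not_true, and_false, if_true, if_false, and_self, add_zero]
    · simp only [h, not_false_eq_true, and_true, if_false, zero_add]
      congr
  rw [h, LinearMap.add_apply, map_add, hB.bigonHomotopy_bigonOp_bigonHomotopy,
    bigonHomotopy_eq_zero (linOfRel_mem_supportedIn
      (fun g g' hg h hg' => h.2 ⟨hg, hg', h.1.1⟩) (bigonHomotopy_mem m)), add_zero]

end Bigon

/-- The circle inside the disk is present and has the label `+`. -/
def BigonPlus (b t : D.Crossing) (g : D.Gen) : Prop :=
  g.1 b = true ∧ g.1 t = false ∧ label g (half b 1) = true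

/-- The circle inside the disk, if it is present, has the label `+`. -/
def BigonNotMinus (b t : D.Crossing) (g : D.Gen) : Prop :=
  g.1 b = true → g.1 t = false → label g (half b 1) = true

/-- The operator preserves the subspaces that control the homotopy. -/
def PreservesBigon (b t : D.Crossing) (A : Module.End F2 D.Chain) : Prop :=
  (∀ m ∈ supportedIn (BigonPlus b t), A m ∈ supportedIn (BigonPlus b t)) ∧
    ∀ m ∈ supportedIn (BigonNotMinus b t), A m ∈ supportedIn (BigonNotMinus b t)

namespace PreservesBigon

variable {A B : Module.End F2 D.Chain}

theorem add (hA : PreservesBigon b t A) (hB : PreservesBigon b t B) : PreservesBigon b t (A + B) :=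
  ⟨fun m hm => Submodule.add_mem _ (hA.1 m hm) (hB.1 m hm),
    fun m hm => Submodule.add_mem _ (hA.2 m hm) (hB.2 m hm)⟩

theorem mul (hA : PreservesBigon b t A) (hB : PreservesBigon b t B) : PreservesBigon b t (A * B) :=
  ⟨fun m hm => hA.1 _ (hB.1 m hm), fun m hm => hA.2 _ (hB.2 m hm)⟩

theorem smul_one (c : F2) : PreservesBigon b t (c • (1 : Module.End F2 D.Chain)) :=
  ⟨fun _ hm => Submodule.smul_mem _ c hm, fun _ hm => Submodule.smul_mem _ c hm⟩

end PreservesBigon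

namespace Bigon

variable (hB : Bigon b t)
include hB

/-- Leaving one of the two subspaces would mean passing from a source of the matching to a target,
and all such edges have weight zero. This is why `d` is the only exception. -/
theorem preservesBigon_component_total {d : ℤ} (hd : d ≠ 0) :
    PreservesBigon b t (component weight d D.total) := by
  rw [total, component_linOfRel]
  have key {g g' : D.Gen} (h : (∃ x, TotalEdge x g g') ∧ weight g' = weight g + d)
      (h1 : BigonSource b t g) (h2 : BigonTarget b t g') : False := by
    have := hB.bigonEdge_weight ⟨h1, h2, h.1⟩
    omega
  constructor
  · refine fun m => linOfRel_mem_supportedIn fun g g' hg h => ?_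
    have ⟨x, hx⟩ := h.1
    have hb := hx.not_of_true hg.1
    have ht : g'.1 t = false := by
      by_contra ht
      exact key h ⟨hg.2.1, fun _ => hg.2.2⟩ ⟨hb, fun h' => absurd h' ht⟩
    refine ⟨hb, ht, ?_⟩
    rw [hB.label_inner hx ?_ ?_ hg.1 hg.2.1, hg.2.2]
    · rintro rfl
      have := hx.1
      rw [hg.1] at this
      exact absurd this (by decide)
    · rintro rfl
      have := hx.2.1.1
      rw [ht, hg.2.1] at this
      exact absurd this (by decide)
  · refine fun m => linOfRel_mem_supportedIn fun g g' hg h hb ht => ?_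
    have ⟨x, hx⟩ := h.1
    by_contra hl
    have ht' : g.1 t = false := by
      by_contra h'
      have := hx.not_of_true (y := t) (by simpa using h')
      rw [ht] at this
      exact absurd this (by decide)
    exact key h ⟨ht', fun hb' => hg hb' ht'⟩ ⟨hb, fun _ => by simpa using hl⟩

/-- Only nontrivial circles are relabelled, and the small circle is trivial because the arc misses
the disk. -/
theorem preservesBigon_component_labelOp (d : ℤ) :
    PreservesBigon b t (component weight d D.labelOp) := by
  rw [labelOp_eq, component_linOfRel]
  have key {g : D.Gen} {a : D.Half} (ha : D.Nontrivial (D.circ g.1 a)) (hb : g.1 b = true)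
      (ht : g.1 t = false) : label (toggle a g) (half b 1) = label g (half b 1) := by
    rw [label_toggle, sameCircle_of_ne, Bool.xor_false]
    intro h
    rw [nontrivial_iff, ← h, hB.parity_inner hb ht (.inl rfl)] at ha
    exact absurd ha (by decide)
  constructor
  · refine fun m => linOfRel_mem_supportedIn ?_
    rintro g _ hg ⟨⟨a, ha, rfl⟩, -⟩
    exact ⟨hg.1, hg.2.1, by rw [key ha hg.1 hg.2.1, hg.2.2]⟩
  · refine fun m => linOfRel_mem_supportedIn ?_
    rintro g _ hg ⟨⟨a, ha, rfl⟩, -⟩ hb ht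
    rw [key ha hb ht, hg hb ht]

theorem preservesBigon_act {c : SlBasis} (hc : c ≠ .d) : PreservesBigon b t (D.act c) := by
  have he : PreservesBigon b t D.actE := actE_eq (D := D) ▸ hB.preservesBigon_component_labelOp _
  have hf : PreservesBigon b t D.actF := actF_eq (D := D) ▸ hB.preservesBigon_component_labelOp _
  have hh : PreservesBigon b t D.actH := actH_eq (D := D) ▸ PreservesBigon.smul_one _
  have hp : PreservesBigon b t D.leePlus :=
    leePlus_eq (D := D) ▸ hB.preservesBigon_component_total (by decide)
  have hm : PreservesBigon b t D.dMinus :=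
    dMinus_eq (D := D) ▸ hB.preservesBigon_component_total (by decide)
  have hl : PreservesBigon b t D.leeZero :=
    leeZero_eq (D := D) ▸ hB.preservesBigon_component_total (by decide)
  have hv : PreservesBigon b t (D.actE * D.dMinus - D.dMinus * D.actE) := by
    rw [ZModModule.sub_eq_add]
    exact (he.mul hm).add (hm.mul he)
  cases c
  exacts [he, hf, hh, hp, hm, hv, absurd rfl hc, hl, (hp.mul hm).add (hm.mul hp)]

end Bigon

end AnnularDiagram

/-! # The second Reidemeister move -/

namespace AnnularDiagram

variable {D D' : AnnularDiagram} (eX : D'.Crossing ≃ D.Crossing ⊕ Bool)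
  (eM : D.Marker ≃ D'.Marker ⊕ Bool)

/-- A left inverse of `outer`. -/
def inward : D'.Half → D.Half
  | .inl (y, k) =>
    match eX y with
    | .inl x => .inl (x, k)
    -- The decision is `false` on the left strand, which carries the numbers 2, 3 at the bottom
    -- crossing and 0, 3 at the top one.
    | .inr s => .inr (eM.symm (.inr (decide (k ≠ 3 ∧ k ≠ if s then 0 else 2))), s)
  | .inr (q, s) => .inr (eM.symm (.inl q), s)

theorem inward_inl {y : D'.Crossing} {x : D.Crossing} (h : eX y = .inl x) (k : ZMod 4) :
    inward eX eM (.inl (y, k)) = .inl (x, k) := by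
  simp only [inward, h]

theorem inward_inr {y : D'.Crossing} {s : Bool} (h : eX y = .inr s) (k : ZMod 4) :
    inward eX eM (.inl (y, k)) =
      .inr (eM.symm (.inr (decide (k ≠ 3 ∧ k ≠ if s then 0 else 2))), s) := by
  simp only [inward, h]

theorem outer_inl (x : D.Crossing) (k : ZMod 4) :
    outer eX eM (.inl (x, k)) = .inl (eX.symm (.inl x), k) := rfl

theorem outer_inr {p : D.Marker} {q : D'.Marker} (h : eM p = .inl q) (s : Bool) :
    outer eX eM (.inr (p, s)) = .inr (q, s) := by
  simp only [outer, h]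

theorem outer_left (s : Bool) :
    outer eX eM (.inr (eM.symm (.inr false), s)) = .inl (eX.symm (.inr s), 3) := by
  cases s <;> simp [outer]

theorem outer_right (s : Bool) :
    outer eX eM (.inr (eM.symm (.inr true), s)) = .inl (eX.symm (.inr s), if s then 2 else 0) := by
  cases s <;> simp [outer]

theorem inward_outer (a : D.Half) : inward eX eM (outer eX eM a) = a := by
  rcases a with ⟨x, k⟩ | ⟨p, s⟩
  · rw [outer_inl, inward_inl eX eM (eX.apply_symm_apply _)]
  · obtain ⟨m, rfl⟩ := eM.symm.surjective p
    rcases m with q | r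
    · rw [outer_inr eX eM (eM.apply_symm_apply _)]
      rfl
    · cases r
      · rw [outer_left, inward_inr eX eM (eX.apply_symm_apply _)]
        rfl
      · rw [outer_right, inward_inr eX eM (eX.apply_symm_apply _)]
        cases s <;> rfl

theorem outer_inward (a : D'.Half) : outer eX eM (inward eX eM a) = a ∨
    Inner (eX.symm (.inr false)) (eX.symm (.inr true)) a := by
  rcases a with ⟨y, k⟩ | ⟨q, s⟩
  · obtain ⟨x, rfl⟩ := eX.symm.surjective y
    rcases x with x | s
    · left; rw [inward_inl eX eM (eX.apply_symm_apply _), outer_inl]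
    · rw [inward_inr eX eM (eX.apply_symm_apply _)]
      cases s
      · obtain rfl | rfl | rfl | rfl := zmod4_cases k
        · exact .inl (outer_right eX eM _)
        · exact .inr (.inl rfl)
        · exact .inr (.inr (.inl rfl))
        · exact .inl (outer_left eX eM _)
      · obtain rfl | rfl | rfl | rfl := zmod4_cases k
        · exact .inr (.inr (.inr (.inl rfl)))
        · exact .inr (.inr (.inr (.inr rfl)))
        · exact .inl (outer_right eX eM _)
        · exact .inl (outer_left eX eM _)
  · exact .inl (outer_inr eX eM (eM.apply_symm_apply _) s)

/-- The state of `D'` that corresponds to a state of `D`. -/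
def extendState (v : D.State) : D'.State := fun y => Sum.elim v id (eX y)

theorem extendState_outer (v : D.State) (x : D.Crossing) :
    extendState eX v (eX.symm (.inl x)) = v x := by simp [extendState]

/-- The name of a new crossing doubles as its resolution: 0 at the bottom and 1 at the top, which
restores the two vertical strands. -/
theorem extendState_inner (v : D.State) (s : Bool) : extendState eX v (eX.symm (.inr s)) = s := by
  simp [extendState]

theorem smooth_outer_inl (v : D.State) (x : D.Crossing) (k : ZMod 4) :
    D'.smooth (extendState eX v) (.inl (eX.symm (.inl x), k)) =
      outer eX eM (D.smooth v (.inl (x, k))) := by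
  simp only [smooth, extendState_outer]
  rfl

theorem circ_inward_smooth (v : D.State) (a : D'.Half) :
    D.circ v (inward eX eM (D'.smooth (extendState eX v) a)) = D.circ v (inward eX eM a) := by
  rcases a with ⟨y, k⟩ | ⟨q, s⟩
  · obtain ⟨x, rfl⟩ := eX.symm.surjective y
    rcases x with x | s
    · rw [smooth_outer_inl eX eM, inward_outer, inward_inl eX eM (eX.apply_symm_apply _), circ_smooth]
    -- At a new crossing the chosen smoothing joins half-edges of the same strand, which `inward`
    -- does not distinguish.
    · congr 1
      have h := extendState_inner eX v s
      simp only [smooth, h]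
      rw [inward_inr eX eM (eX.apply_symm_apply _), inward_inr eX eM (eX.apply_symm_apply _)]
      cases s <;> obtain rfl | rfl | rfl | rfl := zmod4_cases k <;> rfl
  · exact circ_smooth v (.inr (eM.symm (.inl q), s))

theorem flip_extendState (v w : D.State) (x : D.Crossing) :
    Flip (eX.symm (.inl x)) (extendState eX v) (extendState eX w) ↔ Flip x v w := by
  rw [Flip, Flip, extendState_outer, extendState_outer]
  refine and_congr_right fun _ => ⟨fun h y hy => ?_, fun h y hy => ?_⟩
  · have := h (eX.symm (.inl y)) (by simpa using hy)
    rwa [extendState_outer, extendState_outer] at this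
  · obtain ⟨z, rfl⟩ := eX.symm.surjective y
    rcases z with z | s
    · rw [extendState_outer, extendState_outer, h z (by simpa using hy)]
    · rw [extendState_inner, extendState_inner]

theorem sum_outer {A : Type*} [AddCommMonoid A] (f : D'.Half → A)
    (hf : ∀ a, Inner (eX.symm (.inr false)) (eX.symm (.inr true)) a → f a = 0) :
    ∑ a, f a = ∑ a, f (outer eX eM a) := by
  symm
  refine Finset.sum_of_injOn (outer eX eM)
    ((Function.LeftInverse.injective (inward_outer eX eM)).injOn) (by simp) (fun a _ ha => ?_)
    fun _ _ => rfl
  refine hf a ((outer_inward eX eM a).resolve_left fun h => ha ?_)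
  exact ⟨_, by simp, h⟩

theorem card_subtype_eq (p : D'.Crossing → Prop) :
    Nat.card {y // p y} = Nat.card {x // p (eX.symm (.inl x))} +
      Nat.card {s // p (eX.symm (.inr s))} := by
  have e : {y // p y} ≃ {z // p (eX.symm z)} :=
    eX.subtypeEquiv fun y => by rw [eX.symm_apply_apply]
  rw [Nat.card_congr (e.trans Equiv.subtypeSum), Nat.card_sum]

theorem ones_extendState (v : D.State) : ones (extendState eX v) = ones v + 1 := by
  rw [ones, ones, card_subtype_eq eX]
  simp only [extendState_outer, extendState_inner]
  simp

theorem circ_outer_inward (v : D.State) (a : D'.Half) :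
    D'.circ (extendState eX v) (outer eX eM (inward eX eM a)) = D'.circ (extendState eX v) a := by
  rcases outer_inward eX eM a with h | h
  · rw [h]
  · have h1 := circ_false (extendState_inner eX v false)
    have h2 := circ_true (extendState_inner eX v true)
    have e (s : Bool) (k : ZMod 4) := inward_inr eX eM (eX.apply_symm_apply (.inr s)) k
    have l (s : Bool) := outer_left eX eM s
    have r (s : Bool) := outer_right eX eM s
    rcases h with rfl | rfl | rfl | rfl
    · rw [e]; exact (congrArg _ (r _)).trans h1.1.symm
    · rw [e]; exact (congrArg _ (l _)).trans h1.2
    · rw [e]; exact (congrArg _ (l _)).trans h2.2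
    · rw [e]; exact (congrArg _ (r _)).trans h2.1.symm

/-- The conditions of the second Reidemeister move. -/
structure IsReidemeisterII : Prop where
  opp : ∀ a, D'.opp (outer eX eM a) = outer eX eM (D.opp a)
  out : ∀ a, D'.out (outer eX eM a) = D.out a
  cut : ∀ a, D'.cut (outer eX eM a) = D.cut a
  bigon : Bigon (eX.symm (.inr false)) (eX.symm (.inr true))

namespace IsReidemeisterII

variable {eX eM} (hR : IsReidemeisterII eX eM)
include hR

theorem circ_inward_opp (v : D.State) (a : D'.Half) :
    D.circ v (inward eX eM (D'.opp a)) = D.circ v (inward eX eM a) := by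
  have key (v : D.State) (p : D.Marker) : D.circ v (.inr (p, false)) = D.circ v (.inr (p, true)) :=
    circ_smooth v (.inr (p, true))
  rcases outer_inward eX eM a with h | h
  · rw [← h, hR.opp, inward_outer, inward_outer, circ_opp]
  · have h1 := hR.bigon.opp_one
    have h2 := hR.bigon.opp_two
    have h3 : D'.opp (half (eX.symm (.inr true)) 1) = half (eX.symm (.inr false)) 1 := by
      rw [← h1, D'.opp_opp]
    have h4 : D'.opp (half (eX.symm (.inr true)) 0) = half (eX.symm (.inr false)) 2 := by
      rw [← h2, D'.opp_opp]
    have e (s : Bool) (k : ZMod 4) := inward_inr eX eM (eX.apply_symm_apply (.inr s)) k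
    rcases h with rfl | rfl | rfl | rfl
    · rw [h1, e, e]; exact (key _ _).symm
    · rw [h2, e, e]; exact (key _ _).symm
    · rw [h4, e, e]; exact key _ _
    · rw [h3, e, e]; exact key _ _

theorem circ_strand (v : D.State) (r : Bool) :
    D'.circ (extendState eX v) (outer eX eM (.inr (eM.symm (.inr r), false))) =
      D'.circ (extendState eX v) (outer eX eM (.inr (eM.symm (.inr r), true))) := by
  have h1 := circ_false (extendState_inner eX v false)
  have h2 := circ_true (extendState_inner eX v true)
  have h3 := hR.bigon.circ_one (extendState eX v)
  have h4 := hR.bigon.circ_two (extendState eX v)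
  cases r
  · rw [outer_left, outer_left]
    exact h1.2.trans (h4.trans h2.2.symm)
  · rw [outer_right, outer_right]
    exact h1.1.symm.trans (h3.trans h2.1)

theorem circ_outer_smooth (v : D.State) (a : D.Half) :
    D'.circ (extendState eX v) (outer eX eM (D.smooth v a)) =
      D'.circ (extendState eX v) (outer eX eM a) := by
  rcases a with ⟨x, k⟩ | ⟨p, s⟩
  · rw [← smooth_outer_inl, circ_smooth, outer_inl]
  · obtain ⟨m, rfl⟩ := eM.symm.surjective p
    rcases m with q | r
    · have h := outer_inr eX eM (eM.apply_symm_apply (.inl q))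
      rw [h]
      change D'.circ _ (outer eX eM (.inr (eM.symm (.inl q), !s))) = _
      rw [h]
      exact circ_smooth _ (.inr (q, s))
    · cases s
      exacts [(hR.circ_strand v r).symm, hR.circ_strand v r]

/-- Both `inward` and `outer` respect circles, and they are mutually inverse up to moving along a
circle. -/
theorem circ_extendState_iff (v : D.State) (a c : D'.Half) :
    D'.circ (extendState eX v) a = D'.circ (extendState eX v) c ↔
      D.circ v (inward eX eM a) = D.circ v (inward eX eM c) := by
  constructor
  · exact eq_of_circ_eq (fun a => D.circ v (inward eX eM a)) (hR.circ_inward_opp v)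
      (circ_inward_smooth eX eM v)
  · intro h
    rw [← circ_outer_inward eX eM v a, ← circ_outer_inward eX eM v c]
    refine eq_of_circ_eq (fun a => D'.circ (extendState eX v) (outer eX eM a)) (fun a => ?_)
      (hR.circ_outer_smooth v) h
    rw [← hR.opp, circ_opp]

/-- The generator of `D'` that corresponds to a generator of `D`. -/
def extendGen (g : D.Gen) : D'.Gen :=
  mkGen (extendState eX g.1) (fun a => label g (inward eX eM a))
    (fun a => label_congr (hR.circ_inward_opp g.1 a))
    (fun a => label_congr (circ_inward_smooth eX eM g.1 a))

theorem label_extendGen (g : D.Gen) (a : D'.Half) :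
    label (hR.extendGen g) a = label g (inward eX eM a) := rfl

theorem label_extendGen_outer (g : D.Gen) (a : D.Half) :
    label (hR.extendGen g) (outer eX eM a) = label g a := by
  rw [label_extendGen, inward_outer]

theorem extendGen_fst (g : D.Gen) : (hR.extendGen g).1 = extendState eX g.1 := rfl

theorem extendGen_injective : Function.Injective hR.extendGen := by
  intro g g' h
  refine gen_ext (funext fun x => ?_) fun a => ?_
  · have := congrFun (congrArg Sigma.fst h) (eX.symm (.inl x))
    rwa [extendGen_fst, extendGen_fst, extendState_outer, extendState_outer] at this
  · rw [← hR.label_extendGen_outer, h, hR.label_extendGen_outer]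

theorem exists_extendGen {g : D'.Gen} (hb : g.1 (eX.symm (.inr false)) = false)
    (ht : g.1 (eX.symm (.inr true)) = true) : ∃ g', hR.extendGen g' = g := by
  obtain ⟨w, l⟩ := g
  obtain ⟨v, rfl⟩ : ∃ v, extendState eX v = w := by
    refine ⟨fun x => w (eX.symm (.inl x)), funext fun y => ?_⟩
    obtain ⟨x, rfl⟩ := eX.symm.surjective y
    rcases x with x | s
    · rw [extendState_outer]
    · rw [extendState_inner]
      cases s
      exacts [hb.symm, ht.symm]
  refine ⟨mkGen v (fun a => l (D'.circ _ (outer eX eM a))) (fun a => congrArg l ?_)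
    (fun a => congrArg l (hR.circ_outer_smooth v a)), ?_⟩
  · rw [← hR.opp, circ_opp]
  · refine gen_ext rfl fun a => ?_
    exact congrArg l (circ_outer_inward eX eM v a)

theorem toggle_extendGen (a : D.Half) (g : D.Gen) :
    toggle (outer eX eM a) (hR.extendGen g) = hR.extendGen (toggle a g) := by
  refine gen_ext rfl fun c => ?_
  rw [label_toggle, label_extendGen, label_extendGen, label_toggle]
  congr 1
  have := hR.circ_extendState_iff g.1 c (outer eX eM a)
  rw [inward_outer] at this
  exact decide_eq_decide.2 this

theorem touches_extendGen (v : D.State) (x : D.Crossing) (a : D'.Half) :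
    Touches (extendState eX v) (eX.symm (.inl x)) a ↔ Touches v x (inward eX eM a) := by
  rw [Touches, Touches, hR.circ_extendState_iff, hR.circ_extendState_iff,
    inward_inl eX eM (eX.apply_symm_apply _), inward_inl eX eM (eX.apply_symm_apply _)]

theorem totalEdge_extendGen (x : D.Crossing) (g g' : D.Gen) :
    TotalEdge (eX.symm (.inl x)) (hR.extendGen g) (hR.extendGen g') ↔ TotalEdge x g g' := by
  have hl (g : D.Gen) (k : ZMod 4) :
      label (hR.extendGen g) (half (eX.symm (.inl x)) k) = label g (half x k) :=
    hR.label_extendGen_outer g (half x k)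
  have hc : D'.circ (hR.extendGen g).1 (half (eX.symm (.inl x)) 0) =
      D'.circ (hR.extendGen g).1 (half (eX.symm (.inl x)) 2) ↔
      D.circ g.1 (half x 0) = D.circ g.1 (half x 2) := by
    rw [extendGen_fst, hR.circ_extendState_iff, inward_inl eX eM (eX.apply_symm_apply _),
      inward_inl eX eM (eX.apply_symm_apply _)]
  rw [TotalEdge, TotalEdge, hl, hl, hl, hl, ne_eq, hc, extendGen_fst, extendGen_fst,
    extendState_outer, flip_extendState]
  refine and_congr_right fun _ => and_congr_right fun _ => and_congr_left fun _ => ?_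
  simp only [hR.touches_extendGen, label_extendGen]
  refine ⟨fun h a ha => ?_, fun h a ha => h _ ha⟩
  have := h (outer eX eM a)
  rw [inward_outer] at this
  exact this ha

theorem exists_totalEdge_extendGen (g g' : D.Gen) :
    (∃ x, TotalEdge x (hR.extendGen g) (hR.extendGen g')) ↔ ∃ x, TotalEdge x g g' := by
  constructor
  · rintro ⟨y, hy⟩
    obtain ⟨z, rfl⟩ := eX.symm.surjective y
    rcases z with x | s
    · exact ⟨x, (hR.totalEdge_extendGen x g g').1 hy⟩
    · have := hy.2.1.1
      rw [extendGen_fst, extendGen_fst, extendState_inner, extendState_inner] at this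
      exact absurd this (by cases s <;> decide)
  · rintro ⟨x, hx⟩
    exact ⟨_, (hR.totalEdge_extendGen x g g').2 hx⟩

/-! ### Parities and gradings under the move. -/

theorem parity_outer (v : D.State) (a : D.Half) :
    parity (D'.circ (extendState eX v) (outer eX eM a)) = parity (D.circ v a) := by
  classical
  rw [parity_eq_sum, parity_eq_sum, sum_outer eX eM]
  · refine Finset.sum_congr rfl fun c _ => ?_
    have := hR.circ_extendState_iff v (outer eX eM c) (outer eX eM a)
    rw [inward_outer, inward_outer] at this
    simp only [this, hR.cut]
  · intro c hc
    rw [hR.bigon.cut_inner hc, ite_self]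

theorem totalCut_eq : D'.totalCut = D.totalCut := by
  rw [totalCut, totalCut, sum_outer eX eM]
  · exact Finset.sum_congr rfl fun a _ => hR.cut a
  · intro c hc
    exact hR.bigon.cut_inner hc

theorem circSum_extendGen (φ : F2 → Bool → ℤ) (g : D.Gen) :
    circSum φ (hR.extendGen g) = circSum φ g := by
  let m : D.Circle g.1 → D'.Circle (hR.extendGen g).1 :=
    Quot.lift (fun a => D'.circ (hR.extendGen g).1 (outer eX eM a)) (by
      intro a c hac
      refine (hR.circ_extendState_iff g.1 _ _).2 ?_
      rw [inward_outer, inward_outer]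
      exact Quot.sound hac)
  let _ := @fintypeCircle D
  let _ := @fintypeCircle D'
  symm
  refine Fintype.sum_bijective m ⟨?_, ?_⟩ _ _ ?_
  · rintro ⟨a⟩ ⟨c⟩ hac
    have := (hR.circ_extendState_iff g.1 _ _).1 hac
    rwa [inward_outer, inward_outer] at this
  · rintro ⟨a⟩
    exact ⟨D.circ g.1 (inward eX eM a), circ_outer_inward eX eM g.1 a⟩
  · rintro ⟨a⟩
    exact congrArg₂ φ (hR.parity_outer g.1 a).symm (hR.label_extendGen_outer g a).symm

/-- The shift by 5 is the 1-resolution of the top crossing. Being uniform, it does not affect the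
degrees of operators. -/
theorem weight_extendGen (g : D.Gen) : weight (hR.extendGen g) = weight g + 5 := by
  rw [weight, weight, hR.circSum_extendGen, extendGen_fst, ones_extendState]
  push_cast
  ring

/-- The two strands cross twice with opposite signs. In the homological degree this compensates the
additional 1-resolution. -/
theorem negCrossings_eq : D'.negCrossings = D.negCrossings + 1 := by
  rw [negCrossings, negCrossings, card_subtype_eq eX]
  congr 1
  · have h (x : D.Crossing) (k : ZMod 4) : D'.out (.inl (eX.symm (.inl x), k)) = D.out (.inl (x, k)) :=
      hR.out (.inl (x, k))
    simp only [h]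
  · have h1 : D'.out (half (eX.symm (.inr false)) 0) = D.out (.inr (eM.symm (.inr true), false)) := by
      have := hR.out (.inr (eM.symm (.inr true), false))
      rwa [outer_right] at this
    have h2 : D'.out (half (eX.symm (.inr true)) 2) = D.out (.inr (eM.symm (.inr true), true)) := by
      have := hR.out (.inr (eM.symm (.inr true), true))
      rwa [outer_right] at this
    have h3 := D.out_marker (eM.symm (.inr true)) false
    have h4 : D'.out (half (eX.symm (.inr true)) 2) = !D'.out (half (eX.symm (.inr true)) 0) :=
      D'.out_crossing (eX.symm (.inr true)) 0
    have h5 := D'.out_opp (half (eX.symm (.inr false)) 1)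
    rw [hR.bigon.opp_one] at h5
    have h6 (s : Bool) : D'.out (half (eX.symm (.inr s)) 0) = D'.out (half (eX.symm (.inr s)) 1) ↔
        s = decide (D'.out (half (eX.symm (.inr false)) 0) ≠ D'.out (half (eX.symm (.inr false)) 1)) := by
      have h3' : D.out (.inr (eM.symm (.inr true), true)) = _ := h3
      rw [← h1, ← h2] at h3'
      cases s
      · simp
      · rw [h5]
        revert h4 h3'
        generalize D'.out (half (eX.symm (.inr true)) 0) = p
        generalize D'.out (half (eX.symm (.inr true)) 2) = q
        generalize D'.out (half (eX.symm (.inr false)) 0) = r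
        generalize D'.out (half (eX.symm (.inr false)) 1) = u
        revert p q r u
        decide
    simp only [h6]
    simp

theorem homDeg_extendGen (g : D.Gen) : D'.homDeg (hR.extendGen g) = D.homDeg g := by
  rw [homDeg_eq, homDeg_eq, extendGen_fst, ones_extendState, hR.negCrossings_eq]
  push_cast
  ring

end IsReidemeisterII

end AnnularDiagram

/-! # Invariance -/

namespace AnnularDiagram

variable {D D' : AnnularDiagram} {eX : D'.Crossing ≃ D.Crossing ⊕ Bool}
  {eM : D.Marker ≃ D'.Marker ⊕ Bool}

namespace IsReidemeisterII

variable (hR : IsReidemeisterII eX eM)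

/-- The inclusion of chains of `D` into chains of `D'`. -/
noncomputable def inclusion : D.Chain →ₗ[F2] D'.Chain :=
  Function.ExtendByZero.linearMap F2 hR.extendGen

/-- The projection of chains of `D'` onto chains of `D`. -/
noncomputable def projection : D'.Chain →ₗ[F2] D.Chain := LinearMap.funLeft F2 F2 hR.extendGen

theorem projection_apply (m : D'.Chain) (g : D.Gen) : hR.projection m g = m (hR.extendGen g) := rfl

theorem inclusion_extendGen (m : D.Chain) (g : D.Gen) : hR.inclusion m (hR.extendGen g) = m g :=
  hR.extendGen_injective.extend_apply m (0 : D'.Gen → F2) g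

theorem inclusion_of_not {g : D'.Gen}
    (h : ¬ (g.1 (eX.symm (.inr false)) = false ∧ g.1 (eX.symm (.inr true)) = true)) (m : D.Chain) :
    hR.inclusion m g = 0 := by
  refine Function.extend_apply' m (0 : D'.Gen → F2) g ?_
  rintro ⟨g', rfl⟩
  exact h ⟨extendState_inner eX _ _, extendState_inner eX _ _⟩

theorem projection_inclusion (m : D.Chain) : hR.projection (hR.inclusion m) = m :=
  funext fun g => hR.inclusion_extendGen m g

theorem inclusion_projection (m : D'.Chain) (g : D'.Gen) : hR.inclusion (hR.projection m) g =
    if g.1 (eX.symm (.inr false)) = false ∧ g.1 (eX.symm (.inr true)) = true then m g else 0 := by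
  split_ifs with h
  · obtain ⟨g, rfl⟩ := hR.exists_extendGen h.1 h.2
    rw [inclusion_extendGen, projection_apply]
  · exact hR.inclusion_of_not h _

open Classical in
theorem inclusion_single (g : D.Gen) :
    hR.inclusion (Pi.single g 1) = Pi.single (hR.extendGen g) 1 := by
  ext g'
  by_cases h : g'.1 (eX.symm (.inr false)) = false ∧ g'.1 (eX.symm (.inr true)) = true
  · obtain ⟨g', rfl⟩ := hR.exists_extendGen h.1 h.2
    rw [inclusion_extendGen, Pi.single_apply, Pi.single_apply]
    simp only [hR.extendGen_injective.eq_iff]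
  · rw [hR.inclusion_of_not h, Pi.single_apply, if_neg]
    rintro rfl
    exact h ⟨extendState_inner eX _ _, extendState_inner eX _ _⟩

theorem inclusion_mem (m : D.Chain) : hR.inclusion m ∈ supportedIn fun g =>
    g.1 (eX.symm (.inr false)) = false ∧ g.1 (eX.symm (.inr true)) = true := by
  intro g hg
  by_contra h
  exact hg (hR.inclusion_of_not h m)

theorem projection_eq_zero {m : D'.Chain} (h : m ∈ supportedIn fun g =>
    ¬ (g.1 (eX.symm (.inr false)) = false ∧ g.1 (eX.symm (.inr true)) = true)) :
    hR.projection m = 0 := by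
  ext g
  by_contra hg
  exact h _ hg ⟨extendState_inner eX _ _, extendState_inner eX _ _⟩

/-- The operator `A` on the chains of `D` is a corner of the operator `A'` on the chains of `D'`. -/
def IsCorner (A : Module.End F2 D.Chain) (A' : Module.End F2 D'.Chain) : Prop :=
  ∀ m, hR.projection (A' (hR.inclusion m)) = A m

open Classical in
theorem isCorner_iff {A : Module.End F2 D.Chain} {A' : Module.End F2 D'.Chain} :
    hR.IsCorner A A' ↔ ∀ g g', A' (Pi.single (hR.extendGen g) 1) (hR.extendGen g') =
      A (Pi.single g 1) g' := by
  constructor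
  · intro h g g'
    rw [← h, inclusion_single, projection_apply]
  · intro h
    refine LinearMap.congr_fun (f := hR.projection ∘ₗ A' ∘ₗ hR.inclusion) (g := A) (end_ext fun g => ?_)
    ext g'
    rw [LinearMap.comp_apply, LinearMap.comp_apply, inclusion_single, projection_apply, h]

theorem isCorner_component {A : Module.End F2 D.Chain} {A' : Module.End F2 D'.Chain}
    (h : hR.IsCorner A A') (d : ℤ) : hR.IsCorner (component weight d A) (component weight d A') := by
  classical
  rw [isCorner_iff] at h ⊢
  intro g g'
  rw [component_single, component_single, h, hR.weight_extendGen, hR.weight_extendGen]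
  congr 1
  exact propext ⟨fun h => by omega, fun h => by omega⟩

theorem isCorner_total : hR.IsCorner D.total D'.total := by
  classical
  rw [isCorner_iff]
  intro g g'
  rw [total, total, linOfRel_single, linOfRel_single]
  simp only [hR.exists_totalEdge_extendGen]

theorem isCorner_labelOp : hR.IsCorner D.labelOp D'.labelOp := by
  classical
  rw [isCorner_iff]
  intro g g'
  rw [labelOp, labelOp, LinearMap.sum_apply, LinearMap.sum_apply, Finset.sum_apply, Finset.sum_apply,
    sum_outer eX eM]
  · refine Finset.sum_congr rfl fun a _ => ?_
    rw [LinearMap.smul_apply, LinearMap.smul_apply, toggleOp_single, toggleOp_single,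
      hR.toggle_extendGen, Pi.smul_apply, Pi.smul_apply, hR.cut, Pi.single_apply, Pi.single_apply]
    simp only [hR.extendGen_injective.eq_iff]
  · intro a ha
    rw [hR.bigon.cut_inner ha, zero_smul]
    rfl

theorem isCorner_act {b : SlBasis} (h0 : b ≠ .v0) (hx : b ≠ .x) :
    hR.IsCorner (D.act b) (D'.act b) := by
  have ht (d : ℤ) := hR.isCorner_component hR.isCorner_total d
  have hl (d : ℤ) := hR.isCorner_component hR.isCorner_labelOp d
  have he : hR.IsCorner D.actE D'.actE := by rw [actE_eq, actE_eq]; exact hl _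
  have hf : hR.IsCorner D.actF D'.actF := by rw [actF_eq, actF_eq]; exact hl _
  have hh : hR.IsCorner D.actH D'.actH := by
    rw [actH_eq, actH_eq, hR.totalCut_eq]
    exact fun m => congrArg (D.totalCut • ·) (hR.projection_inclusion m)
  have hp : hR.IsCorner D.leePlus D'.leePlus := by rw [leePlus_eq, leePlus_eq]; exact ht _
  have hm : hR.IsCorner D.dMinus D'.dMinus := by rw [dMinus_eq, dMinus_eq]; exact ht _
  have hd : hR.IsCorner D.dZero D'.dZero := by rw [dZero_eq, dZero_eq]; exact ht _
  have hl : hR.IsCorner D.leeZero D'.leeZero := by rw [leeZero_eq, leeZero_eq]; exact ht _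
  cases b
  exacts [he, hf, hh, hp, hm, absurd rfl h0, hd, hl, absurd rfl hx]

/-- The anticommutator of the cancelled part with its inverse is the identity off the corner and
zero on it, so adding it to the identity leaves the projection to the corner. -/
theorem decomposition (m : D'.Chain) : hR.inclusion (hR.projection m) = m +
    bigonOp (eX.symm (.inr false)) (eX.symm (.inr true))
      (bigonHomotopy (eX.symm (.inr false)) (eX.symm (.inr true)) m) +
    bigonHomotopy (eX.symm (.inr false)) (eX.symm (.inr true))
      (bigonOp (eX.symm (.inr false)) (eX.symm (.inr true)) m) := by
  classical
  refine LinearMap.congr_fun (f := hR.inclusion ∘ₗ hR.projection) (g := 1 +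
    bigonOp (eX.symm (.inr false)) (eX.symm (.inr true)) ∘ₗ
      bigonHomotopy (eX.symm (.inr false)) (eX.symm (.inr true)) +
    bigonHomotopy (eX.symm (.inr false)) (eX.symm (.inr true)) ∘ₗ
      bigonOp (eX.symm (.inr false)) (eX.symm (.inr true))) (end_ext fun g => ?_) m
  have h := hR.bigon.bigon_anticommutator_single g
  simp only [LinearMap.add_apply, LinearMap.comp_apply, Module.End.one_apply]
  rw [add_assoc, h]
  ext g'
  rw [inclusion_projection, Pi.add_apply, Pi.single_apply]
  by_cases hg : g' = g
  · subst hg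
    rw [if_pos rfl]
    split_ifs <;> simp [CharTwo.add_self_eq_zero]
  · rw [if_neg hg, ite_self, zero_add]
    split_ifs <;> simp [hg]

/-- The contraction of the complex of `D'` onto the complex of `D`. -/
noncomputable def contraction : Contraction D.dZero D.actLin D'.dZero D'.actLin where
  ι := hR.inclusion
  π := hR.projection
  H := bigonHomotopy (eX.symm (.inr false)) (eX.symm (.inr true))
  N := supportedIn (BigonPlus (eX.symm (.inr false)) (eX.symm (.inr true)))
  Q := supportedIn (BigonNotMinus (eX.symm (.inr false)) (eX.symm (.inr true)))
  π_ι := hR.projection_inclusion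
  π_H m := hR.projection_eq_zero (supportedIn_mono
    (fun g h h' => absurd (h.1.symm.trans h'.2) (by decide)) (bigonHomotopy_mem m))
  H_ι m := bigonHomotopy_eq_zero (supportedIn_mono
    (fun g h h' => absurd (h.1.symm.trans h'.1) (by decide)) (hR.inclusion_mem m))
  H_H := bigonHomotopy_bigonHomotopy
  cc m := LinearMap.congr_fun total_relations.1 m
  homotopy m := by
    set H := bigonHomotopy (eX.symm (.inr false)) (eX.symm (.inr true))
    set s := bigonOp (eX.symm (.inr false)) (eX.symm (.inr true))
    have hcc (m : D'.Chain) : D'.dZero (D'.dZero m) = 0 := LinearMap.congr_fun total_relations.1 m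
    have hHcH (m : D'.Chain) : H (D'.dZero (H m)) = H m :=
      hR.bigon.bigonHomotopy_dZero_bigonHomotopy m
    rw [← map_add hR.projection]
    -- For this `n`, `H ∂₀ H = H` gives `H n = 0`, and `∂₀² = 0` gives `∂₀ n = ∂₀ m`.
    obtain ⟨n, hn⟩ : ∃ n, n = m + D'.dZero (H m) := ⟨_, rfl⟩
    rw [← hn]
    have hHn : H n = 0 := by rw [hn, map_add, hHcH, add_self_F2]
    have hcn : D'.dZero n = D'.dZero m := by rw [hn, map_add, hcc, add_zero]
    -- Since `H n = 0`, the corner part of `n` is `n + H s n`; applying `H ∂₀ H = H` once more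
    -- produces a second `H s n`, and the two cancel.
    rw [hR.decomposition n]
    change n + H (D'.dZero m) = n + s (H n) + H (s n) + H (D'.dZero (n + s (H n) + H (s n)))
    rw [hHn, map_zero, add_zero, map_add, map_add, hHcH, hcn]
    have := add_self_F2 (H (s n))
    linear_combination (norm := module) -this
  H_N m hm := bigonHomotopy_eq_zero (supportedIn_mono
    (fun g h h' => absurd (h.2.2.symm.trans (h'.2 h.2.1)) (by decide)) hm)
  π_N m hm := hR.projection_eq_zero (supportedIn_mono
    (fun g h h' => absurd (h.1.symm.trans h'.1) (by decide)) hm)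
  -- A target without a small circle labelled `-` has both new crossings 1-resolved, and its partner
  -- has the small circle labelled `+`.
  H_Q m hm := linOfRel_mem_supportedIn (fun g g' h h' => by
    rcases hR.bigon.bigonEdge_cases h' with ⟨a1, a2, a3, a4, a5, a6⟩ | ⟨a1, a2, a3, a4, a5, a6⟩
    · rw [hR.bigon.label_two a2, h a2 a3] at a5
      exact absurd a5 (by decide)
    · exact ⟨a1, a2, (hR.bigon.label_zero a1).symm.trans a5⟩) hm
  H_mem m := supportedIn_mono (fun g h hb _ => h.2 hb) (bigonHomotopy_mem m)
  ι_mem m := supportedIn_mono (fun g h hb _ => absurd (hb.symm.trans h.1) (by decide))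
    (hR.inclusion_mem m)
  -- On the corner the top crossing is 1-resolved; edges keep it so, and then there is no small
  -- circle.
  c_ι_mem m := by
    rw [dZero_eq_linOfRel]
    refine linOfRel_mem_supportedIn (fun g g' h h' _ ht => ?_) (hR.inclusion_mem m)
    obtain ⟨⟨x, hx⟩, -⟩ := h'
    exact absurd (ht.symm.trans (hx.not_of_true h.2)) (by decide)
  -- Edges keep the 1-resolution of the bottom crossing, whereas on the corner this crossing is
  -- 0-resolved.
  π_c_N m hm := by
    refine hR.projection_eq_zero ?_
    rw [dZero_eq_linOfRel]
    refine linOfRel_mem_supportedIn (fun g g' h h' hg' => ?_) hm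
    obtain ⟨⟨x, hx⟩, -⟩ := h'
    exact absurd (hg'.1.symm.trans (hx.not_of_true h.1)) (by decide)
  act_N b hb m hm := by
    rw [actLin_single]
    exact (hR.bigon.preservesBigon_act hb).1 m hm
  act_Q b hb m hm := by
    rw [actLin_single]
    exact (hR.bigon.preservesBigon_act hb).2 m hm
  r_d := actLin_single .d
  r_d' := actLin_single .d
  r_eq b h0 hx m := by
    rw [actLin_single, actLin_single]
    exact hR.isCorner_act h0 hx m
  br a b m := by
    rw [actLin_single, actLin_single]
    exact LinearMap.congr_fun (act_bracket a b) m
  br' a b m := by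
    rw [actLin_single, actLin_single]
    exact LinearMap.congr_fun (act_bracket a b) m

theorem bigonHomotopy_mem_gr (m : D'.Chain) (e : ℤ) (hm : m ∈ D'.CKh.gr e) :
    bigonHomotopy (eX.symm (.inr false)) (eX.symm (.inr true)) m ∈ D'.CKh.gr (e - 1) := by
  have h := bigonHomotopy_homDeg (b := eX.symm (.inr false)) (t := eX.symm (.inr true)) e m hm
  rwa [neg_add_eq_sub] at h

include hR in
theorem exists_quasiIso : ∃ h : LInfModuleHom sl2dg D.CKh D'.CKh, h.IsQuasiIso := by
  refine hR.contraction.exists_quasiIso_incl CKh_op CKh_op actLin_mem (fun m e hm g hg => ?_)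
    bigonHomotopy_mem_gr
  obtain ⟨hb, ht⟩ := hR.inclusion_mem m g hg
  obtain ⟨g, rfl⟩ := hR.exists_extendGen hb ht
  rw [hR.homDeg_extendGen]
  exact hm g fun h => hg ((hR.inclusion_extendGen m g).trans h)

include hR in
theorem exists_quasiIso' : ∃ h : LInfModuleHom sl2dg D'.CKh D.CKh, h.IsQuasiIso := by
  refine hR.contraction.exists_quasiIso_proj CKh_op CKh_op actLin_mem (fun m e hm g hg => ?_)
    bigonHomotopy_mem_gr
  rw [← hR.homDeg_extendGen]
  exact hm _ hg

end IsReidemeisterII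

theorem ReidemeisterII.exists_isReidemeisterII (h : ReidemeisterII D D') :
    ∃ (eX : D'.Crossing ≃ D.Crossing ⊕ Bool) (eM : D.Marker ≃ D'.Marker ⊕ Bool),
      IsReidemeisterII eX eM := by
  obtain ⟨eX, eM, h1, h2, h3, h4, h5, h6, h7, h8, h9⟩ := h
  exact ⟨eX, eM, h1, h2, h3, by simp, h4, h5, h6, h7, h8, h9⟩

end AnnularDiagram

theorem mainTheorem7 (D D' : AnnularDiagram) (hR : AnnularDiagram.ReidemeisterII D D') :
    sl2dg.IsLInfAlgebra ∧ D.CKh.IsLInfModule sl2dg ∧ D'.CKh.IsLInfModule sl2dg ∧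
      (∃ h : LInfModuleHom sl2dg D.CKh D'.CKh, h.IsQuasiIso) ∧
      (∃ h : LInfModuleHom sl2dg D'.CKh D.CKh, h.IsQuasiIso) := by
  obtain ⟨eX, eM, h⟩ := hR.exists_isReidemeisterII
  exact ⟨sl2dg_isLInfAlgebra, D.CKh_isLInfModule, D'.CKh_isLInfModule, h.exists_quasiIso,
    h.exists_quasiIso'⟩
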